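/- Let $H$ (resp. $\hat H$) be the group of isometries of $\mathbb R^2$ generated by the $\pi$-rotations about the points of $\mathbb Z^2$ (resp. $(\tfrac12\mathbb Z)^2$). Let $S=(\mathbb R^2-\mathbb Z^2)/H$ be the four-times punctured Conway sphere and let $\mathcal O=(\mathbb R^2-\mathbb Z^2)/\hat H$, the $(2,2,2,\infty)$-orbifold; $S$ is a $(\mathbb Z/2\mathbb Z)^2$-covering of $\mathcal O$. For $s\in\mathbb Q\cup\{\infty\}$ let $\alpha_s\subset S$ and $\beta_s\subset\mathcal O$ be the simple loops that are the images of lines of slope $s$ avoiding $\mathbb Z^2$ and $(\tfrac12\mathbb Z)^2$, respectively. Orbifolds are taken without boundary (a compact orbifold with boundary is replaced by its interior), and $\pi_1$ denotes the orbifold fundamental group. Let $r\in\mathbb Q$. * For an integer $n>1$, the even Heckoid orbifold $\mathbf S(r;n)$ is the $3$-orbifold whose underlying space is the complement of the $2$-bridge link $K(r)$, where $(S^3,K(r))=(B^3,t(\infty))\cup(B^3,t(r))$ is the sum along the Conway sphere of the rational tangles of slopes $\infty$ and $r$, and whose singular set is the lower tunnel (the core tunnel of $(B^3,t(r))$), with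 index $n$. The even Heckoid group is $G(r;n)=\pi_1(\mathbf S(r;n))$. * For an integer $m\ge 2$, the orbifold $\mathbf B(r;m)$ is obtained from $\mathcal O\times[0,1]$ by attaching a $2$-handle orbifold $D^2(m)\times I$ along $\beta_r\times\{0\}$, where $D^2(m)$ is the quotient of the disk by the rotation group of order $m$, and capping off the spherical boundary component $S^2(2,2,m)$ by the quotient of the $3$-ball by the dihedral group of order $2m$; $\mathbf B(\infty;m)$ is defined in the same way with $\beta_\infty$. The orbifold $\mathbf O(r;m)$ is obtained by gluing $\mathbf B(\infty;2)$ and $\mathbf B(r;m)$ along $\mathcal O\times\{1\}$ by the identity. **Proposition.** Let $r$ be a rational number, let $n>1$ be an integer, and let $m=2n$. Then the natural map $\mathbf S(r;n)\to\mathbf O(r;m)$ that extends the covering $S\to\mathcal O$ is a $(\mathbb Z/2\mathbb Z)^2$-covering of orbifolds: it is a connected orbifold covering, and its group of covering transformations is isomorphic to $(\mathbb Z/2\mathbb Z)^2$ and acts transitively on every fibre. In particular, the induced homomorphism $G(r;n)=\pi_1(\mathbf S(r;n))\to\pi_1(\mathbf O(r;m))$ is injective, and its image is the image of the composition of natural homomorphisms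 $$\psi:\ \pi_1(S)\to\pi_1(\mathcal O)\to\pi_1(\mathbf O(r;m)),$$ so that $G(r;n)$ is identified with $\operatorname{Im}(\psi)$. -/

import Mathlib

open CategoryTheory Topology Set

noncomputable section

/-! ## Orbifolds, coverings and orbifold fundamental groups -/

/-- The data of an orbifold atlas. `carrier` is the underlying space, `dom` is the disjoint union of
the (manifold) domains of the uniformizing charts, and `proj` is the union of the chart maps. -/
structure OrbAtlas where
  carrier : Type
  dom : Type
  [topCarrier : TopologicalSpace carrier]
  [topDom : TopologicalSpace dom]
  proj : dom → carrier

attribute [instance] OrbAtlas.topCarrier OrbAtlas.topDom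

namespace OrbAtlas

/-- A change of charts: a homeomorphism between open subsets of the disjoint union of the chart
domains which commutes with the chart maps. -/
def IsTransition (X : OrbAtlas) (h : OpenPartialHomeomorph X.dom X.dom) : Prop :=
  ∀ w ∈ h.source, X.proj (h w) = X.proj w

/-- The pseudogroup of changes of charts. -/
def Transition (X : OrbAtlas) : Type := {h : OpenPartialHomeomorph X.dom X.dom // X.IsTransition h}

/-- Composition of changes of charts (first `h`, then `k`), defined where it makes sense. -/
def Transition.comp {X : OrbAtlas} (h k : X.Transition) : X.Transition :=
  ⟨h.1.trans k.1, fun w hw => by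
    rw [OpenPartialHomeomorph.trans_source] at hw
    rw [OpenPartialHomeomorph.coe_trans, Function.comp_apply, k.2 _ hw.2, h.2 _ hw.1]⟩

/-- `X` is a `d`-dimensional orbifold (without boundary): the underlying space is Hausdorff and
second countable, every chart point `u` has a neighbourhood which is identified with an invariant
neighbourhood of `0` in `ℝ^d` under a finite group `G` of linear isometries, in such a way that the
chart map is the quotient map by `G`, and any two chart points lying over the same point
are related by a change of charts. -/
structure IsOrbifold (d : ℕ) (X : OrbAtlas) : Prop where
  t2 : T2Space X.carrier
  secondCountable : SecondCountableTopology X.carrier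
  continuous_proj : Continuous X.proj
  isOpenMap_proj : IsOpenMap X.proj
  surjective_proj : Function.Surjective X.proj
  local_model : ∀ u : X.dom,
    ∃ (G : Subgroup (EuclideanSpace ℝ (Fin d) ≃ₗᵢ[ℝ] EuclideanSpace ℝ (Fin d)))
      (e : OpenPartialHomeomorph X.dom (EuclideanSpace ℝ (Fin d))),
      Finite G ∧ u ∈ e.source ∧ e u = 0 ∧
      (∀ g ∈ G, ∀ x ∈ e.target, g x ∈ e.target) ∧
      ∀ w ∈ e.source, ∀ w' ∈ e.source, X.proj w = X.proj w' ↔ ∃ g ∈ G, g (e w) = e w'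
  compatible : ∀ u v : X.dom, X.proj u = X.proj v →
    ∃ h : X.Transition, u ∈ h.1.source ∧ h.1 u = v

/-- `f : W → |X|` is an orbifold chart of `X` with group `G`: its fibres are the `G`-orbits, and it is
compatible with the atlas of `X`. -/
def IsChart (X : OrbAtlas) {W : Type} [TopologicalSpace W] (G : Subgroup (W ≃ₜ W))
    (f : W → X.carrier) : Prop :=
  (∀ w w' : W, f w = f w' ↔ ∃ g ∈ G, g w = w') ∧
  ∀ (w : W) (u : X.dom), f w = X.proj u →
    ∃ k : OpenPartialHomeomorph W X.dom, w ∈ k.source ∧ k w = u ∧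
      ∀ x ∈ k.source, X.proj (k x) = f x

/-- Orbifold coverings of `d`-dimensional orbifolds, in the sense of Thurston: every point of `|Y|`
has a neighbourhood `V` with a chart `f : W → W / G = V` such that every component of the preimage
of `V` has a chart of the form `f' : W → W / G'` with `G' ≤ G` and `p ∘ f' = f`. -/
structure IsOrbifoldCovering (d : ℕ) {X Y : OrbAtlas} (p : X.carrier → Y.carrier) : Prop where
  continuous : Continuous p
  surjective : Function.Surjective p
  locally_quotient : ∀ y : Y.carrier,
    ∃ (W : TopologicalSpace.Opens (EuclideanSpace ℝ (Fin d))) (G : Subgroup (W ≃ₜ W))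
      (f : W → Y.carrier), ConnectedSpace W ∧ Finite G ∧ Y.IsChart G f ∧ y ∈ range f ∧
      ∀ x : X.carrier, p x ∈ range f →
        ∃ (G' : Subgroup (W ≃ₜ W)) (f' : W → X.carrier), G' ≤ G ∧ X.IsChart G' f' ∧
          range f' = connectedComponentIn (p ⁻¹' range f) x ∧ ∀ w, p (f' w) = f w

/-- A self-homeomorphism of the underlying space is an orbifold automorphism if it lifts locally
to homeomorphisms between chart domains. -/
def IsAutomorphism (X : OrbAtlas) (h : X.carrier ≃ₜ X.carrier) : Prop :=
  ∀ u v : X.dom, h (X.proj u) = X.proj v →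
    ∃ k : OpenPartialHomeomorph X.dom X.dom, u ∈ k.source ∧ k u = v ∧
      ∀ w ∈ k.source, X.proj (k w) = h (X.proj w)

/-- `p` is a `Γ`-covering: a connected orbifold covering whose group of
covering transformations is isomorphic to `Γ` and acts transitively on every fibre. -/
def IsRegularCovering (d : ℕ) (Γ : Type) [Group Γ] {X Y : OrbAtlas}
    (p : X.carrier → Y.carrier) : Prop :=
  IsOrbifoldCovering d p ∧ ConnectedSpace X.carrier ∧
  ∃ ρ : Γ →* (X.carrier ≃ₜ X.carrier), Function.Injective ρ ∧
    (∀ h : X.carrier ≃ₜ X.carrier, h ∈ ρ.range ↔ X.IsAutomorphism h ∧ ∀ x, p (h x) = p x) ∧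
    ∀ x x' : X.carrier, p x = p x' → ∃ g : Γ, ρ g x = x'

/-- Chart points, regarded as the vertices of a quiver. -/
structure Pt (X : OrbAtlas) where
  pt : X.dom

/-- The elementary pieces of orbifold paths: paths in chart domains, and jumps from a chart point
`u` to `h u` along a change of charts `h`. -/
inductive Step (X : OrbAtlas) : X.Pt → X.Pt → Type
  | path {u v : X.dom} (γ : Path u v) : Step X ⟨u⟩ ⟨v⟩
  | jump {u v : X.dom} (h : X.Transition) (hu : u ∈ h.1.source) (hv : h.1 u = v) : Step X ⟨u⟩ ⟨v⟩

instance (X : OrbAtlas) : Quiver X.Pt := ⟨X.Step⟩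

/-- The class of a path in a chart domain in the free groupoid on the elementary pieces. -/
def pathArrow (X : OrbAtlas) {u v : X.dom} (γ : Path u v) :
    (Quiver.FreeGroupoid.of X.Pt).obj ⟨u⟩ ⟶ (Quiver.FreeGroupoid.of X.Pt).obj ⟨v⟩ :=
  (Quiver.FreeGroupoid.of X.Pt).map (Step.path γ : (⟨u⟩ : X.Pt) ⟶ ⟨v⟩)

/-- The class of a jump in the free groupoid on the elementary pieces. -/
def jumpArrow (X : OrbAtlas) {u v : X.dom} (h : X.Transition) (hu : u ∈ h.1.source)
    (hv : h.1 u = v) :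
    (Quiver.FreeGroupoid.of X.Pt).obj ⟨u⟩ ⟶ (Quiver.FreeGroupoid.of X.Pt).obj ⟨v⟩ :=
  (Quiver.FreeGroupoid.of X.Pt).map (Step.jump h hu hv : (⟨u⟩ : X.Pt) ⟶ ⟨v⟩)

/-- The relations which generate homotopy of orbifold paths (Haefliger): homotopy and concatenation
of paths inside chart domains; composition of jumps; a jump only depends on the germ of the change of
charts; and a path may be moved through a change of charts. -/
inductive HomotopyRel (X : OrbAtlas) : HomRel (Quiver.FreeGroupoid X.Pt)
  | homotopic {u v : X.dom} (γ δ : Path u v) (H : γ.Homotopic δ) :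
      HomotopyRel X (X.pathArrow γ) (X.pathArrow δ)
  | trans {u v w : X.dom} (γ : Path u v) (δ : Path v w) :
      HomotopyRel X (X.pathArrow γ ≫ X.pathArrow δ) (X.pathArrow (γ.trans δ))
  | comp {u v w : X.dom} (h k : X.Transition) (hu : u ∈ h.1.source) (hv : h.1 u = v)
      (ku : v ∈ k.1.source) (kv : k.1 v = w) (cu : u ∈ (h.comp k).1.source)
      (cv : (h.comp k).1 u = w) :
      HomotopyRel X (X.jumpArrow h hu hv ≫ X.jumpArrow k ku kv) (X.jumpArrow (h.comp k) cu cv)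
  | germ {u v : X.dom} (h k : X.Transition) (hu : u ∈ h.1.source) (hv : h.1 u = v)
      (ku : u ∈ k.1.source) (kv : k.1 u = v) (H : h.1 =ᶠ[𝓝 u] k.1) :
      HomotopyRel X (X.jumpArrow h hu hv) (X.jumpArrow k ku kv)
  | slide {u v u' v' : X.dom} (h : X.Transition) (hu : u ∈ h.1.source) (hv : v ∈ h.1.source)
      (hu' : h.1 u = u') (hv' : h.1 v = v') (γ : Path u v) (γ' : Path u' v')
      (hs : ∀ t, γ t ∈ h.1.source) (hγ : ∀ t, γ' t = h.1 (γ t)) :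
      HomotopyRel X (X.pathArrow γ ≫ X.jumpArrow h hv hv') (X.jumpArrow h hu hu' ≫ X.pathArrow γ')

/-- The orbifold fundamental groupoid (on the set of chart points). -/
abbrev FundGpd (X : OrbAtlas) : Type := CategoryTheory.Quotient X.HomotopyRel

/-- A chart point as an object of the orbifold fundamental groupoid. -/
def obj (X : OrbAtlas) (u : X.dom) : X.FundGpd := ⟨(Quiver.FreeGroupoid.of X.Pt).obj ⟨u⟩⟩

/-- The orbifold fundamental group, based at the chart point `u`: homotopy classes of orbifold loops.
The product is concatenation. -/
abbrev Pi1 (X : OrbAtlas) (u : X.dom) : Type := X.obj u ⟶ X.obj u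

/-- Maps of orbifolds: a map of the underlying spaces, a continuous lift of it to the chart domains,
and a compatible assignment of changes of charts to changes of charts, which respects germs and
composition. -/
structure Hom (X Y : OrbAtlas) where
  base : X.carrier → Y.carrier
  lift : X.dom → Y.dom
  continuous_lift : Continuous lift
  proj_lift : ∀ u, Y.proj (lift u) = base (X.proj u)
  onJump : X.Transition → Y.Transition
  mem_source : ∀ (h : X.Transition) (u : X.dom), u ∈ h.1.source → lift u ∈ (onJump h).1.source
  onJump_lift : ∀ (h : X.Transition) (u : X.dom), u ∈ h.1.source →
    (onJump h).1 (lift u) = lift (h.1 u)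
  germ : ∀ (h k : X.Transition) (u : X.dom), u ∈ h.1.source → u ∈ k.1.source →
    h.1 =ᶠ[𝓝 u] k.1 → (onJump h).1 =ᶠ[𝓝 (lift u)] (onJump k).1
  comp : ∀ (h k : X.Transition) (u : X.dom), u ∈ (h.comp k).1.source →
    (onJump (h.comp k)).1 =ᶠ[𝓝 (lift u)] ((onJump h).comp (onJump k)).1

namespace Hom

variable {X Y : OrbAtlas} (F : Hom X Y)

/-- The effect of a map of orbifolds on elementary pieces of orbifold paths. -/
def stepMap : ∀ {a b : X.Pt}, X.Step a b → Y.Step ⟨F.lift a.pt⟩ ⟨F.lift b.pt⟩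
  | _, _, Step.path γ => Step.path (γ.map F.continuous_lift)
  | _, _, Step.jump h hu hv =>
      Step.jump (F.onJump h) (F.mem_source h _ hu) ((F.onJump_lift h _ hu).trans (by rw [hv]))

/-- The effect of a map of orbifolds on elementary pieces, with values in the fundamental
groupoid. -/
def prefunctor : X.Pt ⥤q Y.FundGpd where
  obj a := Y.obj (F.lift a.pt)
  map {a b} s := (CategoryTheory.Quotient.functor Y.HomotopyRel).map
    ((Quiver.FreeGroupoid.of Y.Pt).map (F.stepMap s : (⟨F.lift a.pt⟩ : Y.Pt) ⟶ ⟨F.lift b.pt⟩))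

theorem lift_map_of {V V' : Type} [Quiver V] [Groupoid V'] (φ : V ⥤q V') {a b : V} (f : a ⟶ b) :
    (Quiver.FreeGroupoid.lift φ).map ((Quiver.FreeGroupoid.of V).map f) = φ.map f :=
  Category.id_comp _

theorem lift_respects {a b : Quiver.FreeGroupoid X.Pt} (f g : a ⟶ b) (H : X.HomotopyRel f g) :
    (Quiver.FreeGroupoid.lift F.prefunctor).map f =
      (Quiver.FreeGroupoid.lift F.prefunctor).map g := by
  cases H with
  | homotopic γ δ H =>
    simp only [pathArrow, lift_map_of]
    exact CategoryTheory.Quotient.sound _ (HomotopyRel.homotopic _ _ (H.map ⟨F.lift, F.continuous_lift⟩))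
  | trans γ δ =>
    rw [Functor.map_comp]
    simp only [pathArrow, lift_map_of]
    have := CategoryTheory.Quotient.sound _
      (HomotopyRel.trans (γ.map F.continuous_lift) (δ.map F.continuous_lift))
    rw [← Path.map_trans, Functor.map_comp] at this
    exact this
  | @comp u v w h k hu hv ku kv cu cv =>
    rw [Functor.map_comp]
    simp only [jumpArrow, lift_map_of]
    have hcu : F.lift u ∈ ((F.onJump h).comp (F.onJump k)).1.source :=
      ⟨F.mem_source h _ hu, by
        change (F.onJump h).1 (F.lift u) ∈ (F.onJump k).1.source
        rw [F.onJump_lift h _ hu, hv]; exact F.mem_source k _ ku⟩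
    have hcv : ((F.onJump h).comp (F.onJump k)).1 (F.lift u) = F.lift w := by
      change (F.onJump k).1 ((F.onJump h).1 (F.lift u)) = _
      rw [F.onJump_lift h _ hu, hv, F.onJump_lift k _ ku, kv]
    have h1 := CategoryTheory.Quotient.sound _
      (HomotopyRel.comp (F.onJump h) (F.onJump k) (F.mem_source h _ hu)
        ((F.onJump_lift h _ hu).trans (by rw [hv])) (F.mem_source k _ ku)
        ((F.onJump_lift k _ ku).trans (by rw [kv])) hcu hcv)
    have h2 := CategoryTheory.Quotient.sound _
      (HomotopyRel.germ (F.onJump (h.comp k)) ((F.onJump h).comp (F.onJump k))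
        (F.mem_source _ _ cu) ((F.onJump_lift _ _ cu).trans (by rw [cv])) hcu hcv
        (F.comp h k _ cu))
    rw [Functor.map_comp] at h1
    exact h1.trans h2.symm
  | germ h k hu hv ku kv H =>
    simp only [jumpArrow, lift_map_of]
    exact CategoryTheory.Quotient.sound _
      (HomotopyRel.germ _ _ (F.mem_source _ _ hu) ((F.onJump_lift h _ hu).trans (by rw [hv]))
        (F.mem_source _ _ ku) ((F.onJump_lift k _ ku).trans (by rw [kv])) (F.germ h k _ hu ku H))
  | slide h hu hv hu' hv' γ γ' hs hγ =>
    rw [Functor.map_comp, Functor.map_comp]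
    simp only [jumpArrow, pathArrow, lift_map_of]
    have := CategoryTheory.Quotient.sound _
      (HomotopyRel.slide (F.onJump h) (F.mem_source _ _ hu) (F.mem_source _ _ hv)
        ((F.onJump_lift h _ hu).trans (by rw [hu'])) ((F.onJump_lift h _ hv).trans (by rw [hv']))
        (γ.map F.continuous_lift) (γ'.map F.continuous_lift)
        (fun t => F.mem_source _ _ (hs t))
        (fun t => by
          change F.lift (γ' t) = (F.onJump h).1 (F.lift (γ t))
          rw [F.onJump_lift h _ (hs t), hγ]))
    rw [Functor.map_comp, Functor.map_comp] at this
    exact this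

/-- The functor between fundamental groupoids induced by a map of orbifolds. -/
def functor : X.FundGpd ⥤ Y.FundGpd :=
  CategoryTheory.Quotient.lift _ (Quiver.FreeGroupoid.lift F.prefunctor) fun _ _ f g H => F.lift_respects f g H

/-- The homomorphism between orbifold fundamental groups induced by a map of orbifolds. -/
def pi1Map (u : X.dom) : X.Pi1 u →* Y.Pi1 (F.lift u) :=
  F.functor.mapVertexGroup (X.obj u)

end Hom
end OrbAtlas

/-! ## The Conway sphere and the `(2,2,2,∞)`-orbifold -/

/-- The Euclidean plane. -/
abbrev Plane : Type := EuclideanSpace ℝ (Fin 2)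

/-- Points of the lattice `ℤ²`. -/
def IsLattice (v : Plane) : Prop := ∃ a b : ℤ, v 0 = a ∧ v 1 = b

/-- The group of isometries of the plane generated by the `π`-rotations about the points of `(c ℤ)²`. -/
def halfTurnGroup (c : ℝ) : Subgroup (Plane ≃ᵃⁱ[ℝ] Plane) :=
  Subgroup.closure {g | ∃ a b : ℤ, g = AffineIsometryEquiv.pointReflection ℝ !₂[c * a, c * b]}

/-- The complement of `ℤ²` in the plane. -/
abbrev PuncturedPlane : Type := {v : Plane // ¬ IsLattice v}

/-- The quotient orbifold of `ℝ² - ℤ²` by `halfTurnGroup c`. -/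
def planeQuotient (c : ℝ) : OrbAtlas where
  carrier := Quot fun v w : PuncturedPlane => ∃ g ∈ halfTurnGroup c, g v.1 = w.1
  dom := PuncturedPlane
  proj := Quot.mk _

/-- The four-times punctured Conway sphere `(ℝ² - ℤ²) / H`, where `H` is generated by the
`π`-rotations about the points of `ℤ²`. -/
abbrev puncturedConway : OrbAtlas := planeQuotient 1

/-- The `(2,2,2,∞)`-orbifold `(ℝ² - ℤ²) / Ĥ`, where `Ĥ` is generated by the `π`-rotations about the
points of `(½ ℤ)²`. -/
abbrev orbifoldO : OrbAtlas := planeQuotient (1 / 2)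

/-! ## Sums of rational tangles -/

/-- A direction vector of the lines of slope `∞`. -/
def dirInfty : Plane := !₂[0, 1]

/-- A primitive integral direction vector of the lines of slope `r`. -/
def dirSlope (r : ℚ) : Plane := !₂[(r.den : ℝ), (r.num : ℝ)]

/-- The linear functional whose level sets are the lines with direction `d`. For `d` primitive
integral, its values on `ℤ²` are the integers. -/
def height (d v : Plane) : ℝ := d 1 * v 0 - d 0 * v 1

/-- The point at position `k` on the line `height d = l`. -/
def linePoint (d : Plane) (k l : ℝ) : Plane :=
  k • d + (l / (d 0 ^ 2 + d 1 ^ 2)) • !₂[d 1, -d 0]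

/-- Representatives of the points of the sum of the rational tangles of slopes `∞` and `r` which do
not lie over lattice points: the point `(v, s)` of `ℝ² × [-1, 1]` is excluded if `v` is a lattice
point, or if `s = 1` and the line of slope `∞` through `v` contains a lattice point, or if `s = -1`
and the line of slope `r` through `v` contains a lattice point. -/
structure TanglePt (r : ℚ) where
  v : Plane
  s : ℝ
  mem : s ∈ Icc (-1 : ℝ) 1
  off_lattice : ¬ IsLattice v
  off_top : s = 1 → ∀ j : ℤ, height dirInfty v ≠ j
  off_bot : s = -1 → ∀ j : ℤ, height (dirSlope r) v ≠ j

instance (r : ℚ) : TopologicalSpace (TanglePt r) :=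
  TopologicalSpace.induced (fun x => (x.v, x.s)) inferInstance

/-- Identifications: `(v, s)` is identified with `(g v, s)` for `g` in the group `halfTurnGroup c`; at
the upper end `s = 1` every line of slope `∞` is collapsed to a point, and at the lower end `s = -1`
every line of slope `r` is collapsed to a point. -/
def TanglePt.Rel (c : ℝ) (r : ℚ) (x y : TanglePt r) : Prop :=
  x.s = y.s ∧ ∃ g ∈ halfTurnGroup c,
    g x.v = y.v ∨ (x.s = 1 ∧ height dirInfty (g x.v) = height dirInfty y.v) ∨
      (x.s = -1 ∧ height (dirSlope r) (g x.v) = height (dirSlope r) y.v)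

/-- The product of the open unit disk with an open interval. -/
abbrev OpenHandle : Type := Metric.ball (0 : ℂ) 1 × Ioo (0 : ℝ) 1

theorem height_linePoint (d : Plane) (hd : d 0 ^ 2 + d 1 ^ 2 ≠ 0) (k l : ℝ) :
    height d (linePoint d k l) = l := by
  simp [height, linePoint]
  field_simp
  ring

theorem not_int_of_mem_Ioo {l : ℝ} (hl : l ∈ Ioo (0 : ℝ) 1) (j : ℤ) : l ≠ j := by
  rintro rfl
  have h0 : (0 : ℤ) < j := by exact_mod_cast hl.1
  have h1 : j < (1 : ℤ) := by exact_mod_cast hl.2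
  omega

theorem dirInfty_ne : dirInfty 0 ^ 2 + dirInfty 1 ^ 2 ≠ 0 := by simp [dirInfty]

theorem dirSlope_ne (r : ℚ) : dirSlope r 0 ^ 2 + dirSlope r 1 ^ 2 ≠ 0 := by
  have : (0 : ℝ) < r.den := by exact_mod_cast r.den_pos
  simp only [dirSlope, Matrix.cons_val_zero, Matrix.cons_val_one]
  positivity

/-- The point of the upper tangle with handle coordinates `(z, l)`; the boundary circle of the disk
runs `a` times around the image of the line of slope `∞` at height `l`, on which
`halfTurnGroup c` acts by translations by `2 * c`. -/
def topPoint (c : ℝ) (r : ℚ) (a : ℕ) (x : OpenHandle) : TanglePt r where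
  v := linePoint dirInfty (2 * c * a * (Complex.arg x.1 / (2 * Real.pi))) x.2
  s := 1 - ‖(x.1 : ℂ)‖
  mem := by
    have := mem_ball_zero_iff.1 x.1.2
    have := norm_nonneg (x.1 : ℂ)
    constructor <;> linarith
  off_lattice := by
    rintro ⟨i, j, hi, hj⟩
    have h := height_linePoint dirInfty dirInfty_ne
      (2 * c * a * (Complex.arg x.1 / (2 * Real.pi))) x.2
    refine not_int_of_mem_Ioo x.2.2 i ?_
    rw [← h, height, hi, hj]
    simp [dirInfty]
  off_top _ j := by
    rw [height_linePoint _ dirInfty_ne]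
    exact not_int_of_mem_Ioo x.2.2 j
  off_bot h := by
    have := mem_ball_zero_iff.1 x.1.2
    linarith

/-- The point of the lower tangle with handle coordinates `(z, l)`; the boundary circle of the disk
runs `b` times around the image of the line of slope `r` at height `l`, on which
`halfTurnGroup c` acts by translations by `2 * c` times the direction vector. -/
def botPoint (c : ℝ) (r : ℚ) (b : ℕ) (x : OpenHandle) : TanglePt r where
  v := linePoint (dirSlope r) (2 * c * b * (Complex.arg x.1 / (2 * Real.pi))) x.2
  s := ‖(x.1 : ℂ)‖ - 1
  mem := by
    have := mem_ball_zero_iff.1 x.1.2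
    have := norm_nonneg (x.1 : ℂ)
    constructor <;> linarith
  off_lattice := by
    rintro ⟨i, j, hi, hj⟩
    have h := height_linePoint (dirSlope r) (dirSlope_ne r)
      (2 * c * b * (Complex.arg x.1 / (2 * Real.pi))) x.2
    refine not_int_of_mem_Ioo x.2.2 (r.num * i - r.den * j) ?_
    rw [← h, height, hi, hj]
    simp [dirSlope]
  off_top h := by
    have := mem_ball_zero_iff.1 x.1.2
    linarith
  off_bot _ j := by
    rw [height_linePoint _ (dirSlope_ne r)]
    exact not_int_of_mem_Ioo x.2.2 j

/-- A representative in the middle part. -/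
def midPoint (r : ℚ) (x : PuncturedPlane × Ioo (-1 : ℝ) 1) : TanglePt r where
  v := x.1.1
  s := x.2.1
  mem := ⟨x.2.2.1.le, x.2.2.2.le⟩
  off_lattice := x.1.2
  off_top h := absurd h x.2.2.2.ne
  off_bot h := absurd h x.2.2.1.ne'

/-- The (interior of the) `3`-orbifold obtained from two rational tangles of slopes `∞` and `r` whose
boundaries are identified with the quotient of `(ℝ², ℤ²)` by `halfTurnGroup c`.

Here a rational tangle of slope `r` is modelled as the product of the boundary sphere with an
interval in which, at the inner end, every line of slope `r` is collapsed to a point (so that the loops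
of slope `r` bound disks), with strings the image of `ℤ² × interval`. The upper tangle is the part
`0 ≤ s ≤ 1`, the lower tangle is the part `-1 ≤ s ≤ 0`, and the image of `ℤ² × [-1, 1]` is removed.
The core tunnels of the tangles are the images of the ends `s = 1` and `s = -1`.

The orbifold structure is given by the following charts:
* the middle part `-1 < s < 1` is the product of the quotient orbifold `planeQuotient c` with an
  interval;
* the upper tunnel has a neighbourhood with chart domain `D² × (0, 1)`; the meridian circles
  `|z| = const` of the chart run `a` times around the loop of slope `∞` in `planeQuotient c`, that is,
  an orbifold `2`-handle `D²(a) × I` is attached along this loop;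
* in the same way an orbifold `2`-handle `D²(b) × I` is attached along the loop of slope `r`.

For `c = 1` the points `(z, l)` and `(z', l')` of `D² × (0, 1)` have the same image if and only if they
differ by a rotation `z ↦ ω z`, `ω ^ b = 1`, so the image is an open `2`-handle orbifold
`D²(b) × (0, 1)`. For `c = 1 / 2` the points `(z, l)` and `(ε * conj z, 1 - l)` are also identified, for a
constant `ε` of modulus `1`, so the image is the quotient of the open ball `D² × (0, 1)` by the dihedral
group of order `2 * b`, that is, the `2`-handle orbifold together with the `3`-handle orbifold
`B³(2, 2, b)` which caps off the resulting spherical boundary component `S²(2, 2, b)`. -/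
def tangleSum (c : ℝ) (r : ℚ) (a b : ℕ) : OrbAtlas where
  carrier := Quot (TanglePt.Rel c r)
  dom := (PuncturedPlane × Ioo (-1 : ℝ) 1) ⊕ (OpenHandle ⊕ OpenHandle)
  proj := Sum.elim (fun x => Quot.mk _ (midPoint r x))
    (Sum.elim (fun x => Quot.mk _ (topPoint c r a x)) fun x => Quot.mk _ (botPoint c r b x))

/-- The even Heckoid orbifold of index `n` for the `2`-bridge link `K(r)`: the underlying space is the
complement of the link `K(r)`, which is the image of `ℤ² × [-1, 1]` in the sum
`(S³, K(r)) = (B³, t(∞)) ∪ (B³, t(r))` of the rational tangles over the Conway sphere, and the singular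
set is the lower tunnel, with index `n`. -/
def evenHeckoid (r : ℚ) (n : ℕ) : OrbAtlas := tangleSum 1 r 1 n

/-- The orbifold `O(r; m) = B(∞; 2) ∪ B(r; m)`: the orbifold `B(r; m)` is obtained from the product of the
`(2,2,2,∞)`-orbifold with an interval by attaching a `2`-handle orbifold `D²(m) × I` along the loop of
slope `r`, and capping off the spherical boundary component by a `3`-handle orbifold `B³(2, 2, m)`. -/
def quotientHeckoid (r : ℚ) (m : ℕ) : OrbAtlas := tangleSum (1 / 2) r 2 m

/-! ## The natural maps -/

theorem halfTurnGroup_le : halfTurnGroup 1 ≤ halfTurnGroup (1 / 2) := by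
  apply Subgroup.closure_mono
  rintro g ⟨a, b, rfl⟩
  refine ⟨2 * a, 2 * b, ?_⟩
  congr 2
  push_cast
  ring_nf

/-- The covering of the `(2,2,2,∞)`-orbifold by the punctured Conway sphere. -/
def conwayToO : OrbAtlas.Hom puncturedConway orbifoldO where
  base := Quot.map id fun _ _ ⟨g, hg, h⟩ => ⟨g, halfTurnGroup_le hg, h⟩
  lift := id
  continuous_lift := continuous_id
  proj_lift _ := rfl
  onJump h := ⟨h.1, fun w hw => congrArg
    (Quot.map id fun _ _ ⟨g, hg, h⟩ => ⟨g, halfTurnGroup_le hg, h⟩) (h.2 w hw)⟩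
  mem_source _ _ hu := hu
  onJump_lift _ _ _ := rfl
  germ _ _ _ _ _ H := H
  comp _ _ _ _ := Filter.EventuallyEq.rfl

theorem proj_quotientHeckoid (r : ℚ) (n : ℕ) (u : (evenHeckoid r n).dom) :
    (quotientHeckoid r (2 * n)).proj u =
      Quot.map id (fun _ _ ⟨e, g, hg, h⟩ => ⟨e, g, halfTurnGroup_le hg, h⟩)
        ((evenHeckoid r n).proj u) := by
  rcases u with u | u | u
  · rfl
  · have : topPoint (1 / 2) r 2 u = topPoint 1 r 1 u := by
      simp only [topPoint]; congr 3; push_cast; ring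
    change Quot.mk _ (topPoint (1 / 2) r 2 u) = Quot.mk _ (topPoint 1 r 1 u)
    rw [this]
  · have : botPoint (1 / 2) r (2 * n) u = botPoint 1 r n u := by
      simp only [botPoint]; congr 3; push_cast; ring
    change Quot.mk _ (botPoint (1 / 2) r (2 * n) u) = Quot.mk _ (botPoint 1 r n u)
    rw [this]

/-- The natural map from the even Heckoid orbifold of index `n` to the orbifold `O(r; 2n)`, induced by
the identity map of `ℝ² × [-1, 1]`. -/
def heckoidCovering (r : ℚ) (n : ℕ) :
    OrbAtlas.Hom (evenHeckoid r n) (quotientHeckoid r (2 * n)) where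
  base := Quot.map id fun _ _ ⟨e, g, hg, h⟩ => ⟨e, g, halfTurnGroup_le hg, h⟩
  lift := id
  continuous_lift := continuous_id
  proj_lift := proj_quotientHeckoid r n
  onJump h := ⟨h.1, fun w hw => by
    exact (proj_quotientHeckoid r n (h.1 w)).trans
      ((congrArg _ (h.2 w hw)).trans (proj_quotientHeckoid r n w).symm)⟩
  mem_source _ _ hu := hu
  onJump_lift _ _ _ := rfl
  germ _ _ _ _ _ H := H
  comp _ _ _ _ := Filter.EventuallyEq.rfl

/-- The level `0` in the middle interval. -/
def levelZero : Ioo (-1 : ℝ) 1 := ⟨0, by norm_num, by norm_num⟩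

/-- The inclusion of the middle part into the disjoint union of the chart domains, as an open partial
homeomorphism. -/
def midChart : OpenPartialHomeomorph (PuncturedPlane × Ioo (-1 : ℝ) 1)
    ((PuncturedPlane × Ioo (-1 : ℝ) 1) ⊕ (OpenHandle ⊕ OpenHandle)) where
  toFun := Sum.inl
  invFun := Sum.elim id fun _ => (⟨!₂[1 / 2, 1 / 2], fun ⟨a, _, h, _⟩ => by
    have h2 : (1 : ℝ) = 2 * a := by simp at h; linarith
    have h3 : (1 : ℤ) = 2 * a := by exact_mod_cast h2
    omega⟩, levelZero)
  source := univ
  target := range Sum.inl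
  map_source' x _ := mem_range_self x
  map_target' _ _ := mem_univ _
  left_inv' _ _ := rfl
  right_inv' := by rintro _ ⟨x, rfl⟩; rfl
  open_source := isOpen_univ
  open_target := isOpen_range_inl
  continuousOn_toFun := continuous_inl.continuousOn
  continuousOn_invFun := (continuous_id.sumElim continuous_const).continuousOn

/-- The product of a homeomorphism between open sets of `ℝ² - ℤ²` with the identity of `(-1, 1)`,
regarded as a homeomorphism between open sets of the disjoint union of the chart domains. -/
def thicken (h : OpenPartialHomeomorph PuncturedPlane PuncturedPlane) :
    OpenPartialHomeomorph ((PuncturedPlane × Ioo (-1 : ℝ) 1) ⊕ (OpenHandle ⊕ OpenHandle))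
      ((PuncturedPlane × Ioo (-1 : ℝ) 1) ⊕ (OpenHandle ⊕ OpenHandle)) :=
  midChart.symm.trans ((h.prod (OpenPartialHomeomorph.refl _)).trans midChart)

theorem thicken_inl (h : OpenPartialHomeomorph PuncturedPlane PuncturedPlane)
    (x : PuncturedPlane × Ioo (-1 : ℝ) 1) : thicken h (Sum.inl x) = Sum.inl (h x.1, x.2) := rfl

theorem mem_thicken_source (h : OpenPartialHomeomorph PuncturedPlane PuncturedPlane)
    (y : (PuncturedPlane × Ioo (-1 : ℝ) 1) ⊕ (OpenHandle ⊕ OpenHandle)) :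
    y ∈ (thicken h).source ↔ ∃ x, y = Sum.inl x ∧ x.1 ∈ h.source := by
  rcases y with x | y
  · simp [thicken, midChart]
  · simp [thicken, midChart]

theorem quot_mk_midPoint (c : ℝ) (r : ℚ) (v w : PuncturedPlane) (t : Ioo (-1 : ℝ) 1)
    (H : (planeQuotient c).proj v = (planeQuotient c).proj w) :
    Quot.mk (TanglePt.Rel c r) (midPoint r (v, t)) = Quot.mk _ (midPoint r (w, t)) :=
  congrArg (Quot.map (rb := TanglePt.Rel c r) (fun v : PuncturedPlane => midPoint r (v, t))
    fun _ _ ⟨g, hg, h⟩ => ⟨rfl, g, hg, Or.inl h⟩) H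

/-- The inclusion of the punctured sphere (orbifold) as the level `0` of the sum of two tangles. -/
def levelInclusion (c : ℝ) (r : ℚ) (a b : ℕ) :
    OrbAtlas.Hom (planeQuotient c) (tangleSum c r a b) where
  base := Quot.map (fun v : PuncturedPlane => midPoint r (v, levelZero))
    fun _ _ ⟨g, hg, h⟩ => ⟨rfl, g, hg, Or.inl h⟩
  lift v := Sum.inl (v, levelZero)
  continuous_lift := continuous_inl.comp (Continuous.prodMk_left levelZero)
  proj_lift _ := rfl
  onJump h := ⟨thicken h.1, by
    intro w hw
    obtain ⟨x, rfl, hx⟩ := (mem_thicken_source h.1 w).1 hw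
    exact quot_mk_midPoint c r _ _ x.2 (h.2 x.1 hx)⟩
  mem_source h u hu := (mem_thicken_source h.1 _).2 ⟨_, rfl, hu⟩
  onJump_lift _ _ _ := rfl
  germ h k u hu hk H := by
    have hopen : IsOpenMap (Sum.inl : PuncturedPlane × Ioo (-1 : ℝ) 1 →
      (PuncturedPlane × Ioo (-1 : ℝ) 1) ⊕ (OpenHandle ⊕ OpenHandle)) := isOpenMap_inl
    have h1 : ∀ᶠ x in 𝓝 ((u, levelZero) : PuncturedPlane × Ioo (-1 : ℝ) 1),
        h.1 x.1 = k.1 x.1 := (continuous_fst.tendsto (u, levelZero)).eventually H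
    refine Filter.mem_of_superset (hopen.image_mem_nhds h1) ?_
    rintro _ ⟨x, hx, rfl⟩
    change Sum.inl (h.1 x.1, x.2) = Sum.inl (k.1 x.1, x.2)
    rw [show h.1 x.1 = k.1 x.1 from hx]
  comp h k u hu := by
    have hopen : IsOpenMap (Sum.inl : PuncturedPlane × Ioo (-1 : ℝ) 1 →
      (PuncturedPlane × Ioo (-1 : ℝ) 1) ⊕ (OpenHandle ⊕ OpenHandle)) := isOpenMap_inl
    refine Filter.mem_of_superset (hopen.image_mem_nhds (x := (u, levelZero)) Filter.univ_mem) ?_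
    rintro _ ⟨x, -, rfl⟩
    rfl

/-- The natural homomorphism `ψ : π₁(S) → π₁(O) → π₁(O(r; m))`, where `S` is the punctured Conway
sphere. -/
def psi (r : ℚ) (m : ℕ) (u : PuncturedPlane) :
    puncturedConway.Pi1 u →* (quotientHeckoid r m).Pi1 (Sum.inl (u, levelZero)) :=
  ((levelInclusion (1 / 2) r 2 m).pi1Map u).comp (conwayToO.pi1Map u)

end

/-!
Write `X` for the even Heckoid orbifold and `Y` for the orbifold `O(r; 2n)`. Both are presented by
atlases with the same chart domains: a middle part `(ℝ² - ℤ²) × (-1, 1)` and two handles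
`D² × (0, 1)`. The elements of `halfTurnGroup c` are the maps `v ↦ ± v + 2 c w` with `w` in `ℤ²`
(`exists_mem_halfTurnGroup`, `exists_of_mem_halfTurnGroup`), so the maps `v ↦ ± v + w` that define
`Y` induce on `X` an action of `ℤ² / 2 ℤ² = (ℤ/2)²` (`deckAction`), and the fibres of the natural
map `X → Y` are its orbits (`halfQuot_eq_iff`). The spaces are Hausdorff because a trigonometric
map to a Euclidean space separates the points (`TanglePt.t2Space`).

In every piece of the chart domains the identifications made by this action are given by a family
of Euclidean motions: by `v ↦ ± v + w` in the middle part (`midSymmetry`) and by rotations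
`(z, l) ↦ (ζ z, l)` and `(z, l) ↦ (ζ * conj z, 1 - l)` in the handles (`IsHandle.symmetry`). The middle
part and a handle are related by the branches of the logarithm (`IsHandle.branch`). Hence around
every chart point there is a ball in which the action of `(ℤ/2)²` on `X` is described by a finite
set of rotations. Such an action is called good below (`OrbAtlas.IsGoodAction`,
`isGoodAction_deckAction`). For a good action of a finite group, the space and its quotient are
orbifolds (`OrbAtlas.IsGoodAction.isOrbifold_withProj`), and the quotient map is a regular
covering whose group of covering transformations is the given group
(`OrbAtlas.IsGoodAction.isRegularCovering`). The main point is that a map which takes every point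
to a point of the same orbit is locally given by a single element of the group: the action is free
away from finitely many lines of a ball, and the complement of these lines is connected
(`OrbAtlas.IsGoodAction.exists_label`).

The map `π₁(X) → π₁(Y)` is injective because a loop of `X` can be recovered, up to homotopy, from
its image in `Y` by a monodromy action. An orbifold path of `Y` is a path in the chart domains
with jumps, and every jump is locally a lift of an element of `Γ = (ℤ/2)²`. Lifting `Γ` to
homeomorphisms of the chart domains and choosing arrows from a base point to all chart points, one
obtains a functor from the fundamental groupoid of `Y` to the permutations of `Γ × π₁(X)`, which
takes the image of a loop `x` of `X` to the multiplication by `x` on `1 × π₁(X)`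
(`OrbAtlas.pi1Map_toWithProj_injective`).

Finally, `π₁(S) → π₁(X)` is surjective (`levelHom_surjective`), where `S` is the punctured Conway
sphere at level `0`: up to vertical paths, paths and jumps of the middle part come from `S`; the
handles are simply connected; and any jump from a handle to the middle part or to itself can be
moved off the core of the handle, where it is a branch jump followed by a jump of the middle part.
Since `S → X → Y` and `S → O → Y` induce the same map (`map_levelHom`), the image of `π₁(X)` is
the image of `ψ`.
-/


/-! ### Finitely many subspaces in a ball -/

/-- Euclidean `3`-space. -/
abbrev Space : Type := EuclideanSpace ℝ (Fin 3)

theorem ball_not_subset_biUnion {ε : ℝ} (hε : 0 < ε) {T : Set (Submodule ℝ Space)}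
    (hT : T.Finite) (hne : ∀ L ∈ T, L ≠ ⊤) :
    ∃ x ∈ Metric.ball (0 : Space) ε, ∀ L ∈ T, x ∉ L := by
  have h : ⋃ L ∈ hT.toFinset, (L : Set Space) ≠ univ :=
    Subspace.biUnion_ne_univ_of_top_notMem fun h => hne _ (hT.mem_toFinset.1 h) rfl
  obtain ⟨x, hx⟩ := (ne_univ_iff_exists_notMem _).1 h
  simp only [mem_iUnion, not_exists, Finite.mem_toFinset] at hx
  have hc : 0 < ε / (2 * (‖x‖ + 1)) := by positivity
  refine ⟨(ε / (2 * (‖x‖ + 1))) • x, ?_, fun L hL h => hx L hL ?_⟩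
  · rw [mem_ball_zero_iff, norm_smul, Real.norm_of_nonneg hc.le, div_mul_eq_mul_div,
      div_lt_iff₀ (by positivity)]
    nlinarith [norm_nonneg x]
  · exact (L.smul_mem_iff hc.ne').1 h

theorem span_pair_ne_top (x a : Space) : Submodule.span ℝ {x, a} ≠ ⊤ := by
  intro h
  have h1 := finrank_span_le_card (R := ℝ) ({x, a} : Set Space)
  rw [h, finrank_top, finrank_euclideanSpace_fin] at h1
  have h2 : ({x, a} : Set Space).toFinset.card ≤ 2 := by
    rw [Set.toFinset_insert, Set.toFinset_singleton]
    exact Finset.card_le_two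
  omega

/-- In dimension three, removing finitely many lines through the origin does not disconnect a ball:
any two points can be joined by two segments through a point in general position. -/
theorem isPreconnected_ball_diff_lines {ε : ℝ} (hε : 0 < ε) {A : Set Space} (hA : A.Finite) :
    IsPreconnected {x ∈ Metric.ball (0 : Space) ε | ∀ a ∈ A, ∀ t : ℝ, x ≠ t • a} := by
  have key : ∀ x z : Space, x ∈ {x ∈ Metric.ball (0 : Space) ε | ∀ a ∈ A, ∀ t : ℝ, x ≠ t • a} →
      z ∈ Metric.ball (0 : Space) ε → (∀ a ∈ A, z ∉ Submodule.span ℝ {x, a}) →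
      segment ℝ x z ⊆ {x ∈ Metric.ball (0 : Space) ε | ∀ a ∈ A, ∀ t : ℝ, x ≠ t • a} := by
    rintro x z hx hz hza y hy
    refine ⟨(convex_ball _ _).segment_subset hx.1 hz hy, fun a ha t hyt => ?_⟩
    obtain ⟨b, c, hb, hc, hbc, rfl⟩ := hy
    rcases hc.eq_or_lt with rfl | hc
    · have : b = 1 := by linarith
      subst this
      exact hx.2 a ha t (by simpa using hyt)
    · refine hza a ha ((Submodule.smul_mem_iff _ hc.ne').1 ?_)
      rw [Submodule.mem_span_pair]
      exact ⟨-b, t, by rw [← hyt]; module⟩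
  refine isPreconnected_of_forall_pair fun x hx y hy => ?_
  obtain ⟨z, hz, hzL⟩ := ball_not_subset_biUnion hε
    (T := (fun a => Submodule.span ℝ {x, a}) '' A ∪ (fun a => Submodule.span ℝ {y, a}) '' A)
    ((hA.image _).union (hA.image _)) (by
      rintro L (⟨a, -, rfl⟩ | ⟨a, -, rfl⟩) <;> exact span_pair_ne_top _ _)
  refine ⟨segment ℝ x z ∪ segment ℝ y z, union_subset
    (key x z hx hz fun a ha => hzL _ (Or.inl ⟨a, ha, rfl⟩))
    (key y z hy hz fun a ha => hzL _ (Or.inr ⟨a, ha, rfl⟩)), Or.inl (left_mem_segment _ _ _),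
    Or.inr (left_mem_segment _ _ _), ?_⟩
  exact IsPreconnected.union z (right_mem_segment _ _ _) (right_mem_segment _ _ _)
    (convex_segment _ _).isPreconnected (convex_segment _ _).isPreconnected

theorem dense_compl_lines {A : Set Space} (hA : A.Finite) :
    Dense {x : Space | ∀ a ∈ A, ∀ t : ℝ, x ≠ t • a} := by
  refine Metric.dense_iff.2 fun x r hr => ?_
  obtain ⟨y, hy, hyL⟩ := ball_not_subset_biUnion hr (T := (fun a => Submodule.span ℝ {x, a}) '' A)
    (hA.image _) (by rintro L ⟨a, -, rfl⟩; exact span_pair_ne_top _ _)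
  refine ⟨x + y, by simpa using hy, fun a ha t h => hyL _ ⟨a, ha, rfl⟩ ?_⟩
  change y ∈ Submodule.span ℝ {x, a}
  rw [Submodule.mem_span_pair]
  exact ⟨-1, t, by rw [← h]; module⟩

/-- A linear isometry which coincides at every point of a ball with a member of a finite set belongs
to this set. -/
theorem mem_of_forall_ball_exists {ε : ℝ} (hε : 0 < ε) {S : Set (Space ≃ₗᵢ[ℝ] Space)}
    (hS : S.Finite) (g : Space ≃ₗᵢ[ℝ] Space)
    (h : ∀ x ∈ Metric.ball (0 : Space) ε, ∃ s ∈ S, s x = g x) : g ∈ S := by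
  by_contra hg
  let L : (Space ≃ₗᵢ[ℝ] Space) → Submodule ℝ Space := fun s =>
    LinearMap.eqLocus (s : Space →ₗ[ℝ] Space) (g : Space →ₗ[ℝ] Space)
  obtain ⟨x, hx, hxL⟩ := ball_not_subset_biUnion hε (hS.image L) (by
    rintro _ ⟨s, hs, rfl⟩ htop
    have : s = g := by
      ext1 x
      have hx : x ∈ L s := htop ▸ Submodule.mem_top
      exact hx
    exact hg (this ▸ hs))
  obtain ⟨s, hs, hsx⟩ := h x hx
  exact hxL _ ⟨s, hs, rfl⟩ hsx

/-- Two continuous maps from a preconnected space which agree pointwise up to a finite group, in a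
unique way at each point, agree up to one element of the group. -/
theorem exists_forall_smul_eq {Γ Z C : Type*} [Group Γ] [Finite Γ] [TopologicalSpace Z]
    [TopologicalSpace C] [T2Space C] (ρ : Γ →* (C ≃ₜ C)) {Q : Set Z} (hQ : IsPreconnected Q)
    {α β : Z → C} (hα : ContinuousOn α Q) (hβ : ContinuousOn β Q)
    (hex : ∀ w ∈ Q, ∃ γ, ρ γ (α w) = β w)
    (huniq : ∀ w ∈ Q, ∀ γ, ρ γ (α w) = α w → γ = 1) :
    ∃ γ, ∀ w ∈ Q, ρ γ (α w) = β w := by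
  rcases Q.eq_empty_or_nonempty with rfl | ⟨w0, hw0⟩
  · exact ⟨1, by simp⟩
  obtain ⟨γ0, hγ0⟩ := hex w0 hw0
  have : PreconnectedSpace Q := isPreconnected_iff_preconnectedSpace.1 hQ
  have hcl : ∀ γ, IsClosed {w : Q | ρ γ (α w) = β w} := fun γ =>
    isClosed_eq ((ρ γ).continuous.comp hα.domRestrict) hβ.domRestrict
  have huniq' : ∀ w ∈ Q, ∀ γ γ', ρ γ (α w) = β w → ρ γ' (α w) = β w → γ = γ' := by
    intro w hw γ γ' h h'
    have := huniq w hw (γ'⁻¹ * γ) (by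
      rw [map_mul, Homeomorph.mul_apply, h, ← h', ← Homeomorph.mul_apply, ← map_mul]; simp)
    exact (inv_mul_eq_one.1 this).symm
  have hopen : IsOpen {w : Q | ρ γ0 (α w) = β w} := by
    rw [← isClosed_compl_iff]
    have : {w : Q | ρ γ0 (α w) = β w}ᶜ = ⋃ γ ∈ {γ | γ ≠ γ0}, {w : Q | ρ γ (α w) = β w} := by
      ext w
      simp only [mem_compl_iff, mem_ofPred_eq, mem_iUnion, exists_prop]
      constructor
      · intro h
        obtain ⟨γ, hγ⟩ := hex w w.2
        exact ⟨γ, fun h' => h (h' ▸ hγ), hγ⟩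
      · rintro ⟨γ, hne, hγ⟩ h
        exact hne (huniq' w w.2 _ _ hγ h)
    rw [this]
    exact (toFinite _).isClosed_biUnion fun γ _ => hcl γ
  have := IsClopen.eq_univ ⟨hcl γ0, hopen⟩ ⟨⟨w0, hw0⟩, hγ0⟩
  exact ⟨γ0, fun w hw => (eq_univ_iff_forall.1 this ⟨w, hw⟩)⟩

/-! ### Good actions on orbifold atlases -/

namespace OrbAtlas

/-- A local model at the chart point `u` for the action `ρ` of a group `Γ` on the underlying space of
`X`: a chart `e` onto a ball around `0`, and a finite set `S` of linear isometries, none of which but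
the identity fixes more than a line, such that the identifications `X.proj w' = γ • X.proj w` in
the ball are exactly those made by the elements of `S`. It describes at the same time `X` (take `γ = 1`)
and the quotient of `X` by `Γ` near `u`. -/
structure LocalModel (X : OrbAtlas) {Γ : Type} [Group Γ] (ρ : Γ →* (X.carrier ≃ₜ X.carrier))
    (u : X.dom) where
  e : OpenPartialHomeomorph X.dom Space
  ε : ℝ
  S : Set (Space ≃ₗᵢ[ℝ] Space)
  pos : 0 < ε
  mem_source : u ∈ e.source
  map_base : e u = 0
  target_eq : e.target = Metric.ball 0 ε
  finite : S.Finite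
  axis : ∀ s ∈ S, s ≠ 1 → ∃ a : Space, ∀ x, s x = x → ∃ t : ℝ, x = t • a
  exists_isometry : ∀ γ, ∀ w ∈ e.source, ∀ w' ∈ e.source, ρ γ (X.proj w) = X.proj w' →
    ∃ s ∈ S, s (e w) = e w' ∧
      ∀ x ∈ Metric.ball (0 : Space) ε, X.proj (e.symm (s x)) = ρ γ (X.proj (e.symm x))

/-- The action `ρ` of `Γ` on the underlying space of `X` lifts locally to the charts, has local models,
and is free on a dense connected set. -/
structure IsGoodAction (X : OrbAtlas) {Γ : Type} [Group Γ] (ρ : Γ →* (X.carrier ≃ₜ X.carrier)) :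
    Prop where
  t2 : T2Space X.carrier
  secondCountable_dom : SecondCountableTopology X.dom
  continuous_proj : Continuous X.proj
  isOpenMap_proj : IsOpenMap X.proj
  surjective_proj : Function.Surjective X.proj
  exists_lift : ∀ γ u v, ρ γ (X.proj u) = X.proj v →
    ∃ k : OpenPartialHomeomorph X.dom X.dom, u ∈ k.source ∧ k u = v ∧
      ∀ w ∈ k.source, X.proj (k w) = ρ γ (X.proj w)
  localModel : ∀ u, Nonempty (X.LocalModel ρ u)
  exists_free : ∃ N : Set X.carrier, IsPreconnected N ∧ Dense N ∧
    ∀ x ∈ N, ∀ γ, ρ γ x = x → γ = 1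

/-- The atlas with the same chart domains and new chart maps. -/
abbrev withProj (X : OrbAtlas) {C : Type} [TopologicalSpace C] (q : X.dom → C) : OrbAtlas where
  carrier := C
  dom := X.dom
  proj := q

variable {X : OrbAtlas} {Γ : Type} [Group Γ] {ρ : Γ →* (X.carrier ≃ₜ X.carrier)}

theorem IsGoodAction.eq_one_of_isOpen (hX : X.IsGoodAction ρ) {U : Set X.dom} (hU : IsOpen U)
    (hne : U.Nonempty) {γ : Γ} (h : ∀ w ∈ U, ρ γ (X.proj w) = X.proj w) : γ = 1 := by
  obtain ⟨N, -, hd, hN⟩ := hX.exists_free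
  obtain ⟨_, ⟨w, hw, rfl⟩, hx⟩ := hd.inter_open_nonempty _ (hX.isOpenMap_proj U hU) (hne.image _)
  exact hN _ hx γ (h w hw)

theorem IsGoodAction.eq_of_eventually (hX : X.IsGoodAction ρ) {u : X.dom} {γ γ' : Γ}
    (h : ∀ᶠ w in 𝓝 u, ρ γ (X.proj w) = ρ γ' (X.proj w)) : γ = γ' := by
  obtain ⟨U, hU, hUo, hu⟩ := eventually_nhds_iff.1 h
  have := hX.eq_one_of_isOpen hUo ⟨u, hu⟩ (γ := γ'⁻¹ * γ) fun w hw => by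
    rw [map_mul, Homeomorph.mul_apply, hU w hw, ← Homeomorph.mul_apply, ← map_mul]; simp
  exact (inv_mul_eq_one.1 this).symm

namespace LocalModel

variable {u : X.dom} (m : X.LocalModel ρ u)

theorem symm_mem {x : Space} (hx : x ∈ Metric.ball (0 : Space) m.ε) : m.e.symm x ∈ m.e.source :=
  m.e.map_target (m.target_eq ▸ hx)

theorem apply_symm {x : Space} (hx : x ∈ Metric.ball (0 : Space) m.ε) : m.e (m.e.symm x) = x :=
  m.e.right_inv (m.target_eq ▸ hx)

theorem mem_ball {w : X.dom} (hw : w ∈ m.e.source) : m.e w ∈ Metric.ball (0 : Space) m.ε :=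
  m.target_eq ▸ m.e.map_source hw

theorem isometry_mem_ball (s : Space ≃ₗᵢ[ℝ] Space) {ε : ℝ} {x : Space}
    (hx : x ∈ Metric.ball (0 : Space) ε) : s x ∈ Metric.ball (0 : Space) ε := by
  simpa using hx

theorem symm_zero : m.e.symm 0 = u := by
  rw [← m.map_base, m.e.left_inv m.mem_source]

/-- Away from finitely many lines, the action is free in a local model. -/
theorem exists_lines (hX : X.IsGoodAction ρ) : ∃ A : Set Space, A.Finite ∧
    ∀ x ∈ Metric.ball (0 : Space) m.ε, (∀ a ∈ A, ∀ t : ℝ, x ≠ t • a) →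
      ∀ γ, ρ γ (X.proj (m.e.symm x)) = X.proj (m.e.symm x) → γ = 1 := by
  have hax : ∀ s : Space ≃ₗᵢ[ℝ] Space, ∃ a : Space, s ∈ m.S → s ≠ 1 →
      ∀ x, s x = x → ∃ t : ℝ, x = t • a := by
    intro s
    by_cases h : s ∈ m.S ∧ s ≠ 1
    · obtain ⟨a, ha⟩ := m.axis s h.1 h.2
      exact ⟨a, fun _ _ => ha⟩
    · exact ⟨0, fun h1 h2 => absurd ⟨h1, h2⟩ h⟩
  choose a ha using hax
  refine ⟨a '' m.S, m.finite.image a, fun x hx hxa γ hγ => ?_⟩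
  obtain ⟨s, hs, hsx, hsγ⟩ := m.exists_isometry γ _ (m.symm_mem hx) _ (m.symm_mem hx) hγ
  rw [m.apply_symm hx] at hsx
  have hs1 : s = 1 := by
    by_contra hne
    obtain ⟨t, ht⟩ := ha s hs hne x hsx
    exact hxa _ ⟨s, hs, rfl⟩ t ht
  subst hs1
  refine hX.eq_one_of_isOpen m.e.open_source ⟨u, m.mem_source⟩ fun w hw => ?_
  have := hsγ _ (m.mem_ball hw)
  rw [LinearIsometryEquiv.coe_one, id, m.e.left_inv hw] at this
  exact this.symm

/-- The linear isometries of the ball which lift elements of the subgroup `Δ` of `Γ`. -/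
def group (Δ : Subgroup Γ) : Subgroup (Space ≃ₗᵢ[ℝ] Space) where
  carrier := {s | ∃ γ ∈ Δ, ∀ x ∈ Metric.ball (0 : Space) m.ε,
    X.proj (m.e.symm (s x)) = ρ γ (X.proj (m.e.symm x))}
  mul_mem' := by
    rintro s s' ⟨γ, hγ, h⟩ ⟨γ', hγ', h'⟩
    refine ⟨γ * γ', Δ.mul_mem hγ hγ', fun x hx => ?_⟩
    rw [LinearIsometryEquiv.coe_mul, Function.comp_apply, h _ (isometry_mem_ball s' hx), h' x hx,
      map_mul, Homeomorph.mul_apply]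
  one_mem' := ⟨1, Δ.one_mem, fun x _ => by simp⟩
  inv_mem' := by
    rintro s ⟨γ, hγ, h⟩
    refine ⟨γ⁻¹, Δ.inv_mem hγ, fun x hx => ?_⟩
    have := h _ (isometry_mem_ball s⁻¹ hx)
    rw [← Function.comp_apply (f := s) (g := ⇑s⁻¹), ← LinearIsometryEquiv.coe_mul,
      mul_inv_cancel, LinearIsometryEquiv.coe_one, id] at this
    rw [this, ← Homeomorph.mul_apply, ← map_mul]
    simp

theorem group_mono {Δ Δ' : Subgroup Γ} (h : Δ ≤ Δ') : m.group Δ ≤ m.group Δ' :=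
  fun _ ⟨γ, hγ, hs⟩ => ⟨γ, h hγ, hs⟩

theorem finite_group (Δ : Subgroup Γ) : Finite (m.group Δ) := by
  refine (m.finite.subset ?_).to_subtype
  rintro g ⟨γ, -, hg⟩
  refine mem_of_forall_ball_exists m.pos m.finite g fun x hx => ?_
  obtain ⟨s, hs, hsx, -⟩ := m.exists_isometry γ _ (m.symm_mem hx) _
    (m.symm_mem (isometry_mem_ball g hx)) (hg x hx).symm
  rw [m.apply_symm hx, m.apply_symm (isometry_mem_ball g hx)] at hsx
  exact ⟨s, hs, hsx⟩

theorem exists_mem_group_iff {Δ : Subgroup Γ} {w w' : X.dom} (hw : w ∈ m.e.source)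
    (hw' : w' ∈ m.e.source) :
    (∃ γ ∈ Δ, ρ γ (X.proj w) = X.proj w') ↔ ∃ s ∈ m.group Δ, s (m.e w) = m.e w' := by
  constructor
  · rintro ⟨γ, hγ, h⟩
    obtain ⟨s, -, hs, hsγ⟩ := m.exists_isometry γ w hw w' hw' h
    exact ⟨s, ⟨γ, hγ, hsγ⟩, hs⟩
  · rintro ⟨s, ⟨γ, hγ, hsγ⟩, hs⟩
    have := hsγ _ (m.mem_ball hw)
    rw [hs, m.e.left_inv hw, m.e.left_inv hw'] at this
    exact ⟨γ, hγ, this.symm⟩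

/-- The restriction of linear isometries to a ball around the origin. -/
noncomputable def ballHom (ε : ℝ) : (Space ≃ₗᵢ[ℝ] Space) →*
    (Metric.ball (0 : Space) ε ≃ₜ Metric.ball (0 : Space) ε) where
  toFun s := s.toHomeomorph.subtype fun x => by simp
  map_one' := rfl
  map_mul' _ _ := rfl

end LocalModel

/-- A homeomorphism between open sets of the chart domains which respects the fibres of the quotient
by `Γ` is near every point a lift of a single element of `Γ`. -/
theorem IsGoodAction.exists_label [Finite Γ] (hX : X.IsGoodAction ρ)
    (k : OpenPartialHomeomorph X.dom X.dom)
    (hk : ∀ w ∈ k.source, ∃ γ, ρ γ (X.proj w) = X.proj (k w)) {u : X.dom} (hu : u ∈ k.source) :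
    ∃ γ, ∀ᶠ w in 𝓝 u, X.proj (k w) = ρ γ (X.proj w) := by
  have := hX.t2
  obtain ⟨m⟩ := hX.localModel u
  obtain ⟨A, hA, hfree⟩ := m.exists_lines hX
  have h0 : (0 : Space) ∈ m.e.target := by simpa [m.target_eq] using m.pos
  have hnhds : m.e.target ∩ m.e.symm ⁻¹' k.source ∈ 𝓝 (0 : Space) :=
    (m.e.symm.isOpen_inter_preimage k.open_source).mem_nhds
      ⟨h0, by rw [mem_preimage, m.symm_zero]; exact hu⟩
  obtain ⟨δ, hδ, hball⟩ := Metric.mem_nhds_iff.1 hnhds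
  have hsub : Metric.ball (0 : Space) δ ⊆ Metric.ball 0 m.ε := fun x hx =>
    m.target_eq ▸ (hball hx).1
  have hc1 : ContinuousOn (fun x => X.proj (m.e.symm x)) (Metric.ball (0 : Space) δ) :=
    hX.continuous_proj.comp_continuousOn
      (m.e.continuousOn_symm.mono fun x hx => (hball hx).1)
  have hc2 : ContinuousOn (fun x => X.proj (k (m.e.symm x))) (Metric.ball (0 : Space) δ) :=
    hX.continuous_proj.comp_continuousOn (k.continuousOn.comp
      (m.e.continuousOn_symm.mono fun x hx => (hball hx).1) fun x hx => (hball hx).2)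
  obtain ⟨γ, hγ⟩ := exists_forall_smul_eq ρ (isPreconnected_ball_diff_lines hδ hA)
    (hc1.mono (sep_subset _ _)) (hc2.mono (sep_subset _ _))
    (fun x hx => hk _ (hball hx.1).2) (fun x hx γ h => hfree x (hsub hx.1) hx.2 γ h)
  -- The equality extends from the complement of the lines to the ball, by density.
  have hall : ∀ x ∈ Metric.ball (0 : Space) δ,
      ρ γ (X.proj (m.e.symm x)) = X.proj (k (m.e.symm x)) := by
    have hB : IsOpen (Metric.ball (0 : Space) δ) := Metric.isOpen_ball
    have hd := (dense_compl_lines hA).open_subset_closure_inter hB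
    refine fun x hx => EqOn.of_subset_closure (f := fun x => ρ γ (X.proj (m.e.symm x))) hγ
      ((ρ γ).continuous.comp_continuousOn hc1) hc2 (sep_subset _ _) (fun y hy => ?_) hx
    exact hd hy
  refine ⟨γ, ?_⟩
  have hev : ∀ᶠ w in 𝓝 u, w ∈ m.e.source ∧ m.e w ∈ Metric.ball (0 : Space) δ := by
    refine (m.e.open_source.eventually_mem m.mem_source).and
      ((m.e.continuousAt m.mem_source).eventually ?_)
    rw [m.map_base]
    exact Metric.ball_mem_nhds _ hδ
  filter_upwards [hev] with w hw
  have := hall _ hw.2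
  rw [m.e.left_inv hw.1] at this
  exact this.symm

end OrbAtlas

/-! ### The quotient orbifold and the covering -/

namespace OrbAtlas

variable {X : OrbAtlas} {Γ : Type} [Group Γ] {ρ : Γ →* (X.carrier ≃ₜ X.carrier)}

/-- If the fibres of `q` are the orbits of a subgroup `Δ` of `Γ` in the charts of `X`, then `q` is
the atlas of an orbifold. -/
theorem IsGoodAction.isOrbifold_withProj (hX : X.IsGoodAction ρ) {C : Type} [TopologicalSpace C]
    [T2Space C] {q : X.dom → C} (Δ : Subgroup Γ)
    (hq : ∀ u v, q u = q v ↔ ∃ γ ∈ Δ, ρ γ (X.proj u) = X.proj v) (hc : Continuous q)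
    (ho : IsOpenMap q) (hs : Function.Surjective q) : (X.withProj q).IsOrbifold 3 where
  t2 := inferInstance
  secondCountable :=
    have := hX.secondCountable_dom
    (IsOpenQuotientMap.mk hs hc ho).isQuotientMap.secondCountableTopology ho
  continuous_proj := hc
  isOpenMap_proj := ho
  surjective_proj := hs
  local_model u := by
    obtain ⟨m⟩ := hX.localModel u
    refine ⟨m.group Δ, m.e, m.finite_group Δ, m.mem_source, m.map_base, fun g _ x hx => ?_,
      fun w hw w' hw' => (hq w w').trans (m.exists_mem_group_iff hw hw')⟩
    rw [m.target_eq] at hx ⊢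
    exact LocalModel.isometry_mem_ball g hx
  compatible u v huv := by
    obtain ⟨γ, hγ, h⟩ := (hq u v).1 huv
    obtain ⟨k, hk, hkv, hkp⟩ := hX.exists_lift γ u v h
    exact ⟨⟨k, fun w hw => ((hq w (k w)).2 ⟨γ, hγ, (hkp w hw).symm⟩).symm⟩, hk, hkv⟩

theorem IsGoodAction.isOrbifold (hX : X.IsGoodAction ρ) : X.IsOrbifold 3 :=
  have := hX.t2
  hX.isOrbifold_withProj (q := X.proj) ⊥ (fun u v => by simp) hX.continuous_proj
    hX.isOpenMap_proj hX.surjective_proj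

/-- The translates of the image of a local model are equal or disjoint. -/
theorem LocalModel.translate_eq {u : X.dom} (m : X.LocalModel ρ u) {γ γ' : Γ}
    (h : ((ρ γ '' (X.proj '' m.e.source)) ∩ (ρ γ' '' (X.proj '' m.e.source))).Nonempty) :
    ρ γ '' (X.proj '' m.e.source) = ρ γ' '' (X.proj '' m.e.source) := by
  have key : ∀ γ γ' : Γ,
      ((ρ γ '' (X.proj '' m.e.source)) ∩ (ρ γ' '' (X.proj '' m.e.source))).Nonempty →
      ρ γ '' (X.proj '' m.e.source) ⊆ ρ γ' '' (X.proj '' m.e.source) := by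
    rintro γ γ' ⟨_, ⟨_, ⟨w, hw, rfl⟩, rfl⟩, _, ⟨w', hw', rfl⟩, h⟩
    obtain ⟨s, -, -, hs⟩ := m.exists_isometry (γ'⁻¹ * γ) w hw w' hw' (by
      rw [map_mul, Homeomorph.mul_apply, ← h, ← Homeomorph.mul_apply, ← map_mul]; simp)
    rintro _ ⟨_, ⟨y, hy, rfl⟩, rfl⟩
    have := hs _ (m.mem_ball hy)
    rw [m.e.left_inv hy] at this
    refine ⟨_, ⟨_, m.symm_mem (isometry_mem_ball s (m.mem_ball hy)), rfl⟩, ?_⟩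
    rw [this, ← Homeomorph.mul_apply, ← map_mul]
    simp
  exact (key _ _ h).antisymm (key _ _ (inter_comm _ _ ▸ h))

theorem LocalModel.connectedComponentIn_eq (hX : X.IsGoodAction ρ)
    {C : Type} {p : X.carrier → C} (hp : ∀ x x', p x = p x' ↔ ∃ γ, ρ γ x = x')
    {u : X.dom} (m : X.LocalModel ρ u) (γ : Γ)
    {x : X.carrier} (hx : x ∈ ρ γ '' (X.proj '' m.e.source)) :
    connectedComponentIn (p ⁻¹' (p '' (X.proj '' m.e.source))) x =
      ρ γ '' (X.proj '' m.e.source) := by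
  have hcover : p ⁻¹' (p '' (X.proj '' m.e.source)) = ⋃ γ, ρ γ '' (X.proj '' m.e.source) := by
    ext y
    simp only [mem_preimage, mem_image, mem_iUnion, hp]
    constructor
    · rintro ⟨z, hz, γ, h⟩
      exact ⟨γ, z, hz, h⟩
    · rintro ⟨γ, z, hz, h⟩
      exact ⟨z, hz, γ, h⟩
  have hopen : ∀ γ, IsOpen (ρ γ '' (X.proj '' m.e.source)) := fun γ =>
    (ρ γ).isOpenMap _ (hX.isOpenMap_proj _ m.e.open_source)
  have hconn : IsPreconnected (ρ γ '' (X.proj '' m.e.source)) := by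
    have h1 : IsPreconnected m.e.source := by
      rw [← m.e.symm_image_target_eq_source, m.target_eq]
      exact (convex_ball _ _).isPreconnected.image _ (m.target_eq ▸ m.e.continuousOn_symm)
    exact (h1.image _ hX.continuous_proj.continuousOn).image _ (ρ γ).continuous.continuousOn
  refine Subset.antisymm ?_
    (hconn.subset_connectedComponentIn hx (hcover ▸ subset_iUnion (fun γ => ρ γ '' _) γ))
  have hxmem : x ∈ p ⁻¹' (p '' (X.proj '' m.e.source)) := hcover ▸ mem_iUnion.2 ⟨γ, hx⟩
  refine isPreconnected_connectedComponentIn.subset_left_of_subset_union (hopen γ)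
    (isOpen_biUnion (s := {γ' | Disjoint (ρ γ '' (X.proj '' m.e.source))
      (ρ γ' '' (X.proj '' m.e.source))}) fun γ' _ => hopen γ') ?_ ?_
      ⟨x, mem_connectedComponentIn hxmem, hx⟩
  · exact disjoint_iUnion₂_right.2 fun γ' h => h
  · refine (connectedComponentIn_subset _ _).trans (hcover ▸ iUnion_subset fun γ' => ?_)
    by_cases hd : Disjoint (ρ γ '' (X.proj '' m.e.source)) (ρ γ' '' (X.proj '' m.e.source))
    · exact subset_union_of_subset_right
        (subset_biUnion_of_mem (u := fun γ' => ρ γ' '' (X.proj '' m.e.source)) hd) _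
    · rw [m.translate_eq (not_disjoint_iff_nonempty_inter.1 hd)]
      exact subset_union_left

section Covering

variable {C : Type} [TopologicalSpace C] {p : X.carrier → C}

theorem isOpenMap_of_fibres (hp : ∀ x x', p x = p x' ↔ ∃ γ, ρ γ x = x') (hq : IsQuotientMap p) :
    IsOpenMap p := by
  intro U hU
  rw [← hq.isOpen_preimage]
  have : p ⁻¹' (p '' U) = ⋃ γ, ρ γ '' U := by
    ext x
    simp only [mem_preimage, mem_image, mem_iUnion, hp]
    exact ⟨fun ⟨y, hy, γ, h⟩ => ⟨γ, y, hy, h⟩, fun ⟨γ, y, hy, h⟩ => ⟨y, hy, γ, h⟩⟩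
  rw [this]
  exact isOpen_iUnion fun γ => (ρ γ).isOpenMap U hU

/-- The chart of the quotient (or, translated by `γ`, of `X`) given by a local model. -/
theorem LocalModel.isChart {u : X.dom} (m : X.LocalModel ρ u)
    {q : X.dom → C} (Δ : Subgroup Γ)
    (hq : ∀ u v, q u = q v ↔ ∃ γ ∈ Δ, ρ γ (X.proj u) = X.proj v) (g : C → C) (hg : g.Injective)
    (hlift : ∀ u v, g (q u) = q v → ∃ k : OpenPartialHomeomorph X.dom X.dom,
      u ∈ k.source ∧ k u = v ∧ ∀ w ∈ k.source, q (k w) = g (q w)) :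
    (X.withProj q).IsChart ((m.group Δ).map (LocalModel.ballHom m.ε))
      (fun w : Metric.ball (0 : Space) m.ε => g (q (m.e.symm w))) := by
  constructor
  · intro w w'
    rw [hg.eq_iff, hq, m.exists_mem_group_iff (m.symm_mem w.2) (m.symm_mem w'.2),
      m.apply_symm w.2, m.apply_symm w'.2]
    constructor
    · rintro ⟨s, hs, h⟩
      exact ⟨LocalModel.ballHom m.ε s, ⟨s, hs, rfl⟩, Subtype.ext h⟩
    · rintro ⟨_, ⟨s, hs, rfl⟩, h⟩
      exact ⟨s, hs, congrArg Subtype.val h⟩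
  · intro w v h
    obtain ⟨k, hk, hkv, hkq⟩ := hlift _ v h
    have ho : IsOpenEmbedding (Subtype.val : Metric.ball (0 : Space) m.ε → Space) :=
      Metric.isOpen_ball.isOpenEmbedding_subtypeVal
    have : Nonempty (Metric.ball (0 : Space) m.ε) := ⟨w⟩
    refine ⟨(ho.toOpenPartialHomeomorph _).trans (m.e.symm.trans k), ?_, hkv, fun x hx => ?_⟩
    · simp only [mfld_simps]
      exact ⟨by rw [m.target_eq]; exact w.2, hk⟩
    · simp only [mfld_simps] at hx
      exact hkq _ hx.2

theorem IsGoodAction.isOrbifoldCovering (hX : X.IsGoodAction ρ) {q : X.dom → C}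
    (hp : ∀ x x', p x = p x' ↔ ∃ γ, ρ γ x = x') (hpq : ∀ u, q u = p (X.proj u))
    (hc : Continuous p) (hs : Function.Surjective p) :
    IsOrbifoldCovering 3 (X := X) (Y := X.withProj q) p where
  continuous := hc
  surjective := hs
  locally_quotient y := by
    obtain ⟨x, rfl⟩ := hs y
    obtain ⟨u, rfl⟩ := hX.surjective_proj x
    obtain ⟨m⟩ := hX.localModel u
    have hq : ∀ u v, q u = q v ↔ ∃ γ ∈ (⊤ : Subgroup Γ), ρ γ (X.proj u) = X.proj v := by
      simp [hpq, hp]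
    have hrange : range (fun w : Metric.ball (0 : Space) m.ε => q (m.e.symm w)) =
        p '' (X.proj '' m.e.source) := by
      have : m.e.source = m.e.symm '' Metric.ball (0 : Space) m.ε := by
        rw [← m.target_eq, m.e.symm_image_target_eq_source]
      rw [this, image_image, image_image, image_eq_range]
      exact congrArg range (funext fun w => hpq _)
    refine ⟨⟨Metric.ball 0 m.ε, Metric.isOpen_ball⟩,
      (m.group ⊤).map (LocalModel.ballHom m.ε), fun w => q (m.e.symm w), ?_, ?_, ?_, ?_, ?_⟩
    · exact isConnected_iff_connectedSpace.1
        ((convex_ball (0 : Space) m.ε).isConnected ⟨0, Metric.mem_ball_self m.pos⟩)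
    · have := m.finite_group ⊤
      have h : ((m.group ⊤ : Set (Space ≃ₗᵢ[ℝ] Space))).Finite := toFinite _
      exact (h.image (LocalModel.ballHom m.ε)).to_subtype
    · refine m.isChart ⊤ hq id Function.injective_id fun u v h => ?_
      obtain ⟨γ, -, hγ⟩ := (hq u v).1 h
      obtain ⟨k, hk, hkv, hkp⟩ := hX.exists_lift γ u v hγ
      exact ⟨k, hk, hkv, fun w hw => ((hq w (k w)).2 ⟨γ, trivial, (hkp w hw).symm⟩).symm⟩
    · change p (X.proj u) ∈ range (fun w : Metric.ball (0 : Space) m.ε => q (m.e.symm w))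
      rw [hrange]
      exact ⟨_, ⟨u, m.mem_source, rfl⟩, rfl⟩
    · intro x hx
      change p x ∈ range (fun w : Metric.ball (0 : Space) m.ε => q (m.e.symm w)) at hx
      rw [hrange] at hx
      obtain ⟨z, hz, hzx⟩ := hx
      obtain ⟨γ, rfl⟩ := (hp _ _).1 hzx
      refine ⟨(m.group ⊥).map (LocalModel.ballHom m.ε),
        fun w => ρ γ (X.proj (m.e.symm w.1)), Subgroup.map_mono (m.group_mono bot_le), ?_, ?_, ?_⟩
      · exact m.isChart (q := X.proj) ⊥ (fun u v => by simp) (ρ γ) (ρ γ).injective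
          (hX.exists_lift γ)
      · change _ = connectedComponentIn
          (p ⁻¹' range (fun w : Metric.ball (0 : Space) m.ε => q (m.e.symm w))) _
        rw [hrange, m.connectedComponentIn_eq hX hp γ (mem_image_of_mem _ hz)]
        have : m.e.source = m.e.symm '' Metric.ball (0 : Space) m.ε := by
          rw [← m.target_eq, m.e.symm_image_target_eq_source]
        rw [this, image_image, image_image, image_eq_range]
        rfl
      · intro w
        change p (ρ γ (X.proj (m.e.symm w.1))) = q (m.e.symm w.1)
        rw [hpq, eq_comm, hp]
        exact ⟨γ, rfl⟩

theorem IsGoodAction.isRegularCovering [Finite Γ] (hX : X.IsGoodAction ρ) [Nonempty X.carrier]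
    {q : X.dom → C}
    (hp : ∀ x x', p x = p x' ↔ ∃ γ, ρ γ x = x') (hpq : ∀ u, q u = p (X.proj u))
    (hc : Continuous p) (hs : Function.Surjective p) :
    IsRegularCovering 3 Γ (X := X) (Y := X.withProj q) p := by
  have := hX.t2
  obtain ⟨N, hN, hd, hfree⟩ := hX.exists_free
  refine ⟨hX.isOrbifoldCovering hp hpq hc hs, ?_, ρ, ?_, fun h => ⟨?_, ?_⟩, fun x x' => (hp x x').1⟩
  · have : PreconnectedSpace X.carrier := ⟨hd.closure_eq ▸ hN.closure⟩
    exact ⟨inferInstance⟩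
  · refine (injective_iff_map_eq_one ρ).2 fun γ h => ?_
    obtain ⟨x, hx⟩ := hd.nonempty
    exact hfree x hx γ (by rw [h]; rfl)
  · rintro ⟨γ, rfl⟩
    exact ⟨hX.exists_lift γ, fun x => ((hp _ _).2 ⟨γ, rfl⟩).symm⟩
  · rintro ⟨-, h'⟩
    obtain ⟨γ, hγ⟩ := exists_forall_smul_eq ρ hN continuousOn_id h.continuous.continuousOn
      (fun x _ => (hp x (h x)).1 (h' x).symm) hfree
    exact ⟨γ, Homeomorph.ext fun x =>
      congrFun (Continuous.ext_on hd (ρ γ).continuous h.continuous hγ) x⟩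

end Covering

end OrbAtlas

/-! ### The fundamental groupoid -/

namespace OrbAtlas

variable {X : OrbAtlas}

/-- The class of a path in a chart domain in the fundamental groupoid. -/
def pathHom (X : OrbAtlas) {u v : X.dom} (γ : Path u v) : X.obj u ⟶ X.obj v :=
  (CategoryTheory.Quotient.functor X.HomotopyRel).map (X.pathArrow γ)

/-- The class of a jump in the fundamental groupoid. -/
def jumpHom (X : OrbAtlas) {u v : X.dom} (h : X.Transition) (hu : u ∈ h.1.source)
    (hv : h.1 u = v) : X.obj u ⟶ X.obj v :=
  (CategoryTheory.Quotient.functor X.HomotopyRel).map (X.jumpArrow h hu hv)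

theorem pathHom_homotopic {u v : X.dom} {γ δ : Path u v} (H : γ.Homotopic δ) :
    X.pathHom γ = X.pathHom δ :=
  CategoryTheory.Quotient.sound _ (HomotopyRel.homotopic _ _ H)

theorem pathHom_trans {u v w : X.dom} (γ : Path u v) (δ : Path v w) :
    X.pathHom γ ≫ X.pathHom δ = X.pathHom (γ.trans δ) :=
  ((CategoryTheory.Quotient.functor X.HomotopyRel).map_comp _ _).symm.trans
    (CategoryTheory.Quotient.sound _ (HomotopyRel.trans γ δ))

theorem jumpHom_comp {u v w : X.dom} (h k : X.Transition) (hu : u ∈ h.1.source) (hv : h.1 u = v)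
    (ku : v ∈ k.1.source) (kv : k.1 v = w) (cu : u ∈ (h.comp k).1.source)
    (cv : (h.comp k).1 u = w) :
    X.jumpHom h hu hv ≫ X.jumpHom k ku kv = X.jumpHom (h.comp k) cu cv :=
  ((CategoryTheory.Quotient.functor X.HomotopyRel).map_comp _ _).symm.trans
    (CategoryTheory.Quotient.sound _ (HomotopyRel.comp h k hu hv ku kv cu cv))

theorem jumpHom_germ {u v : X.dom} (h k : X.Transition) (hu : u ∈ h.1.source) (hv : h.1 u = v)
    (ku : u ∈ k.1.source) (kv : k.1 u = v) (H : h.1 =ᶠ[𝓝 u] k.1) :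
    X.jumpHom h hu hv = X.jumpHom k ku kv :=
  CategoryTheory.Quotient.sound _ (HomotopyRel.germ h k hu hv ku kv H)

theorem jumpHom_slide {u v u' v' : X.dom} (h : X.Transition) (hu : u ∈ h.1.source)
    (hv : v ∈ h.1.source) (hu' : h.1 u = u') (hv' : h.1 v = v') (γ : Path u v) (γ' : Path u' v')
    (hs : ∀ t, γ t ∈ h.1.source) (hγ : ∀ t, γ' t = h.1 (γ t)) :
    X.pathHom γ ≫ X.jumpHom h hv hv' = X.jumpHom h hu hu' ≫ X.pathHom γ' := by
  have := CategoryTheory.Quotient.sound _ (HomotopyRel.slide h hu hv hu' hv' γ γ' hs hγ)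
  rw [Functor.map_comp, Functor.map_comp] at this
  exact this

theorem pathHom_refl (u : X.dom) : X.pathHom (Path.refl u) = 𝟙 (X.obj u) := by
  have h := pathHom_trans (X := X) (Path.refl u) (Path.refl u)
  rw [Path.refl_trans_refl] at h
  exact (cancel_epi (X.pathHom (Path.refl u))).1 (h.trans (Category.comp_id _).symm)

theorem pathHom_comp_symm {u v : X.dom} (γ : Path u v) :
    X.pathHom γ ≫ X.pathHom γ.symm = 𝟙 (X.obj u) := by
  rw [pathHom_trans, ← pathHom_refl]
  exact pathHom_homotopic ⟨Path.Homotopy.reflTransSymm γ |>.symm⟩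

theorem jumpHom_eq_id {u : X.dom} (h : X.Transition) (hu : u ∈ h.1.source) (hv : h.1 u = u)
    (H : ∀ᶠ w in 𝓝 u, h.1 w = w) : X.jumpHom h hu hv = 𝟙 (X.obj u) := by
  have hu2 : u ∈ (h.comp h).1.source := ⟨hu, by change h.1 u ∈ h.1.source; rwa [hv]⟩
  have hv2 : (h.comp h).1 u = u := by change h.1 (h.1 u) = u; rw [hv, hv]
  have h1 := jumpHom_comp h h hu hv hu hv hu2 hv2
  have h2 : X.jumpHom (h.comp h) hu2 hv2 = X.jumpHom h hu hv := by
    refine jumpHom_germ _ _ _ _ _ _ ?_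
    filter_upwards [H] with w hw
    change h.1 (h.1 w) = h.1 w
    rw [hw, hw]
  exact (cancel_epi (X.jumpHom h hu hv)).1 ((h1.trans h2).trans (Category.comp_id _).symm)

/-- The inverse of a change of charts. -/
def Transition.symm (h : X.Transition) : X.Transition :=
  ⟨h.1.symm, fun w hw => by
    rw [← h.2 _ (h.1.map_target hw), h.1.right_inv hw]⟩

theorem jumpHom_comp_symm {u v : X.dom} (h : X.Transition) (hu : u ∈ h.1.source) (hv : h.1 u = v)
    (hv' : v ∈ h.symm.1.source) (hu' : h.symm.1 v = u) :
    X.jumpHom h hu hv ≫ X.jumpHom h.symm hv' hu' = 𝟙 (X.obj u) := by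
  have hu2 : u ∈ (h.comp h.symm).1.source := ⟨hu, by
    change h.1 u ∈ h.symm.1.source; rwa [hv]⟩
  have hv2 : (h.comp h.symm).1 u = u := by
    change h.symm.1 (h.1 u) = u; rw [hv, hu']
  rw [jumpHom_comp _ _ _ _ _ _ hu2 hv2]
  refine jumpHom_eq_id _ _ _ ?_
  filter_upwards [h.1.open_source.mem_nhds hu] with w hw
  exact h.1.left_inv hw

theorem hom_induction_aux {a b : Quiver.Symmetrify X.Pt}
    {P : ∀ {u v : X.dom}, (X.obj u ⟶ X.obj v) → Prop} (hid : ∀ u, P (𝟙 (X.obj u)))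
    (hpath : ∀ {u v w : X.dom} (f : X.obj u ⟶ X.obj v) (γ : Path v w), P f → P (f ≫ X.pathHom γ))
    (hjump : ∀ {u v w : X.dom} (f : X.obj u ⟶ X.obj v) (h : X.Transition) (hv : v ∈ h.1.source)
      (hw : h.1 v = w), P f → P (f ≫ X.jumpHom h hv hw)) (p : Quiver.Path a b) :
    P (u := Pt.pt a) (v := Pt.pt b) (Quot.mk _ (Quot.mk _ p)) := by
  induction p with
  | nil => exact hid _
  | cons q s ih =>
    rcases s with s | s
    · change X.Step _ _ at s
      cases s with
      | path γ => exact hpath _ γ ih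
      | jump h hu hv => exact hjump _ h hu hv ih
    · change X.Step _ _ at s
      cases s with
      | @path u v γ =>
        have := hpath _ γ.symm ih
        have e : X.pathHom γ.symm = Groupoid.inv (X.pathHom γ) := by
          rw [← cancel_epi (X.pathHom γ), pathHom_comp_symm, Groupoid.comp_inv]
        rw [e] at this
        exact this
      | @jump u v h hu hv =>
        have hv' : v ∈ h.symm.1.source := hv ▸ h.1.map_source hu
        have hu' : h.symm.1 v = u := hv ▸ h.1.left_inv hu
        have := hjump _ h.symm hv' hu' ih
        have e : X.jumpHom h.symm hv' hu' = Groupoid.inv (X.jumpHom h hu hv) := by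
          rw [← cancel_epi (X.jumpHom h hu hv), jumpHom_comp_symm, Groupoid.comp_inv]
        rw [e] at this
        exact this

/-- Every arrow of the fundamental groupoid is a composition of paths and jumps. -/
theorem hom_induction {P : ∀ {u v : X.dom}, (X.obj u ⟶ X.obj v) → Prop}
    (hid : ∀ u, P (𝟙 (X.obj u)))
    (hpath : ∀ {u v w : X.dom} (f : X.obj u ⟶ X.obj v) (γ : Path v w), P f → P (f ≫ X.pathHom γ))
    (hjump : ∀ {u v w : X.dom} (f : X.obj u ⟶ X.obj v) (h : X.Transition) (hv : v ∈ h.1.source)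
      (hw : h.1 v = w), P f → P (f ≫ X.jumpHom h hv hw))
    {u v : X.dom} (f : X.obj u ⟶ X.obj v) : P f := by
  induction f using Quot.ind with
  | mk f =>
    induction f using Quot.ind with
    | mk p => exact hom_induction_aux hid hpath hjump p

theorem Hom.functor_map_pathHom {Y : OrbAtlas} (F : Hom X Y) {u v : X.dom} (γ : Path u v) :
    F.functor.map (X.pathHom γ) = Y.pathHom (γ.map F.continuous_lift) :=
  Hom.lift_map_of _ _

theorem Hom.functor_map_jumpHom {Y : OrbAtlas} (F : Hom X Y) {u v : X.dom} (h : X.Transition)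
    (hu : u ∈ h.1.source) (hv : h.1 u = v) :
    F.functor.map (X.jumpHom h hu hv) = Y.jumpHom (F.onJump h) (F.mem_source h _ hu)
      ((F.onJump_lift h _ hu).trans (congrArg F.lift hv)) :=
  Hom.lift_map_of _ _

/-- A functor out of the fundamental groupoid, from its values on paths and jumps. -/
def liftFunctor {V : Type} [Groupoid V] (φ : X.Pt ⥤q V)
    (homotopic : ∀ {u v : X.dom} (γ δ : Path u v), γ.Homotopic δ →
      φ.map (Step.path γ : (⟨u⟩ : X.Pt) ⟶ ⟨v⟩) = φ.map (Step.path δ : (⟨u⟩ : X.Pt) ⟶ ⟨v⟩))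
    (trans : ∀ {u v w : X.dom} (γ : Path u v) (δ : Path v w),
      φ.map (Step.path γ : (⟨u⟩ : X.Pt) ⟶ ⟨v⟩) ≫ φ.map (Step.path δ : (⟨v⟩ : X.Pt) ⟶ ⟨w⟩) =
        φ.map (Step.path (γ.trans δ) : (⟨u⟩ : X.Pt) ⟶ ⟨w⟩))
    (comp : ∀ {u v w : X.dom} (h k : X.Transition) (hu : u ∈ h.1.source) (hv : h.1 u = v)
      (ku : v ∈ k.1.source) (kv : k.1 v = w) (cu : u ∈ (h.comp k).1.source)
      (cv : (h.comp k).1 u = w),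
      φ.map (Step.jump h hu hv : (⟨u⟩ : X.Pt) ⟶ ⟨v⟩) ≫
        φ.map (Step.jump k ku kv : (⟨v⟩ : X.Pt) ⟶ ⟨w⟩) =
          φ.map (Step.jump (h.comp k) cu cv : (⟨u⟩ : X.Pt) ⟶ ⟨w⟩))
    (germ : ∀ {u v : X.dom} (h k : X.Transition) (hu : u ∈ h.1.source) (hv : h.1 u = v)
      (ku : u ∈ k.1.source) (kv : k.1 u = v), h.1 =ᶠ[𝓝 u] k.1 →
      φ.map (Step.jump h hu hv : (⟨u⟩ : X.Pt) ⟶ ⟨v⟩) =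
        φ.map (Step.jump k ku kv : (⟨u⟩ : X.Pt) ⟶ ⟨v⟩))
    (slide : ∀ {u v u' v' : X.dom} (h : X.Transition) (hu : u ∈ h.1.source) (hv : v ∈ h.1.source)
      (hu' : h.1 u = u') (hv' : h.1 v = v') (γ : Path u v) (γ' : Path u' v'),
      (∀ t, γ t ∈ h.1.source) → (∀ t, γ' t = h.1 (γ t)) →
      φ.map (Step.path γ : (⟨u⟩ : X.Pt) ⟶ ⟨v⟩) ≫
        φ.map (Step.jump h hv hv' : (⟨v⟩ : X.Pt) ⟶ ⟨v'⟩) =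
      φ.map (Step.jump h hu hu' : (⟨u⟩ : X.Pt) ⟶ ⟨u'⟩) ≫
        φ.map (Step.path γ' : (⟨u'⟩ : X.Pt) ⟶ ⟨v'⟩)) : X.FundGpd ⥤ V :=
  CategoryTheory.Quotient.lift _ (Quiver.FreeGroupoid.lift φ) fun _ _ f g H => by
    cases H with
    | homotopic γ δ H =>
      simp only [pathArrow, Hom.lift_map_of]
      exact homotopic γ δ H
    | trans γ δ =>
      rw [Functor.map_comp]
      simp only [pathArrow, Hom.lift_map_of]
      exact trans γ δ
    | comp h k hu hv ku kv cu cv =>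
      rw [Functor.map_comp]
      simp only [jumpArrow, Hom.lift_map_of]
      exact comp h k hu hv ku kv cu cv
    | germ h k hu hv ku kv H =>
      simp only [jumpArrow, Hom.lift_map_of]
      exact germ h k hu hv ku kv H
    | slide h hu hv hu' hv' γ γ' hs hγ =>
      rw [Functor.map_comp, Functor.map_comp]
      simp only [jumpArrow, pathArrow, Hom.lift_map_of]
      exact slide h hu hv hu' hv' γ γ' hs hγ

end OrbAtlas

/-! ### Injectivity on fundamental groups -/

namespace OrbAtlas

variable {X : OrbAtlas}

/-- The change of charts obtained from `h` by composing it with homeomorphisms `t` and `t'` of the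
chart domains, where this is compatible with the chart maps. -/
def twist (h : OpenPartialHomeomorph X.dom X.dom) (t t' : X.dom ≃ₜ X.dom) : X.Transition :=
  ⟨t.symm.toOpenPartialHomeomorph.trans
    ((h.restrOpen (interior {w | X.proj (t' (h w)) = X.proj (t w)}) isOpen_interior).trans
      t'.toOpenPartialHomeomorph), fun y hy => by
    simp only [mfld_simps] at hy
    have := interior_subset hy.2
    simpa using this⟩

theorem mem_twist_source {h : OpenPartialHomeomorph X.dom X.dom} {t t' : X.dom ≃ₜ X.dom} {u : X.dom}
    (hu : u ∈ h.source) (H : ∀ᶠ w in 𝓝 u, X.proj (t' (h w)) = X.proj (t w)) :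
    t u ∈ (twist h t t').1.source := by
  simp only [twist, mfld_simps]
  simpa using And.intro hu (mem_interior_iff_mem_nhds.2 H)

theorem twist_apply (h : OpenPartialHomeomorph X.dom X.dom) (t t' : X.dom ≃ₜ X.dom) (y : X.dom) :
    (twist h t t').1 y = t' (h (t.symm y)) := rfl

/-- The jump along `twist h t t'`. -/
def twistHom (h : OpenPartialHomeomorph X.dom X.dom) (t t' : X.dom ≃ₜ X.dom) {u v : X.dom}
    (hu : u ∈ h.source) (hv : h u = v)
    (H : ∀ᶠ w in 𝓝 u, X.proj (t' (h w)) = X.proj (t w)) : X.obj (t u) ⟶ X.obj (t' v) :=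
  X.jumpHom (twist h t t') (mem_twist_source hu H) (by rw [twist_apply, t.symm_apply_apply, hv])

theorem twistHom_comp (h k : OpenPartialHomeomorph X.dom X.dom) (t t' t'' : X.dom ≃ₜ X.dom)
    {u v w : X.dom} (hu : u ∈ h.source) (hv : h u = v) (ku : v ∈ k.source) (kv : k v = w)
    (cu : u ∈ (h.trans k).source) (cv : h.trans k u = w)
    (H : ∀ᶠ w in 𝓝 u, X.proj (t' (h w)) = X.proj (t w))
    (H' : ∀ᶠ w in 𝓝 v, X.proj (t'' (k w)) = X.proj (t' w))
    (H'' : ∀ᶠ w in 𝓝 u, X.proj (t'' (h.trans k w)) = X.proj (t w)) :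
    twistHom h t t' hu hv H ≫ twistHom k t' t'' ku kv H' = twistHom (h.trans k) t t'' cu cv H'' := by
  subst hv
  have cu2 : t u ∈ ((twist h t t').comp (twist k t' t'')).1.source := by
    refine ⟨mem_twist_source hu H, ?_⟩
    change (twist h t t').1 (t u) ∈ (twist k t' t'').1.source
    rw [twist_apply, t.symm_apply_apply]
    exact mem_twist_source ku H'
  have cv2 : ((twist h t t').comp (twist k t' t'')).1 (t u) = t'' w := by
    change (twist k t' t'').1 ((twist h t t').1 (t u)) = t'' w
    rw [twist_apply, twist_apply, t.symm_apply_apply, t'.symm_apply_apply, kv]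
  refine (jumpHom_comp _ _ _ _ _ _ cu2 cv2).trans (jumpHom_germ _ _ _ _ _ _ ?_)
  refine Filter.Eventually.of_forall fun y => ?_
  change (twist k t' t'').1 ((twist h t t').1 y) = _
  simp only [twist_apply, t'.symm_apply_apply]
  rfl

theorem twistHom_germ (h k : OpenPartialHomeomorph X.dom X.dom) (t t' : X.dom ≃ₜ X.dom)
    {u v : X.dom} (hu : u ∈ h.source) (hv : h u = v) (ku : u ∈ k.source) (kv : k u = v)
    (H : ∀ᶠ w in 𝓝 u, X.proj (t' (h w)) = X.proj (t w))
    (H' : ∀ᶠ w in 𝓝 u, X.proj (t' (k w)) = X.proj (t w)) (hk : h =ᶠ[𝓝 u] k) :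
    twistHom h t t' hu hv H = twistHom k t t' ku kv H' := by
  refine jumpHom_germ _ _ _ _ _ _ ?_
  have : ∀ᶠ y in 𝓝 (t u), h (t.symm y) = k (t.symm y) := by
    have := t.symm.continuous.tendsto (t u)
    rw [t.symm_apply_apply] at this
    exact this.eventually hk
  filter_upwards [this] with y hy
  rw [twist_apply, twist_apply, hy]

theorem twistHom_slide (h : OpenPartialHomeomorph X.dom X.dom) (t t' : X.dom ≃ₜ X.dom)
    {u v u' v' : X.dom} (hu : u ∈ h.source) (hv : v ∈ h.source) (hu' : h u = u') (hv' : h v = v')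
    (γ : Path u v) (γ' : Path u' v') (hs : ∀ s, γ s ∈ h.source) (hγ : ∀ s, γ' s = h (γ s))
    (H : ∀ s, ∀ᶠ w in 𝓝 (γ s), X.proj (t' (h w)) = X.proj (t w))
    (Hu : ∀ᶠ w in 𝓝 u, X.proj (t' (h w)) = X.proj (t w))
    (Hv : ∀ᶠ w in 𝓝 v, X.proj (t' (h w)) = X.proj (t w)) :
    X.pathHom (γ.map t.continuous) ≫ twistHom h t t' hv hv' Hv =
      twistHom h t t' hu hu' Hu ≫ X.pathHom (γ'.map t'.continuous) :=
  jumpHom_slide _ _ _ _ _ _ _ (fun s => mem_twist_source (hs s) (H s)) fun s => by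
    change t' (γ' s) = (twist h t t').1 (t (γ s))
    rw [twist_apply, t.symm_apply_apply, hγ]

/-- The loop at `b` obtained from an arrow by means of arrows from `b` to all objects. -/
def loopAt {b : X.dom} (c : ∀ u, X.obj b ⟶ X.obj u) {u v : X.dom} (f : X.obj u ⟶ X.obj v) :
    X.Pi1 b :=
  c u ≫ f ≫ Groupoid.inv (c v)

theorem loopAt_comp {b : X.dom} (c : ∀ u, X.obj b ⟶ X.obj u) {u v w : X.dom}
    (f : X.obj u ⟶ X.obj v) (g : X.obj v ⟶ X.obj w) :
    loopAt c (f ≫ g) = loopAt c f * loopAt c g := by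
  change _ = (c u ≫ f ≫ Groupoid.inv (c v)) ≫ (c v ≫ g ≫ Groupoid.inv (c w))
  simp [loopAt]

theorem loopAt_id {b : X.dom} (c : ∀ u, X.obj b ⟶ X.obj u) (u : X.dom) :
    loopAt c (𝟙 (X.obj u)) = 1 := by
  change _ = 𝟙 (X.obj b)
  simp [loopAt]

theorem eq_id_of_loopAt_eq_one {b : X.dom} (c : ∀ u, X.obj b ⟶ X.obj u) {u : X.dom}
    {f : X.obj u ⟶ X.obj u} (h : loopAt c f = 1) : f = 𝟙 (X.obj u) := by
  have h' : c u ≫ f ≫ Groupoid.inv (c u) = 𝟙 (X.obj b) := h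
  have : c u ≫ f = c u ≫ 𝟙 _ := by
    have := congrArg (· ≫ c u) h'
    simpa using this
  exact (cancel_epi (c u)).1 this

/-- The permutation `(g, x) ↦ (σ g, x * k g)` of a product of two groups. -/
def skewPerm {Γ P : Type} [Group P] (σ : Equiv.Perm Γ) (k : Γ → P) : Equiv.Perm (Γ × P) where
  toFun y := (σ y.1, y.2 * k y.1)
  invFun y := (σ.symm y.1, y.2 * (k (σ.symm y.1))⁻¹)
  left_inv y := by simp
  right_inv y := by simp

theorem skewPerm_apply {Γ P : Type} [Group P] (σ : Equiv.Perm Γ) (k : Γ → P) (y : Γ × P) :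
    skewPerm σ k y = (σ y.1, y.2 * k y.1) := rfl

variable {Γ : Type} [Group Γ] {ρ : Γ →* (X.carrier ≃ₜ X.carrier)}
  {C : Type} [TopologicalSpace C] {q : X.dom → C}

theorem eventually_proj_twist {t : Γ → X.dom ≃ₜ X.dom}
    (ht : ∀ γ u, X.proj (t γ u) = ρ γ (X.proj u)) {h : OpenPartialHomeomorph X.dom X.dom} {u : X.dom}
    {γ : Γ} (hγ : ∀ᶠ w in 𝓝 u, X.proj (h w) = ρ γ (X.proj w)) (g : Γ) :
    ∀ᶠ w in 𝓝 u, X.proj (t (g * γ⁻¹) (h w)) = X.proj (t g w) := by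
  filter_upwards [hγ] with w hw
  rw [ht, hw, ht, ← Homeomorph.mul_apply, ← map_mul, inv_mul_cancel_right]

section Monodromy

variable (t : Γ → X.dom ≃ₜ X.dom) (ht : ∀ γ u, X.proj (t γ u) = ρ γ (X.proj u))
  {b : X.dom} (c : ∀ u, X.obj b ⟶ X.obj u)

/-- The permutation of `Γ × π₁(X)` defined by a path in a chart domain. -/
def pathPerm {u v : X.dom} (δ : Path u v) : Equiv.Perm (Γ × X.Pi1 b) :=
  skewPerm 1 fun g => loopAt c (X.pathHom (δ.map (t g).continuous))

include ht in
/-- The permutation of `Γ × π₁(X)` defined by a jump along a lift `h` of an element `γ` of `Γ`. -/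
def jumpPerm (h : OpenPartialHomeomorph X.dom X.dom) {u v : X.dom} (hu : u ∈ h.source)
    (hv : h u = v) (γ : Γ) (hγ : ∀ᶠ w in 𝓝 u, X.proj (h w) = ρ γ (X.proj w)) :
    Equiv.Perm (Γ × X.Pi1 b) :=
  skewPerm (Equiv.mulRight γ⁻¹) fun g => loopAt c
    (twistHom h (t g) (t (g * γ⁻¹)) hu hv (eventually_proj_twist ht hγ g))

theorem jumpPerm_congr (h k : OpenPartialHomeomorph X.dom X.dom) {u v : X.dom} (hu : u ∈ h.source)
    (hv : h u = v) (ku : u ∈ k.source) (kv : k u = v) (hk : h =ᶠ[𝓝 u] k) (γ γ' : Γ)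
    (hγ : ∀ᶠ w in 𝓝 u, X.proj (h w) = ρ γ (X.proj w))
    (kγ : ∀ᶠ w in 𝓝 u, X.proj (k w) = ρ γ' (X.proj w)) (e : γ = γ') :
    jumpPerm t ht c h hu hv γ hγ = jumpPerm t ht c k ku kv γ' kγ := by
  subst e
  unfold jumpPerm
  congr 1
  ext1 g
  rw [twistHom_germ h k _ _ hu hv ku kv _ (eventually_proj_twist ht kγ g) hk]

theorem jumpPerm_comp (h k : OpenPartialHomeomorph X.dom X.dom) {u v w : X.dom}
    (hu : u ∈ h.source) (hv : h u = v) (ku : v ∈ k.source) (kv : k v = w)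
    (cu : u ∈ (h.trans k).source) (cv : h.trans k u = w) (γ γ' γ'' : Γ)
    (hγ : ∀ᶠ w in 𝓝 u, X.proj (h w) = ρ γ (X.proj w))
    (kγ : ∀ᶠ w in 𝓝 v, X.proj (k w) = ρ γ' (X.proj w))
    (cγ : ∀ᶠ w in 𝓝 u, X.proj (h.trans k w) = ρ γ'' (X.proj w)) (e : γ'' = γ' * γ) :
    jumpPerm t ht c k ku kv γ' kγ * jumpPerm t ht c h hu hv γ hγ =
      jumpPerm t ht c (h.trans k) cu cv γ'' cγ := by
  subst e
  refine Equiv.ext fun ⟨g, x⟩ => ?_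
  simp only [jumpPerm, Equiv.Perm.mul_apply, skewPerm_apply, Equiv.coe_mulRight]
  have e1 : g * γ⁻¹ * γ'⁻¹ = g * (γ' * γ)⁻¹ := by rw [mul_inv_rev, mul_assoc]
  refine Prod.ext e1 ?_
  change x * _ * _ = x * _
  rw [mul_assoc, ← loopAt_comp]
  congr 1
  rw [twistHom_comp h k _ _ _ hu hv ku kv cu cv _ _ (by
    rw [e1]; exact eventually_proj_twist ht cγ g)]
  have aux : ∀ (s s' : X.dom ≃ₜ X.dom), s = s' → ∀ H H',
      loopAt c (twistHom (h.trans k) (t g) s cu cv H) =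
        loopAt c (twistHom (h.trans k) (t g) s' cu cv H') := by
    rintro s _ rfl _ _
    rfl
  exact aux _ _ (congrArg t e1) _ _

theorem pathPerm_mul_jumpPerm (h : OpenPartialHomeomorph X.dom X.dom) {u v u' v' : X.dom}
    (hu : u ∈ h.source) (hv : v ∈ h.source) (hu' : h u = u') (hv' : h v = v')
    (δ : Path u v) (δ' : Path u' v') (hs : ∀ s, δ s ∈ h.source) (hδ : ∀ s, δ' s = h (δ s)) (γ : Γ)
    (H : ∀ s, ∀ᶠ w in 𝓝 (δ s), X.proj (h w) = ρ γ (X.proj w))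
    (Hu : ∀ᶠ w in 𝓝 u, X.proj (h w) = ρ γ (X.proj w))
    (Hv : ∀ᶠ w in 𝓝 v, X.proj (h w) = ρ γ (X.proj w)) :
    jumpPerm t ht c h hv hv' γ Hv * pathPerm t c δ =
      pathPerm t c δ' * jumpPerm t ht c h hu hu' γ Hu := by
  refine Equiv.ext fun ⟨g, x⟩ => ?_
  simp only [pathPerm, jumpPerm, Equiv.Perm.mul_apply, skewPerm_apply, Equiv.Perm.one_apply]
  refine Prod.ext rfl ?_
  change x * _ * _ = x * _ * _
  rw [mul_assoc, mul_assoc, ← loopAt_comp]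
  have := loopAt_comp c (twistHom h (t g) (t (g * γ⁻¹)) hu hu' (eventually_proj_twist ht Hu g))
    (X.pathHom (δ'.map (t (g * γ⁻¹)).continuous))
  refine congrArg (x * ·) (Eq.trans ?_ this)
  rw [twistHom_slide h _ _ hu hv hu' hv' δ δ' hs hδ
    (fun s => eventually_proj_twist ht (H s) _) (eventually_proj_twist ht Hu g) _]

variable [Finite Γ] (hX : X.IsGoodAction ρ) (hq : ∀ u v, q u = q v → ∃ γ, ρ γ (X.proj u) = X.proj v)

include hX hq in
theorem exists_label_transition (h : (X.withProj q).Transition) {u : X.dom} (hu : u ∈ h.1.source) :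
    ∃ γ, ∀ᶠ w in 𝓝 u, X.proj (h.1 w) = ρ γ (X.proj w) :=
  hX.exists_label h.1 (fun w hw => hq _ _ (h.2 w hw).symm) hu

/-- The element of `Γ` which is lifted near `u` by a change of charts `h` of the quotient. -/
noncomputable def label (h : (X.withProj q).Transition) {u : X.dom} (hu : u ∈ h.1.source) : Γ :=
  (exists_label_transition hX hq h hu).choose

theorem label_spec (h : (X.withProj q).Transition) {u : X.dom} (hu : u ∈ h.1.source) :
    ∀ᶠ w in 𝓝 u, X.proj (h.1 w) = ρ (label hX hq h hu) (X.proj w) :=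
  (exists_label_transition hX hq h hu).choose_spec

theorem label_eq (h : (X.withProj q).Transition) {u : X.dom} (hu : u ∈ h.1.source) {γ : Γ}
    (hγ : ∀ᶠ w in 𝓝 u, X.proj (h.1 w) = ρ γ (X.proj w)) : label hX hq h hu = γ := by
  refine hX.eq_of_eventually (u := u) ?_
  filter_upwards [hγ, label_spec hX hq h hu] with w h1 h2
  rw [← h1, h2]

/-- The action of the fundamental groupoid of the quotient on `Γ × π₁(X)`: the first component keeps
track of the sheet, the second one of the lift to `X`. -/
noncomputable def monodromy : (X.withProj q).FundGpd ⥤ SingleObj (Equiv.Perm (Γ × X.Pi1 b)) :=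
  liftFunctor (X := X.withProj q) (V := SingleObj (Equiv.Perm (Γ × X.Pi1 b)))
    { obj := fun _ => SingleObj.star _
      map := fun {_ _} s => match s with
        | Step.path δ => pathPerm t c δ
        | Step.jump h hu hv => jumpPerm t ht c h.1 hu hv _ (label_spec hX hq h hu) }
    (fun {u v} γ δ H => by
      change pathPerm t c γ = pathPerm t c δ
      unfold pathPerm
      congr 1
      ext1 g
      rw [pathHom_homotopic (H.map ⟨t g, (t g).continuous⟩)])
    (fun {u v w} γ δ => by
      change pathPerm t c δ * pathPerm t c γ = pathPerm t c (γ.trans δ)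
      refine Equiv.ext fun ⟨g, x⟩ => ?_
      simp only [pathPerm, Equiv.Perm.mul_apply, skewPerm_apply]
      refine Prod.ext rfl ?_
      change x * _ * _ = x * _
      rw [mul_assoc, Equiv.Perm.one_apply, ← loopAt_comp, pathHom_trans, ← Path.map_trans])
    (fun {u v w} h k hu hv ku kv cu cv => by
      refine jumpPerm_comp t ht c h.1 k.1 hu hv ku kv cu cv _ _ _ (label_spec hX hq h hu)
        (label_spec hX hq k ku) (label_spec hX hq (h.comp k) cu) ?_
      refine label_eq hX hq _ _ ?_
      have h1 : ∀ᶠ y in 𝓝 u, X.proj (k.1 (h.1 y)) =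
          ρ (label hX hq k ku) (X.proj (h.1 y)) := by
        have := h.1.continuousAt hu
        rw [ContinuousAt, hv] at this
        exact this.eventually (label_spec hX hq k ku)
      filter_upwards [h1, label_spec hX hq h hu] with y h1 h2
      rw [map_mul, Homeomorph.mul_apply, ← h2, ← h1]
      rfl)
    (fun {u v} h k hu hv ku kv H => by
      refine jumpPerm_congr t ht c h.1 k.1 hu hv ku kv H _ _ (label_spec hX hq h hu)
        (label_spec hX hq k ku) ?_
      refine label_eq hX hq _ _ ?_
      filter_upwards [H, label_spec hX hq k ku] with y h1 h2
      rw [h1, h2])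
    (fun {u v u' v'} h hu hv hu' hv' γ γ' hs hγ => by
      have hlab : ∀ s, label hX hq h (hs s) = label hX hq h hu := by
        have hloc : IsLocallyConstant fun s => label hX hq h (hs s) := by
          refine (IsLocallyConstant.iff_eventually_eq _).2 fun s => ?_
          have := γ.continuous.continuousAt.eventually
            (eventually_eventually_nhds.2 (label_spec hX hq h (hs s)))
          filter_upwards [this] with s' hs'
          exact label_eq hX hq h _ hs'
        intro s
        rw [hloc.apply_eq_of_isPreconnected isPreconnected_univ (mem_univ s) (mem_univ 0)]
        congr 1
        exact γ.source
      have hspec : ∀ s, ∀ᶠ w in 𝓝 (γ s),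
          X.proj (h.1 w) = ρ (label hX hq h hu) (X.proj w) := fun s => by
        have := label_spec hX hq h (hs s)
        rwa [hlab] at this
      have hv1 : ∀ᶠ w in 𝓝 v, X.proj (h.1 w) = ρ (label hX hq h hu) (X.proj w) := by
        simpa using hspec 1
      change jumpPerm t ht c h.1 hv hv' _ (label_spec hX hq h hv) * pathPerm t c γ =
        pathPerm t c γ' * jumpPerm t ht c h.1 hu hu' _ (label_spec hX hq h hu)
      rw [jumpPerm_congr t ht c h.1 h.1 hv hv' hv hv' Filter.EventuallyEq.rfl _ _
        (label_spec hX hq h hv) hv1 (label_eq hX hq h _ hv1)]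
      exact pathPerm_mul_jumpPerm t ht c h.1 hu hv hu' hv' γ γ' hs hγ _ hspec _ _)

/-- The permutation of `Γ × π₁(X)` defined by an arrow of the fundamental groupoid of the quotient. -/
noncomputable def monodromyPerm {u v : X.dom}
    (f : (X.withProj q).obj u ⟶ (X.withProj q).obj v) : Equiv.Perm (Γ × X.Pi1 b) :=
  (monodromy t ht c hX hq).map f

theorem monodromyPerm_id (u : X.dom) :
    monodromyPerm t ht c hX hq (𝟙 ((X.withProj q).obj u)) = 1 :=
  (monodromy t ht c hX hq).map_id _

theorem monodromyPerm_comp {u v w : X.dom} (f : (X.withProj q).obj u ⟶ (X.withProj q).obj v)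
    (g : (X.withProj q).obj v ⟶ (X.withProj q).obj w) :
    monodromyPerm t ht c hX hq (f ≫ g) =
      monodromyPerm t ht c hX hq g * monodromyPerm t ht c hX hq f :=
  (monodromy t ht c hX hq).map_comp f g

theorem monodromyPerm_pathHom {u v : X.dom} (γ : Path u v) :
    monodromyPerm t ht c hX hq ((X.withProj q).pathHom γ) = pathPerm t c γ :=
  Hom.lift_map_of _ _

theorem monodromyPerm_jumpHom {u v : X.dom} (h : (X.withProj q).Transition) (hu : u ∈ h.1.source)
    (hv : h.1 u = v) :
    monodromyPerm t ht c hX hq ((X.withProj q).jumpHom h hu hv) =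
      jumpPerm t ht c h.1 hu hv _ (label_spec hX hq h hu) :=
  Hom.lift_map_of _ _

/-- The map to the quotient, which is the identity on the chart domains. -/
def toWithProj (p : X.carrier → C) (hpq : ∀ u, q u = p (X.proj u)) : Hom X (X.withProj q) where
  base := p
  lift := id
  continuous_lift := continuous_id
  proj_lift := hpq
  onJump h := ⟨h.1, fun w hw => by
    change q (h.1 w) = q w
    rw [hpq, h.2 w hw, hpq]⟩
  mem_source _ _ hu := hu
  onJump_lift _ _ _ := rfl
  germ _ _ _ _ _ H := H
  comp _ _ _ _ := Filter.EventuallyEq.rfl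

theorem monodromyPerm_toWithProj (h1 : t 1 = Homeomorph.refl _) (p : X.carrier → C)
    (hpq : ∀ u, q u = p (X.proj u)) {u v : X.dom} (f : X.obj u ⟶ X.obj v) (x : X.Pi1 b) :
    monodromyPerm t ht c hX hq ((toWithProj p hpq).functor.map f) (1, x) =
      (1, x * loopAt c f) := by
  have hpath : ∀ s : X.dom ≃ₜ X.dom, s = Homeomorph.refl _ → ∀ {u v : X.dom} (γ : Path u v),
      loopAt c (X.pathHom (γ.map s.continuous)) = loopAt c (X.pathHom γ) := by
    rintro _ rfl u v γ
    rfl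
  have hjump : ∀ s s' : X.dom ≃ₜ X.dom, s = Homeomorph.refl _ → s' = Homeomorph.refl _ →
      ∀ {u v : X.dom} (h : X.Transition) (hu : u ∈ h.1.source) (hv : h.1 u = v) H,
        loopAt c (twistHom h.1 s s' hu hv H) = loopAt c (X.jumpHom h hu hv) := by
    rintro _ _ rfl rfl u v h hu hv H
    exact congrArg _ (jumpHom_germ _ _ _ _ _ _ Filter.EventuallyEq.rfl)
  refine hom_induction (P := fun {u v} f =>
    monodromyPerm t ht c hX hq ((toWithProj p hpq).functor.map f) (1, x) =
      (1, x * loopAt c f)) (fun u => ?_) (fun {u v w} f γ ih => ?_)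
    (fun {u v w} f h hv hw ih => ?_) f
  · rw [loopAt_id]
    refine (congrArg (fun y => monodromyPerm t ht c hX hq y (1, x))
      ((toWithProj p hpq).functor.map_id (X.obj u))).trans ?_
    exact (congrArg (fun s : Equiv.Perm _ => s (1, x)) (monodromyPerm_id t ht c hX hq u)).trans
      (Prod.ext rfl (mul_one x).symm)
  · rw [Functor.map_comp, Hom.functor_map_pathHom]
    refine (congrArg (fun s : Equiv.Perm _ => s (1, x))
      (monodromyPerm_comp t ht c hX hq _ _)).trans ?_
    rw [Equiv.Perm.mul_apply, ih]
    refine (congrArg (fun s : Equiv.Perm _ => s (1, x * loopAt c f))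
      (monodromyPerm_pathHom t ht c hX hq γ)).trans ?_
    rw [pathPerm, skewPerm_apply, loopAt_comp, ← mul_assoc]
    exact Prod.ext rfl (congrArg (x * loopAt c f * ·) (hpath _ h1 γ))
  · rw [Functor.map_comp, Hom.functor_map_jumpHom]
    refine (congrArg (fun s : Equiv.Perm _ => s (1, x))
      (monodromyPerm_comp t ht c hX hq _ _)).trans ?_
    rw [Equiv.Perm.mul_apply, ih]
    have hlab : ∀ᶠ y in 𝓝 v, X.proj (h.1 y) = ρ 1 (X.proj y) := by
      filter_upwards [h.1.open_source.mem_nhds hv] with y hy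
      rw [map_one]
      exact h.2 y hy
    refine (congrArg (fun s : Equiv.Perm _ => s (1, x * loopAt c f))
      ((monodromyPerm_jumpHom t ht c hX hq ((toWithProj p hpq).onJump h) hv hw).trans
        (jumpPerm_congr t ht c h.1 h.1 hv hw hv hw Filter.EventuallyEq.rfl _ 1
          (label_spec hX hq ((toWithProj p hpq).onJump h) hv) hlab
          (label_eq hX hq _ _ hlab)))).trans ?_
    rw [jumpPerm, skewPerm_apply, loopAt_comp, ← mul_assoc]
    exact Prod.ext (by simp) (congrArg (x * loopAt c f * ·)
      (hjump _ _ h1 ((congrArg t (by simp)).trans h1) h hv hw _))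

include ht c hX hq in
/-- The map to the quotient is injective on fundamental groups: the monodromy recovers the
class of a loop in `X` from its image. -/
theorem pi1Map_toWithProj_injective (h1 : t 1 = Homeomorph.refl _) (p : X.carrier → C)
    (hpq : ∀ u, q u = p (X.proj u)) (u : X.dom) :
    Function.Injective ((toWithProj p hpq).pi1Map u) := by
  refine (injective_iff_map_eq_one _).2 fun f hf => ?_
  have h2 := monodromyPerm_toWithProj t ht c hX hq h1 p hpq f 1
  have h3 : (toWithProj p hpq).functor.map f = 𝟙 _ := hf
  rw [h3] at h2
  have h5 := congrArg (fun s : Equiv.Perm _ => s (1, 1)) (monodromyPerm_id t ht c hX hq u)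
  have h4 : (1 : X.Pi1 b) = 1 * loopAt c f := congrArg Prod.snd (h5.symm.trans h2)
  exact eq_id_of_loopAt_eq_one c (by rw [← one_mul (loopAt c f), ← h4])

end Monodromy

end OrbAtlas

/-! ### Symmetries of pieces of the chart domains -/

namespace OrbAtlas

/-- A family of homeomorphisms of an open piece `O` of the chart domains of `X` which realizes
all identifications by the group `Γ` inside the piece. In the coordinates `φ`, its members are
restrictions of isometries of Euclidean space, whose linear parts are finite in number, and they are
rotations about axes (or trivial). -/
structure PieceSymmetry (X : OrbAtlas) {Γ : Type} [Group Γ] (ρ : Γ →* (X.carrier ≃ₜ X.carrier))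
    {O : Type} [TopologicalSpace O] (ι : O → X.dom) where
  J : Type
  φ : O → Space
  act : J → O ≃ₜ O
  linear : J → Space ≃ₗᵢ[ℝ] Space
  shift : J → Space
  label : J → Γ
  isOpenEmbedding_inclusion : IsOpenEmbedding ι
  isOpenEmbedding_coord : IsOpenEmbedding φ
  coord_act : ∀ j o, φ (act j o) = linear j (φ o) + shift j
  proj_act : ∀ j o, X.proj (ι (act j o)) = ρ (label j) (X.proj (ι o))
  exists_act : ∀ γ o o', ρ γ (X.proj (ι o)) = X.proj (ι o') → ∃ j, label j = γ ∧ act j o = o'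
  exists_label : ∀ γ, ∃ j, label j = γ
  finite_linear : (range linear).Finite
  axis : ∀ j, linear j ≠ 1 → ∃ a : Space, ∀ x, linear j x = x → ∃ t : ℝ, x = t • a
  isolated : ∀ o, ∃ r > 0, ∀ j, dist (φ (act j o)) (φ o) < r → act j o = o

variable {X : OrbAtlas} {Γ : Type} [Group Γ] {ρ : Γ →* (X.carrier ≃ₜ X.carrier)}
  {O : Type} [TopologicalSpace O] {ι : O → X.dom}

namespace PieceSymmetry

theorem nonempty_localModel (F : X.PieceSymmetry ρ ι) (o : O) :
    Nonempty (X.LocalModel ρ (ι o)) := by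
  have : Nonempty O := ⟨o⟩
  have hφ := F.isOpenEmbedding_coord
  have hι := F.isOpenEmbedding_inclusion
  obtain ⟨r, hr, hiso⟩ := F.isolated o
  obtain ⟨r', hr', hball⟩ := Metric.isOpen_iff.1 hφ.isOpen_range (F.φ o) (mem_range_self o)
  set ε := min (r / 2) r' with hε
  have hεpos : 0 < ε := lt_min (by linarith) hr'
  let e0 : OpenPartialHomeomorph Space X.dom :=
    ((Homeomorph.addRight (F.φ o)).toOpenPartialHomeomorph.trans
      ((hφ.toOpenPartialHomeomorph F.φ).symm)).trans (hι.toOpenPartialHomeomorph ι)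
  let e1 := e0.restrOpen (Metric.ball 0 ε) Metric.isOpen_ball
  have hsub : ∀ x ∈ Metric.ball (0 : Space) ε, x + F.φ o ∈ range F.φ := fun x hx => by
    refine hball ?_
    rw [mem_ball_zero_iff] at hx
    simpa using hx.trans_le (min_le_right _ _)
  have he1s : e1.source = Metric.ball 0 ε := by
    simp only [e1, e0, mfld_simps]
    ext x
    simp only [mfld_simps]
    exact ⟨fun h => h.2, fun h => ⟨hsub x h, h⟩⟩
  -- On a point of the ball, the chart inverts `o' ↦ φ o' - φ o`.
  have happ : ∀ x ∈ Metric.ball (0 : Space) ε, ∃ o', e1 x = ι o' ∧ F.φ o' = x + F.φ o := by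
    intro x hx
    obtain ⟨o', ho'⟩ := hsub x hx
    refine ⟨o', ?_, ho'⟩
    change ι ((hφ.toOpenPartialHomeomorph F.φ).symm (x + F.φ o)) = ι o'
    rw [← ho']
    exact congrArg ι ((hφ.toOpenPartialHomeomorph F.φ).left_inv (mem_univ o'))
  have hinv : ∀ o', F.φ o' - F.φ o ∈ Metric.ball (0 : Space) ε → e1 (F.φ o' - F.φ o) = ι o' := by
    intro o' h
    obtain ⟨o'', h1, h2⟩ := happ _ h
    rw [h1, hφ.injective (h2.trans (sub_add_cancel _ _))]
  have hmem : ∀ w ∈ e1.target, ∃ o', w = ι o' ∧ e1.symm w = F.φ o' - F.φ o ∧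
      F.φ o' - F.φ o ∈ Metric.ball (0 : Space) ε := by
    intro w hw
    have h1 := e1.map_target hw
    obtain ⟨o', h2, h3⟩ := happ _ (he1s ▸ h1)
    rw [e1.right_inv hw] at h2
    have h4 : e1.symm w = F.φ o' - F.φ o := by rw [h3]; abel
    exact ⟨o', h2, h4, h4 ▸ he1s ▸ h1⟩
  have h0 : e1 0 = ι o := by
    have := hinv o (by simpa using hεpos)
    rwa [sub_self] at this
  have h0s : (0 : Space) ∈ e1.source := he1s ▸ Metric.mem_ball_self hεpos
  refine ⟨{ e := e1.symm, ε := ε, S := range F.linear, pos := hεpos, mem_source := ?_,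
            map_base := ?_, target_eq := he1s, finite := F.finite_linear, axis := ?_,
            exists_isometry := ?_ }⟩
  · exact h0 ▸ e1.map_source h0s
  · rw [← h0, e1.left_inv h0s]
  · rintro _ ⟨j, rfl⟩
    exact F.axis j
  · intro γ w hw w' hw' h
    obtain ⟨o1, rfl, h1, hb1⟩ := hmem w hw
    obtain ⟨o2, rfl, h2, hb2⟩ := hmem w' hw'
    obtain ⟨j, hj, hj2⟩ := F.exists_act γ o1 o2 h
    have hfix : F.act j o = o := by
      refine hiso j ?_
      have d1 : dist (F.φ (F.act j o)) (F.φ (F.act j o1)) = dist (F.φ o1) (F.φ o) := by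
        rw [F.coord_act, F.coord_act, dist_add_right, (F.linear j).dist_map, dist_comm]
      have t1 := dist_triangle (F.φ (F.act j o)) (F.φ (F.act j o1)) (F.φ o)
      rw [d1, hj2] at t1
      rw [mem_ball_zero_iff, ← dist_eq_norm] at hb1 hb2
      have : ε ≤ r / 2 := min_le_left _ _
      linarith
    have hlin : ∀ o', F.linear j (F.φ o' - F.φ o) = F.φ (F.act j o') - F.φ o := by
      intro o'
      have := F.coord_act j o
      rw [hfix] at this
      rw [map_sub, F.coord_act, eq_sub_of_add_eq' this.symm]
      abel
    refine ⟨F.linear j, mem_range_self j, ?_, fun x hx => ?_⟩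
    · rw [h1, h2, hlin, hj2]
    · change X.proj (e1 (F.linear j x)) = ρ γ (X.proj (e1 x))
      obtain ⟨o', ho', hx'⟩ := happ x hx
      have hx2 : x = F.φ o' - F.φ o := by rw [hx']; abel
      have hx3 := LocalModel.isometry_mem_ball (F.linear j) hx
      rw [ho', ← hj, ← F.proj_act]
      rw [hx2, hlin] at hx3 ⊢
      rw [hinv _ hx3]

theorem exists_lift (F : X.PieceSymmetry ρ ι) {γ : Γ} {o o' : O}
    (h : ρ γ (X.proj (ι o)) = X.proj (ι o')) :
    ∃ k : OpenPartialHomeomorph X.dom X.dom, ι o ∈ k.source ∧ k (ι o) = ι o' ∧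
      ∀ w ∈ k.source, X.proj (k w) = ρ γ (X.proj w) := by
  have : Nonempty O := ⟨o⟩
  obtain ⟨j, rfl, rfl⟩ := F.exists_act γ o o' h
  have hι := F.isOpenEmbedding_inclusion
  have hinv : ∀ o, (hι.toOpenPartialHomeomorph ι).symm (ι o) = o := fun o =>
    (hι.toOpenPartialHomeomorph ι).left_inv (mem_univ o)
  refine ⟨(hι.toOpenPartialHomeomorph ι).symm.trans
    ((F.act j).toOpenPartialHomeomorph.trans (hι.toOpenPartialHomeomorph ι)), ?_, ?_, ?_⟩
  · simp only [mfld_simps]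
  · change ι (F.act j ((hι.toOpenPartialHomeomorph ι).symm (ι o))) = _
    rw [hinv]
  · intro w hw
    simp only [mfld_simps] at hw
    obtain ⟨o, rfl⟩ := hw
    change X.proj (ι (F.act j ((hι.toOpenPartialHomeomorph ι).symm (ι o)))) = _
    rw [hinv, F.proj_act]

theorem exists_homeomorph (F : X.PieceSymmetry ρ ι) (γ : Γ) :
    ∃ t : O ≃ₜ O, ∀ o, X.proj (ι (t o)) = ρ γ (X.proj (ι o)) := by
  obtain ⟨j, rfl⟩ := F.exists_label γ
  exact ⟨F.act j, F.proj_act j⟩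

end PieceSymmetry

end OrbAtlas

/-! ### Rotations of Euclidean space -/

/-- The identification of `ℂ × ℝ` with Euclidean space. -/
noncomputable def toSpace : ℂ × ℝ ≃ₜ Space where
  toFun x := !₂[x.1.re, x.1.im, x.2]
  invFun y := (⟨y 0, y 1⟩, y 2)
  left_inv x := rfl
  right_inv y := by ext i; fin_cases i <;> rfl
  continuous_toFun := by
    refine (PiLp.continuous_toLp 2 _).comp (continuous_pi fun i => ?_)
    fin_cases i
    · exact Complex.continuous_re.comp continuous_fst
    · exact Complex.continuous_im.comp continuous_fst
    · exact continuous_snd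
  continuous_invFun := by
    have h : ∀ i, Continuous fun y : Space => y i := fun i => by fun_prop
    refine Continuous.prodMk ?_ (h 2)
    have : (fun y : Space => (⟨y 0, y 1⟩ : ℂ)) = fun y => (y 0 : ℂ) + (y 1 : ℂ) * Complex.I := by
      funext y
      exact Complex.mk_eq_add_mul_I _ _
    rw [this]
    exact (Complex.continuous_ofReal.comp (h 0)).add
      ((Complex.continuous_ofReal.comp (h 1)).mul continuous_const)

theorem toSpace_apply_zero (x : ℂ × ℝ) : toSpace x 0 = x.1.re := rfl
theorem toSpace_apply_one (x : ℂ × ℝ) : toSpace x 1 = x.1.im := rfl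
theorem toSpace_apply_two (x : ℂ × ℝ) : toSpace x 2 = x.2 := rfl

theorem toSpace_add (x y : ℂ × ℝ) : toSpace (x + y) = toSpace x + toSpace y := by
  ext i
  fin_cases i <;> rfl

theorem toSpace_smul (t : ℝ) (x : ℂ × ℝ) : toSpace (t • x) = t • toSpace x := by
  ext i
  fin_cases i
  · change (t • x.1).re = t * x.1.re; simp
  · change (t • x.1).im = t * x.1.im; simp
  · rfl

theorem norm_toSpace_sq (x : ℂ × ℝ) : ‖toSpace x‖ ^ 2 = ‖x.1‖ ^ 2 + x.2 ^ 2 := by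
  rw [EuclideanSpace.norm_sq_eq, Fin.sum_univ_three, toSpace_apply_zero, toSpace_apply_one,
    toSpace_apply_two, Complex.sq_norm, Complex.normSq_apply]
  simp only [Real.norm_eq_abs, sq_abs]
  ring

/-- The identity of `ℂ` (for the sign `1`) or complex conjugation (for the sign `-1`). -/
noncomputable def conjSign (ε : ℤˣ) : ℂ ≃ₗᵢ[ℝ] ℂ :=
  if ε = 1 then LinearIsometryEquiv.refl ℝ ℂ else Complex.conjLIE

theorem conjSign_one (z : ℂ) : conjSign 1 z = z := by simp [conjSign]

theorem conjSign_neg_one (z : ℂ) : conjSign (-1) z = (starRingEnd ℂ) z := by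
  have : (-1 : ℤˣ) ≠ 1 := by decide
  simp [conjSign, this]

/-- The rotation `(z, l) ↦ (ζ z, l)` (for the sign `1`) or `(z, l) ↦ (ζ * conj z, -l)` (for the
sign `-1`) of `ℂ × ℝ`. -/
noncomputable def rotPair (ζ : Circle) (ε : ℤˣ) (x : ℂ × ℝ) : ℂ × ℝ :=
  (ζ * conjSign ε x.1, ((ε : ℤ) : ℝ) * x.2)

/-- The rotation `rotPair ζ ε` as a linear isometry of Euclidean space. -/
noncomputable def rotSpace (ζ : Circle) (ε : ℤˣ) : Space ≃ₗᵢ[ℝ] Space :=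
  LinearIsometry.toLinearIsometryEquiv
    { toFun := fun y => toSpace (rotPair ζ ε (toSpace.symm y))
      map_add' := fun y y' => by
        obtain ⟨x, rfl⟩ := toSpace.surjective y
        obtain ⟨x', rfl⟩ := toSpace.surjective y'
        rw [← toSpace_add]
        simp only [toSpace.symm_apply_apply]
        rw [← toSpace_add]
        congr 1
        refine Prod.ext ?_ ?_
        · change (ζ : ℂ) * conjSign ε (x.1 + x'.1) = ζ * conjSign ε x.1 + ζ * conjSign ε x'.1
          rw [map_add, mul_add]
        · exact mul_add _ _ _
      map_smul' := fun t y => by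
        obtain ⟨x, rfl⟩ := toSpace.surjective y
        rw [← toSpace_smul]
        simp only [toSpace.symm_apply_apply, RingHom.id_apply]
        rw [← toSpace_smul]
        congr 1
        refine Prod.ext ?_ ?_
        · change (ζ : ℂ) * conjSign ε (t • x.1) = t • (ζ * conjSign ε x.1)
          rw [map_smul, mul_smul_comm]
        · exact mul_left_comm _ _ _
      norm_map' := fun y => by
        obtain ⟨x, rfl⟩ := toSpace.surjective y
        change ‖toSpace (rotPair ζ ε (toSpace.symm (toSpace x)))‖ = _
        rw [toSpace.symm_apply_apply, ← sq_eq_sq₀ (norm_nonneg _) (norm_nonneg _),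
          norm_toSpace_sq, norm_toSpace_sq]
        have h1 : ‖(rotPair ζ ε x).1‖ = ‖x.1‖ := by
          change ‖(ζ : ℂ) * conjSign ε x.1‖ = _
          rw [norm_mul, Circle.norm_coe, one_mul, LinearIsometryEquiv.norm_map]
        have h2 : (rotPair ζ ε x).2 ^ 2 = x.2 ^ 2 := by
          change (((ε : ℤ) : ℝ) * x.2) ^ 2 = _
          rcases Int.units_eq_one_or ε with rfl | rfl <;> simp
        rw [h1, h2] } rfl

theorem rotSpace_toSpace (ζ : Circle) (ε : ℤˣ) (x : ℂ × ℝ) :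
    rotSpace ζ ε (toSpace x) = toSpace (rotPair ζ ε x) := by
  change toSpace (rotPair ζ ε (toSpace.symm (toSpace x))) = _
  rw [toSpace.symm_apply_apply]

/-- A rotation other than the identity fixes only the points of its axis. For the sign `-1` and
`ζ = ξ ^ 2`, the axis is spanned by `(ξ, 0)`. -/
theorem rotSpace_axis (ζ : Circle) (ε : ℤˣ) (hne : rotSpace ζ ε ≠ 1) :
    ∃ a : Space, ∀ x, rotSpace ζ ε x = x → ∃ t : ℝ, x = t • a := by
  rcases Int.units_eq_one_or ε with rfl | rfl
  · have hζ : (ζ : ℂ) ≠ 1 := fun h => hne <| by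
      ext1 y
      obtain ⟨x, rfl⟩ := toSpace.surjective y
      rw [rotSpace_toSpace]
      simp [rotPair, conjSign_one, h]
    refine ⟨toSpace (0, 1), fun y hy => ?_⟩
    obtain ⟨x, rfl⟩ := toSpace.surjective y
    rw [rotSpace_toSpace] at hy
    have h1 : (ζ : ℂ) * conjSign 1 x.1 = x.1 := congrArg Prod.fst (toSpace.injective hy)
    rw [conjSign_one] at h1
    have h2 : x.1 = 0 := by
      by_contra h
      exact hζ (mul_right_cancel₀ h (h1.trans (one_mul _).symm))
    refine ⟨x.2, ?_⟩
    rw [← toSpace_smul]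
    congr 1
    refine Prod.ext ?_ ?_
    · simp [h2]
    · simp
  · obtain ⟨θ, rfl⟩ : ∃ θ, Circle.exp θ = ζ := ⟨_, Circle.exp_arg ζ⟩
    refine ⟨toSpace (Circle.exp (θ / 2), 0), fun y hy => ?_⟩
    obtain ⟨x, rfl⟩ := toSpace.surjective y
    rw [rotSpace_toSpace] at hy
    have h1 : (Circle.exp θ : ℂ) * conjSign (-1) x.1 = x.1 :=
      congrArg Prod.fst (toSpace.injective hy)
    have h2 : ((-1 : ℤˣ) : ℤ) * x.2 = x.2 := congrArg Prod.snd (toSpace.injective hy)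
    rw [conjSign_neg_one] at h1
    have h3 : x.2 = 0 := by
      simp at h2
      linarith
    set ξ := Circle.exp (θ / 2) with hξ
    have h4 : (Circle.exp θ : ℂ) = ξ * ξ := by
      rw [← Circle.coe_mul, hξ, ← Circle.exp_add, add_halves]
    have h5 : (starRingEnd ℂ) (ξ : ℂ) * ξ = 1 := by
      rw [mul_comm, Complex.mul_conj, Circle.normSq_coe, Complex.ofReal_one]
    -- `conj ξ * z` is real.
    have h6 : (starRingEnd ℂ) ((starRingEnd ℂ) (ξ : ℂ) * x.1) = (starRingEnd ℂ) (ξ : ℂ) * x.1 := by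
      rw [map_mul, Complex.conj_conj]
      conv_rhs => rw [← h1, h4]
      linear_combination (-(ξ : ℂ) * (starRingEnd ℂ) x.1) * h5
    obtain ⟨t, ht⟩ := Complex.conj_eq_iff_real.1 h6
    refine ⟨t, ?_⟩
    rw [← toSpace_smul]
    congr 1
    refine Prod.ext ?_ ?_
    · change x.1 = t • (ξ : ℂ)
      rw [Complex.real_smul, ← ht]
      linear_combination (-x.1) * h5
    · simp [h3]

/-! ### Half-turns and the sum of two tangles -/

/-- The points of the lattice `ℤ²`. -/
noncomputable def lattice (w : ℤ × ℤ) : Plane := !₂[(w.1 : ℝ), (w.2 : ℝ)]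

theorem plane_ext {v v' : Plane} (h0 : v 0 = v' 0) (h1 : v 1 = v' 1) : v = v' := by
  ext i
  fin_cases i
  · exact h0
  · exact h1

theorem units_sq (ε : ℤˣ) : ((ε : ℤ) : ℝ) * ((ε : ℤ) : ℝ) = 1 := by
  rcases Int.units_eq_one_or ε with rfl | rfl <;> norm_num

/-- The elements of `halfTurnGroup c` are the maps `v ↦ ± v + 2 * c * w` with `w` in `ℤ²`. -/
theorem exists_of_mem_halfTurnGroup {c : ℝ} {g : Plane ≃ᵃⁱ[ℝ] Plane} (hg : g ∈ halfTurnGroup c) :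
    ∃ (ε : ℤˣ) (w : ℤ × ℤ), ∀ v, g v = ((ε : ℤ) : ℝ) • v + (2 * c) • lattice w := by
  induction hg using Subgroup.closure_induction with
  | mem g hg =>
    obtain ⟨a, b, rfl⟩ := hg
    refine ⟨-1, (a, b), fun v => ?_⟩
    rw [AffineIsometryEquiv.pointReflection_apply]
    refine plane_ext ?_ ?_ <;> simp [lattice] <;> ring
  | one => exact ⟨1, 0, fun v => plane_ext (by simp [lattice]) (by simp [lattice])⟩
  | mul g g' _ _ ih ih' =>
    obtain ⟨ε, w, h⟩ := ih
    obtain ⟨ε', w', h'⟩ := ih'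
    refine ⟨ε * ε', (ε * w'.1 + w.1, ε * w'.2 + w.2), fun v => ?_⟩
    rw [AffineIsometryEquiv.coe_mul, Function.comp_apply, h', h]
    refine plane_ext ?_ ?_ <;> simp [lattice] <;> ring
  | inv g _ ih =>
    obtain ⟨ε, w, h⟩ := ih
    refine ⟨ε, (-ε * w.1, -ε * w.2), fun v => g.injective ?_⟩
    rw [← Function.comp_apply (f := g) (g := ⇑g⁻¹), ← AffineIsometryEquiv.coe_mul,
      mul_inv_cancel, AffineIsometryEquiv.coe_one, id, h]
    have := units_sq ε
    refine plane_ext ?_ ?_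
    · simp [lattice]
      linear_combination (2 * c * w.1 - v.ofLp 0) * this
    · simp [lattice]
      linear_combination (2 * c * w.2 - v.ofLp 1) * this

theorem exists_mem_halfTurnGroup (c : ℝ) (ε : ℤˣ) (w : ℤ × ℤ) :
    ∃ g ∈ halfTurnGroup c, ∀ v, g v = ((ε : ℤ) : ℝ) • v + (2 * c) • lattice w := by
  have hmem : ∀ a b : ℤ, AffineIsometryEquiv.pointReflection ℝ (!₂[c * a, c * b] : Plane) ∈
      halfTurnGroup c := fun a b => Subgroup.subset_closure ⟨a, b, rfl⟩
  rcases Int.units_eq_one_or ε with rfl | rfl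
  · refine ⟨_, (halfTurnGroup c).mul_mem (hmem w.1 w.2) (hmem 0 0), fun v => ?_⟩
    rw [AffineIsometryEquiv.coe_mul, Function.comp_apply,
      AffineIsometryEquiv.pointReflection_apply, AffineIsometryEquiv.pointReflection_apply]
    refine plane_ext ?_ ?_ <;> simp [lattice] <;> ring
  · refine ⟨_, hmem w.1 w.2, fun v => ?_⟩
    rw [AffineIsometryEquiv.pointReflection_apply]
    refine plane_ext ?_ ?_ <;> simp [lattice] <;> ring

theorem height_add_smul (d v u : Plane) (a b : ℝ) :
    height d (a • v + b • u) = a * height d v + b * height d u := by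
  simp [height]
  ring

/-- The direction vector `d` is integral and primitive. -/
def IsPrimitive (d : Plane) : Prop := ∃ a b : ℤ, d 0 = a ∧ d 1 = b ∧ IsCoprime a b

theorem isPrimitive_dirInfty : IsPrimitive dirInfty :=
  ⟨0, 1, by simp [dirInfty], by simp [dirInfty], isCoprime_one_right⟩

theorem isPrimitive_dirSlope (r : ℚ) : IsPrimitive (dirSlope r) :=
  ⟨r.den, r.num, by simp [dirSlope], by simp [dirSlope],
    (Int.isCoprime_iff_gcd_eq_one.2 (by
      rw [Int.gcd, Int.natAbs_natCast]; exact r.reduced)).symm⟩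

theorem IsPrimitive.exists_height {d : Plane} (hd : IsPrimitive d) (w : ℤ × ℤ) :
    ∃ k : ℤ, height d (lattice w) = k := by
  obtain ⟨a, b, ha, hb, -⟩ := hd
  exact ⟨b * w.1 - a * w.2, by simp [height, lattice, ha, hb]⟩

theorem IsPrimitive.exists_lattice {d : Plane} (hd : IsPrimitive d) (k : ℤ) :
    ∃ w : ℤ × ℤ, height d (lattice w) = k := by
  obtain ⟨a, b, ha, hb, u, v, huv⟩ := hd
  refine ⟨(k * v, -k * u), ?_⟩
  have : (u : ℝ) * a + v * b = 1 := by exact_mod_cast huv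
  simp [height, lattice, ha, hb]
  linear_combination (k : ℝ) * this

theorem IsPrimitive.eq_smul {d : Plane} (hd : IsPrimitive d) {w : ℤ × ℤ}
    (h : height d (lattice w) = 0) : ∃ i : ℤ, lattice w = (i : ℝ) • d := by
  obtain ⟨a, b, ha, hb, u, v, huv⟩ := hd
  have h1 : (b : ℝ) * w.1 - a * w.2 = 0 := by simpa [height, lattice, ha, hb] using h
  have h2 : (u : ℝ) * a + v * b = 1 := by exact_mod_cast huv
  refine ⟨u * w.1 + v * w.2, plane_ext ?_ ?_⟩
  · simp [lattice, ha]
    linear_combination (-(w.1 : ℝ)) * h2 + v * h1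
  · simp [lattice, hb]
    linear_combination (-(w.2 : ℝ)) * h2 - u * h1

theorem IsPrimitive.ne_zero {d : Plane} (hd : IsPrimitive d) : d 0 ^ 2 + d 1 ^ 2 ≠ 0 := by
  obtain ⟨a, b, ha, hb, hab⟩ := hd
  have : a ^ 2 + b ^ 2 ≠ 0 := fun h => by
    have h1 : a = 0 := by nlinarith [sq_nonneg a, sq_nonneg b]
    have h2 : b = 0 := by nlinarith [sq_nonneg a, sq_nonneg b]
    subst h1 h2
    exact not_isCoprime_zero_zero hab
  rw [ha, hb]
  intro h
  refine this ((Int.cast_eq_zero (α := ℝ)).1 ?_)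
  push_cast
  exact h

section Invariants

variable {c : ℝ} (hc : 0 < c)

include hc in
theorem cos_eq_iff (a b : ℝ) : Real.cos (Real.pi / c * a) = Real.cos (Real.pi / c * b) ↔
    ∃ (ε : ℤˣ) (k : ℤ), b = (ε : ℤ) * a + 2 * c * k := by
  have hpi := Real.pi_pos
  rw [Real.cos_eq_cos_iff]
  constructor
  · rintro ⟨k, h | h⟩
    · refine ⟨1, k, ?_⟩
      field_simp at h
      simp
      linarith
    · refine ⟨-1, k, ?_⟩
      field_simp at h
      simp
      linarith
  · rintro ⟨ε, k, rfl⟩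
    refine ⟨k, ?_⟩
    rcases Int.units_eq_one_or ε with rfl | rfl
    · left; field_simp; simp; ring
    · right; field_simp; simp; ring

include hc in
theorem sin_signed (ε : ℤˣ) (k : ℤ) (a : ℝ) :
    Real.sin (Real.pi / c * ((ε : ℤ) * a + 2 * c * k)) = (ε : ℤ) * Real.sin (Real.pi / c * a) := by
  have : Real.pi / c * ((ε : ℤ) * a + 2 * c * k) =
      (ε : ℤ) * (Real.pi / c * a) + k * (2 * Real.pi) := by
    field_simp
  rw [this, Real.sin_add_int_mul_two_pi]
  rcases Int.units_eq_one_or ε with rfl | rfl <;> simp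

include hc in
/-- The functions `cos`, `cos` and `sin * sin` of the two coordinates separate the orbits of the group
generated by half-turns. -/
theorem exists_signed_of_trig {v v' : Plane}
    (h0 : Real.cos (Real.pi / c * v 0) = Real.cos (Real.pi / c * v' 0))
    (h1 : Real.cos (Real.pi / c * v 1) = Real.cos (Real.pi / c * v' 1))
    (hs : Real.sin (Real.pi / c * v 0) * Real.sin (Real.pi / c * v 1) =
      Real.sin (Real.pi / c * v' 0) * Real.sin (Real.pi / c * v' 1)) :
    ∃ (ε : ℤˣ) (w : ℤ × ℤ), v' = ((ε : ℤ) : ℝ) • v + (2 * c) • lattice w := by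
  have hzero : ∀ (a : ℝ) (ε : ℤˣ) (k : ℤ), Real.sin (Real.pi / c * a) = 0 →
      ∃ k' : ℤ, (ε : ℤ) * a + 2 * c * k = ((-ε : ℤˣ) : ℤ) * a + 2 * c * k' := by
    intro a ε k h
    obtain ⟨n, hn⟩ := Real.sin_eq_zero_iff.1 h
    have ha : a = c * n := by
      have := Real.pi_pos
      field_simp at hn
      linarith
    refine ⟨k + ε * n, ?_⟩
    rw [ha]
    push_cast
    ring
  obtain ⟨ε, k, hk⟩ := (cos_eq_iff hc _ _).1 h0
  obtain ⟨ε', k', hk'⟩ := (cos_eq_iff hc _ _).1 h1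
  by_cases hε : ε' = ε
  · subst hε
    exact ⟨ε', (k, k'), plane_ext (by simp [lattice, hk]) (by simp [lattice, hk'])⟩
  · have hε' : ε' = -ε := by
      rcases Int.units_eq_one_or ε with rfl | rfl <;>
        rcases Int.units_eq_one_or ε' with rfl | rfl <;> simp_all
    subst hε'
    rw [hk, hk', sin_signed hc, sin_signed hc] at hs
    have h2 : Real.sin (Real.pi / c * v 0) * Real.sin (Real.pi / c * v 1) = 0 := by
      have := units_sq ε
      push_cast at hs
      linear_combination (1 / 2) * hs - (1 / 2) * (Real.sin (Real.pi / c * v 0) *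
        Real.sin (Real.pi / c * v 1)) * this
    rcases mul_eq_zero.1 h2 with h | h
    · obtain ⟨j, hj⟩ := hzero _ ε k h
      exact ⟨-ε, (j, k'), plane_ext (by rw [hk, hj]; simp [lattice]) (by simp [lattice, hk'])⟩
    · obtain ⟨j, hj⟩ := hzero _ (-ε) k' h
      rw [neg_neg] at hj
      exact ⟨ε, (k, j), plane_ext (by simp [lattice, hk]) (by rw [hk', hj]; simp [lattice])⟩

/-- A continuous complete invariant of the identifications in the sum of two tangles. -/
noncomputable def TanglePt.invariant (c : ℝ) (r : ℚ) (x : TanglePt r) :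
    ℝ × ℝ × ℝ × ℝ × ℝ × ℝ :=
  (x.s, (1 - x.s ^ 2) * Real.cos (Real.pi / c * x.v 0),
    (1 - x.s ^ 2) * Real.cos (Real.pi / c * x.v 1),
    (1 - x.s ^ 2) * (Real.sin (Real.pi / c * x.v 0) * Real.sin (Real.pi / c * x.v 1)),
    max x.s 0 * Real.cos (Real.pi / c * height dirInfty x.v),
    max (-x.s) 0 * Real.cos (Real.pi / c * height (dirSlope r) x.v))

theorem TanglePt.continuous_coord (r : ℚ) : Continuous fun x : TanglePt r => (x.v, x.s) :=
  continuous_induced_dom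

theorem TanglePt.continuous_v (r : ℚ) : Continuous fun x : TanglePt r => x.v :=
  continuous_fst.comp (TanglePt.continuous_coord r)

theorem TanglePt.continuous_s (r : ℚ) : Continuous fun x : TanglePt r => x.s :=
  continuous_snd.comp (TanglePt.continuous_coord r)

theorem continuous_height (d : Plane) : Continuous (height d) := by
  unfold height
  fun_prop

theorem TanglePt.continuous_invariant (c : ℝ) (r : ℚ) :
    Continuous (TanglePt.invariant c r) := by
  have hv := TanglePt.continuous_v r
  have hs := TanglePt.continuous_s r
  have h0 : Continuous fun x : TanglePt r => x.v 0 := by fun_prop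
  have h1 : Continuous fun x : TanglePt r => x.v 1 := by fun_prop
  have h2 := (continuous_height dirInfty).comp hv
  have h3 := (continuous_height (dirSlope r)).comp hv
  simp only [Function.comp_def] at h2 h3
  unfold TanglePt.invariant
  fun_prop

theorem TanglePt.ext' {r : ℚ} {x y : TanglePt r} (hv : x.v = y.v) (hs : x.s = y.s) : x = y := by
  cases x; cases y; cases hv; cases hs; rfl

theorem TanglePt.rel_iff {r : ℚ} {x y : TanglePt r} : TanglePt.Rel c r x y ↔
    x.s = y.s ∧ ∃ (ε : ℤˣ) (w : ℤ × ℤ),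
      ((ε : ℤ) : ℝ) • x.v + (2 * c) • lattice w = y.v ∨
      (x.s = 1 ∧ height dirInfty (((ε : ℤ) : ℝ) • x.v + (2 * c) • lattice w) =
        height dirInfty y.v) ∨
      (x.s = -1 ∧ height (dirSlope r) (((ε : ℤ) : ℝ) • x.v + (2 * c) • lattice w) =
        height (dirSlope r) y.v) := by
  constructor
  · rintro ⟨hs, g, hg, h⟩
    obtain ⟨ε, w, hw⟩ := exists_of_mem_halfTurnGroup hg
    rw [hw] at h
    exact ⟨hs, ε, w, h⟩
  · rintro ⟨hs, ε, w, h⟩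
    obtain ⟨g, hg, hw⟩ := exists_mem_halfTurnGroup c ε w
    rw [← hw] at h
    exact ⟨hs, g, hg, h⟩

include hc in
theorem cos_height_eq {d : Plane} (hd : IsPrimitive d) (v : Plane) (ε : ℤˣ) (w : ℤ × ℤ) :
    Real.cos (Real.pi / c * height d (((ε : ℤ) : ℝ) • v + (2 * c) • lattice w)) =
      Real.cos (Real.pi / c * height d v) := by
  obtain ⟨k, hk⟩ := hd.exists_height w
  rw [height_add_smul, hk, eq_comm, cos_eq_iff hc]
  exact ⟨ε, k, rfl⟩

include hc in
theorem TanglePt.invariant_eq_of_rel {r : ℚ} {x y : TanglePt r} (h : TanglePt.Rel c r x y) :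
    x.invariant c r = y.invariant c r := by
  obtain ⟨hs, ε, w, h⟩ := TanglePt.rel_iff.1 h
  unfold TanglePt.invariant
  rw [← hs]
  rcases h with h | ⟨h1, h⟩ | ⟨h1, h⟩
  · have e0 : y.v 0 = (ε : ℤ) * x.v 0 + 2 * c * w.1 := by rw [← h]; simp [lattice]
    have e1 : y.v 1 = (ε : ℤ) * x.v 1 + 2 * c * w.2 := by rw [← h]; simp [lattice]
    have c0 := (cos_eq_iff hc (x.v 0) (y.v 0)).2 ⟨ε, w.1, e0⟩
    have c1 := (cos_eq_iff hc (x.v 1) (y.v 1)).2 ⟨ε, w.2, e1⟩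
    have s01 : Real.sin (Real.pi / c * y.v 0) * Real.sin (Real.pi / c * y.v 1) =
        Real.sin (Real.pi / c * x.v 0) * Real.sin (Real.pi / c * x.v 1) := by
      rw [e0, e1, sin_signed hc, sin_signed hc]
      linear_combination (Real.sin (Real.pi / c * x.v 0) * Real.sin (Real.pi / c * x.v 1)) *
        units_sq ε
    rw [c0, c1, s01, ← h, cos_height_eq hc isPrimitive_dirInfty,
      cos_height_eq hc (isPrimitive_dirSlope r)]
  · rw [h1, ← h, cos_height_eq hc isPrimitive_dirInfty]
    norm_num
  · rw [h1, ← h, cos_height_eq hc (isPrimitive_dirSlope r)]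
    norm_num

include hc in
theorem exists_height_eq {d v v' : Plane} (hd : IsPrimitive d)
    (h : Real.cos (Real.pi / c * height d v) = Real.cos (Real.pi / c * height d v')) :
    ∃ (ε : ℤˣ) (w : ℤ × ℤ), height d (((ε : ℤ) : ℝ) • v + (2 * c) • lattice w) = height d v' := by
  obtain ⟨ε, k, hk⟩ := (cos_eq_iff hc _ _).1 h
  obtain ⟨w, hw⟩ := hd.exists_lattice k
  exact ⟨ε, w, by rw [height_add_smul, hw, hk]⟩

include hc in
theorem TanglePt.rel_of_invariant_eq {r : ℚ} {x y : TanglePt r}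
    (h : x.invariant c r = y.invariant c r) : TanglePt.Rel c r x y := by
  simp only [TanglePt.invariant, Prod.mk.injEq] at h
  obtain ⟨hs, h0, h1, h01, ht, hb⟩ := h
  rw [← hs] at h0 h1 h01 ht hb
  refine TanglePt.rel_iff.2 ⟨hs, ?_⟩
  by_cases h2 : x.s = 1
  · rw [h2] at ht
    obtain ⟨ε, w, h⟩ := exists_height_eq hc isPrimitive_dirInfty (v := x.v) (v' := y.v)
      (by simpa using ht)
    exact ⟨ε, w, Or.inr (Or.inl ⟨h2, h⟩)⟩
  by_cases h3 : x.s = -1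
  · rw [h3] at hb
    obtain ⟨ε, w, h⟩ := exists_height_eq hc (isPrimitive_dirSlope r) (v := x.v) (v' := y.v)
      (by simpa using hb)
    exact ⟨ε, w, Or.inr (Or.inr ⟨h3, h⟩)⟩
  have hpos : 1 - x.s ^ 2 ≠ 0 := fun h => by
    have : (x.s - 1) * (x.s + 1) = 0 := by linarith
    rcases mul_eq_zero.1 this with h | h
    · exact h2 (by linarith)
    · exact h3 (by linarith)
  obtain ⟨ε, w, h⟩ := exists_signed_of_trig hc (mul_left_cancel₀ hpos h0)
    (mul_left_cancel₀ hpos h1) (mul_left_cancel₀ hpos h01)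
  exact ⟨ε, w, Or.inl h.symm⟩

include hc in
theorem TanglePt.mk_eq_iff {r : ℚ} {x y : TanglePt r} :
    Quot.mk (TanglePt.Rel c r) x = Quot.mk _ y ↔ TanglePt.Rel c r x y := by
  refine ⟨fun h => TanglePt.rel_of_invariant_eq hc ?_, Quot.sound⟩
  exact congrArg (Quot.lift (TanglePt.invariant c r)
    fun _ _ => TanglePt.invariant_eq_of_rel hc) h

include hc in
theorem TanglePt.t2Space (r : ℚ) : T2Space (Quot (TanglePt.Rel c r)) := by
  refine T2Space.of_injective_continuous (f := Quot.lift (TanglePt.invariant c r)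
    fun _ _ => TanglePt.invariant_eq_of_rel hc) ?_ ?_
  · rintro ⟨x⟩ ⟨y⟩ h
    exact Quot.sound (TanglePt.rel_of_invariant_eq hc h)
  · exact continuous_quot_lift _ (TanglePt.continuous_invariant c r)

end Invariants

/-! ### The action of `(ℤ/2)²` -/

/-- The group of covering transformations. -/
abbrev DeckGroup : Type := Multiplicative (ZMod 2 × ZMod 2)

/-- The class modulo `2` of a lattice point. -/
def deckClass (w : ℤ × ℤ) : DeckGroup := Multiplicative.ofAdd ((w.1 : ZMod 2), (w.2 : ZMod 2))

theorem deckClass_add (w w' : ℤ × ℤ) : deckClass (w + w') = deckClass w * deckClass w' := by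
  simp only [deckClass, ← ofAdd_add, Prod.mk_add_mk, Prod.fst_add, Prod.snd_add, Int.cast_add]

theorem deckClass_zero : deckClass 0 = 1 := by
  simp [deckClass, ← ofAdd_zero]

theorem deckClass_two_smul (w : ℤ × ℤ) : deckClass (2 • w) = 1 := by
  have : (2 : ZMod 2) = 0 := by decide
  simp [deckClass, ← ofAdd_zero, this]

theorem deckClass_eq_iff {w w' : ℤ × ℤ} : deckClass w = deckClass w' ↔ ∃ u, w' = w + 2 • u := by
  constructor
  · intro h
    have h' : ((w.1 : ZMod 2), (w.2 : ZMod 2)) = ((w'.1 : ZMod 2), (w'.2 : ZMod 2)) := h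
    rw [Prod.mk.injEq, ZMod.intCast_eq_intCast_iff_dvd_sub, ZMod.intCast_eq_intCast_iff_dvd_sub] at h'
    obtain ⟨⟨a, ha⟩, b, hb⟩ := h'
    refine ⟨(a, b), Prod.ext ?_ ?_⟩
    · simp at ha ⊢; omega
    · simp at hb ⊢; omega
  · rintro ⟨u, rfl⟩
    rw [deckClass_add, deckClass_two_smul, mul_one]

theorem deckClass_neg (w : ℤ × ℤ) : deckClass (-w) = deckClass w :=
  deckClass_eq_iff.2 ⟨w, by rw [two_smul]; abel⟩

theorem deckClass_surjective : Function.Surjective deckClass := fun γ =>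
  ⟨((γ.toAdd.1.val : ℤ), (γ.toAdd.2.val : ℤ)), by simp [deckClass]⟩

theorem lattice_add (w w' : ℤ × ℤ) : lattice (w + w') = lattice w + lattice w' :=
  plane_ext (by simp [lattice]) (by simp [lattice])

theorem lattice_two_smul (w : ℤ × ℤ) : lattice (2 • w) = (2 : ℝ) • lattice w :=
  plane_ext (by simp [lattice]) (by simp [lattice])

theorem lattice_neg (w : ℤ × ℤ) : lattice (-w) = -lattice w :=
  plane_ext (by simp [lattice]) (by simp [lattice])

theorem lattice_zero_eq : lattice 0 = 0 := plane_ext (by simp [lattice]) (by simp [lattice])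

/-- The map `v ↦ ± v + w`, for `w` in the lattice. -/
noncomputable def signedShift (ε : ℤˣ) (w : ℤ × ℤ) (v : Plane) : Plane :=
  ((ε : ℤ) : ℝ) • v + lattice w

theorem signedShift_one_zero (v : Plane) : signedShift 1 0 v = v := by
  simp [signedShift, lattice_zero_eq]

theorem continuous_signedShift (ε : ℤˣ) (w : ℤ × ℤ) : Continuous (signedShift ε w) := by
  unfold signedShift
  fun_prop

theorem isLattice_iff {v : Plane} : IsLattice v ↔ ∃ w, v = lattice w := by
  constructor
  · rintro ⟨a, b, h0, h1⟩
    exact ⟨(a, b), plane_ext h0 h1⟩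
  · rintro ⟨w, rfl⟩
    exact ⟨w.1, w.2, rfl, rfl⟩

/-- The inverse of `signedShift ε w` is `signedShift ε w'` with `w' = - ε * w`. -/
theorem signedShift_signedShift (ε : ℤˣ) (w : ℤ × ℤ) (v : Plane) :
    signedShift ε (-(ε : ℤ) • w) (signedShift ε w v) = v := by
  have := units_sq ε
  refine plane_ext ?_ ?_
  · simp [signedShift, lattice]
    linear_combination v.ofLp 0 * this
  · simp [signedShift, lattice]
    linear_combination v.ofLp 1 * this

theorem neg_smul_neg_smul (ε : ℤˣ) (w : ℤ × ℤ) : -(ε : ℤ) • (-(ε : ℤ) • w) = w := by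
  rcases Int.units_eq_one_or ε with rfl | rfl <;> simp

theorem not_isLattice_signedShift (ε : ℤˣ) (w : ℤ × ℤ) {v : Plane} (h : ¬ IsLattice v) :
    ¬ IsLattice (signedShift ε w v) := by
  intro h'
  obtain ⟨u, hu⟩ := isLattice_iff.1 h'
  refine h (isLattice_iff.2 ⟨(ε : ℤ) • u + (-(ε : ℤ) • w), ?_⟩)
  rw [← signedShift_signedShift ε w v, hu]
  refine plane_ext ?_ ?_ <;> simp [signedShift, lattice]

theorem height_signedShift (d : Plane) (ε : ℤˣ) (w : ℤ × ℤ) (v : Plane) :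
    height d (signedShift ε w v) = (ε : ℤ) * height d v + height d (lattice w) := by
  have := height_add_smul d v (lattice w) (ε : ℤ) 1
  rwa [one_smul, one_mul] at this

theorem IsPrimitive.height_signedShift_ne {d : Plane} (hd : IsPrimitive d) (ε : ℤˣ) (w : ℤ × ℤ)
    {v : Plane} (h : ∀ j : ℤ, height d v ≠ j) (j : ℤ) : height d (signedShift ε w v) ≠ j := by
  intro h'
  obtain ⟨k, hk⟩ := hd.exists_height w
  rw [height_signedShift, hk] at h'
  refine h (ε * (j - k)) ?_
  push_cast
  rw [← h']
  linear_combination (-height d v) * units_sq ε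

namespace TanglePt

variable {r : ℚ}

/-- The action of `v ↦ ± v + w` on the points of the sum of two tangles. -/
noncomputable def move (ε : ℤˣ) (w : ℤ × ℤ) (x : TanglePt r) : TanglePt r where
  v := signedShift ε w x.v
  s := x.s
  mem := x.mem
  off_lattice := not_isLattice_signedShift ε w x.off_lattice
  off_top h := isPrimitive_dirInfty.height_signedShift_ne ε w (x.off_top h)
  off_bot h := (isPrimitive_dirSlope r).height_signedShift_ne ε w (x.off_bot h)

theorem continuous_move (ε : ℤˣ) (w : ℤ × ℤ) : Continuous (move (r := r) ε w) :=
  continuous_induced_rng.2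
    (((continuous_signedShift ε w).comp (continuous_v r)).prodMk (continuous_s r))

/-- The points `x` and `y` are at the same level, and `v ↦ ± v + w` takes `x` to `y`, up to
the collapsing of lines at the ends. -/
def Meets (ε : ℤˣ) (w : ℤ × ℤ) (x y : TanglePt r) : Prop :=
  x.s = y.s ∧ (signedShift ε w x.v = y.v ∨
    (x.s = 1 ∧ height dirInfty (signedShift ε w x.v) = height dirInfty y.v) ∨
    (x.s = -1 ∧ height (dirSlope r) (signedShift ε w x.v) = height (dirSlope r) y.v))

theorem meets_move (ε : ℤˣ) (w : ℤ × ℤ) (x : TanglePt r) : Meets ε w x (move ε w x) :=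
  ⟨rfl, Or.inl rfl⟩

theorem rel_one_iff {x y : TanglePt r} : Rel 1 r x y ↔ ∃ ε w, deckClass w = 1 ∧ Meets ε w x y := by
  rw [rel_iff]
  constructor
  · rintro ⟨hs, ε, w, h⟩
    refine ⟨ε, 2 • w, deckClass_two_smul w, hs, ?_⟩
    rw [signedShift, lattice_two_smul]
    simpa using h
  · rintro ⟨ε, w, hw, hs, h⟩
    obtain ⟨u, rfl⟩ := deckClass_eq_iff.1 (deckClass_zero.trans hw.symm)
    refine ⟨hs, ε, u, ?_⟩
    rw [zero_add, signedShift, lattice_two_smul] at h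
    simpa using h

theorem rel_half_iff {x y : TanglePt r} : Rel (1 / 2) r x y ↔ ∃ ε w, Meets ε w x y := by
  rw [rel_iff]
  simp only [show (2 * (1 / 2) : ℝ) = 1 by norm_num, one_smul]
  exact ⟨fun ⟨hs, ε, w, h⟩ => ⟨ε, w, hs, h⟩, fun ⟨ε, w, hs, h⟩ => ⟨hs, ε, w, h⟩⟩

theorem mk_one_eq_iff {x y : TanglePt r} :
    Quot.mk (Rel 1 r) x = Quot.mk _ y ↔ ∃ ε w, deckClass w = 1 ∧ Meets ε w x y :=
  (mk_eq_iff one_pos).trans rel_one_iff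

theorem signedShift_one_comp (ε : ℤˣ) (w u : ℤ × ℤ) (v : Plane) :
    signedShift ε u (signedShift 1 w v) = signedShift ε ((ε : ℤ) • w + u) v := by
  refine plane_ext ?_ ?_ <;> simp [signedShift, lattice] <;> ring

theorem deckClass_smul (ε : ℤˣ) (w : ℤ × ℤ) : deckClass ((ε : ℤ) • w) = deckClass w := by
  rcases Int.units_eq_one_or ε with rfl | rfl
  · simp
  · simp [deckClass_neg]

theorem mk_move_eq_iff {w : ℤ × ℤ} {x y : TanglePt r} :
    Quot.mk (Rel 1 r) (move 1 w x) = Quot.mk _ y ↔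
      ∃ ε w', deckClass w' = deckClass w ∧ Meets ε w' x y := by
  rw [mk_one_eq_iff]
  constructor
  · rintro ⟨ε, u, hu, h⟩
    refine ⟨ε, (ε : ℤ) • w + u, by rw [deckClass_add, hu, mul_one, deckClass_smul], ?_⟩
    rw [Meets, ← signedShift_one_comp]
    exact h
  · rintro ⟨ε, w', hw, h⟩
    refine ⟨ε, w' - (ε : ℤ) • w, ?_, ?_⟩
    · rw [sub_eq_add_neg, deckClass_add, deckClass_neg, deckClass_smul, hw, ← deckClass_add,
        ← two_smul ℕ, deckClass_two_smul]
    · have e : signedShift ε w' x.v = signedShift ε (w' - (ε : ℤ) • w) (move 1 w x).v := by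
        change _ = signedShift ε _ (signedShift 1 w x.v)
        rw [signedShift_one_comp, add_sub_cancel]
      rw [Meets, ← e]
      exact h

/-- The translation by a lattice point of the sum of two tangles. -/
noncomputable def translate (w : ℤ × ℤ) : Quot (Rel 1 r) → Quot (Rel 1 r) :=
  Quot.lift (fun x => Quot.mk _ (move 1 w x)) fun x y h => by
    obtain ⟨ε, u, hu, hs, h⟩ := rel_one_iff.1 h
    refine mk_move_eq_iff.2 ⟨ε, u + w, by rw [deckClass_add, hu, one_mul], hs, ?_⟩
    have e : ∀ v, signedShift ε (u + w) v = signedShift 1 w (signedShift ε u v) := by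
      intro v
      refine plane_ext ?_ ?_ <;> simp [signedShift, lattice] <;> ring
    rw [e]
    refine h.imp (fun h => by rw [h]; rfl)
      (Or.imp (fun h => ⟨h.1, ?_⟩) fun h => ⟨h.1, ?_⟩)
    · rw [height_signedShift, h.2, ← height_signedShift]; rfl
    · rw [height_signedShift, h.2, ← height_signedShift]; rfl

theorem continuous_translate (w : ℤ × ℤ) : Continuous (translate (r := r) w) :=
  continuous_quot_lift _ (continuous_quot_mk.comp (continuous_move 1 w))

theorem translate_translate (w w' : ℤ × ℤ) (x : Quot (Rel 1 r)) :
    translate w (translate w' x) = translate (w + w') x := by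
  obtain ⟨x⟩ := x
  refine congrArg (Quot.mk (Rel 1 r)) (ext' (x := move 1 w (move 1 w' x)) ?_ rfl)
  change signedShift 1 w (signedShift 1 w' x.v) = signedShift 1 (w + w') x.v
  refine plane_ext ?_ ?_ <;> simp [signedShift, lattice] <;> ring

theorem translate_congr {w w' : ℤ × ℤ} (h : deckClass w = deckClass w') :
    translate (r := r) w = translate w' := by
  funext x
  obtain ⟨x⟩ := x
  exact mk_move_eq_iff.2 ⟨1, w', h.symm, meets_move 1 w' x⟩

theorem translate_eq_self {w : ℤ × ℤ} (h : deckClass w = 1) (x : Quot (Rel 1 r)) :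
    translate w x = x := by
  rw [translate_congr (h.trans deckClass_zero.symm)]
  obtain ⟨x⟩ := x
  exact congrArg (Quot.mk (Rel 1 r)) (ext' (x := move 1 0 x) (signedShift_one_zero x.v) rfl)

/-- The translation by a lattice point as a homeomorphism. -/
noncomputable def translateHomeo (w : ℤ × ℤ) : Quot (Rel 1 r) ≃ₜ Quot (Rel 1 r) where
  toFun := translate w
  invFun := translate (-w)
  left_inv x := by rw [translate_translate, translate_eq_self (by simp [deckClass_zero])]
  right_inv x := by rw [translate_translate, translate_eq_self (by simp [deckClass_zero])]
  continuous_toFun := continuous_translate w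
  continuous_invFun := continuous_translate (-w)

/-- The action of `(ℤ/2)²` by translations. -/
noncomputable def deckAction (r : ℚ) : DeckGroup →* (Quot (Rel 1 r) ≃ₜ Quot (Rel 1 r)) where
  toFun γ := translateHomeo (deckClass_surjective γ).choose
  map_one' := Homeomorph.ext fun x =>
    translate_eq_self (deckClass_surjective 1).choose_spec x
  map_mul' γ γ' := Homeomorph.ext fun x => by
    change translate _ x = translate _ (translate _ x)
    rw [translate_translate]
    refine congrFun (translate_congr ?_) x
    rw [deckClass_add, (deckClass_surjective _).choose_spec, (deckClass_surjective _).choose_spec,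
      (deckClass_surjective _).choose_spec]

theorem deckAction_mk_eq_iff {γ : DeckGroup} {x y : TanglePt r} :
    deckAction r γ (Quot.mk _ x) = Quot.mk _ y ↔ ∃ ε w, deckClass w = γ ∧ Meets ε w x y := by
  refine Iff.trans mk_move_eq_iff ?_
  rw [(deckClass_surjective γ).choose_spec]

theorem deckAction_mk (ε : ℤˣ) (w : ℤ × ℤ) (x : TanglePt r) :
    deckAction r (deckClass w) (Quot.mk _ x) = Quot.mk _ (move ε w x) :=
  deckAction_mk_eq_iff.2 ⟨ε, w, rfl, meets_move ε w x⟩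

/-- The quotient map from the orbifold for `ℤ²` to the orbifold for `(½ ℤ)²`. -/
noncomputable def halfQuot (r : ℚ) : Quot (Rel 1 r) → Quot (Rel (1 / 2) r) :=
  Quot.map id fun _ _ ⟨e, g, hg, h⟩ => ⟨e, g, halfTurnGroup_le hg, h⟩

theorem continuous_halfQuot (r : ℚ) : Continuous (halfQuot r) :=
  continuous_quot_lift _ continuous_quot_mk

theorem surjective_halfQuot (r : ℚ) : Function.Surjective (halfQuot r) := by
  rintro ⟨x⟩
  exact ⟨Quot.mk _ x, rfl⟩

theorem isQuotientMap_halfQuot (r : ℚ) : IsQuotientMap (halfQuot r) :=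
  IsQuotientMap.of_comp continuous_quot_mk (continuous_halfQuot r)
    (isQuotientMap_quot_mk (r := Rel (1 / 2) r))

theorem halfQuot_eq_iff (x y : Quot (Rel 1 r)) :
    halfQuot r x = halfQuot r y ↔ ∃ γ, deckAction r γ x = y := by
  obtain ⟨x⟩ := x
  obtain ⟨y⟩ := y
  refine (mk_eq_iff (by norm_num)).trans (rel_half_iff.trans ?_)
  constructor
  · rintro ⟨ε, w, h⟩
    exact ⟨deckClass w, deckAction_mk_eq_iff.2 ⟨ε, w, rfl, h⟩⟩
  · rintro ⟨γ, h⟩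
    obtain ⟨ε, w, -, h⟩ := deckAction_mk_eq_iff.1 h
    exact ⟨ε, w, h⟩

end TanglePt

/-! ### The middle part -/

/-- The chart domain of the middle part. -/
abbrev MidPiece : Type := PuncturedPlane × Ioo (-1 : ℝ) 1

/-- The map `v ↦ ± v + w` of the punctured plane, for `w` in the lattice. -/
noncomputable def planeMove (ε : ℤˣ) (w : ℤ × ℤ) : PuncturedPlane ≃ₜ PuncturedPlane where
  toFun v := ⟨signedShift ε w v, not_isLattice_signedShift ε w v.2⟩
  invFun v := ⟨signedShift ε (-(ε : ℤ) • w) v, not_isLattice_signedShift ε _ v.2⟩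
  left_inv v := Subtype.ext (signedShift_signedShift ε w v)
  right_inv v := Subtype.ext (by
    have := signedShift_signedShift ε (-(ε : ℤ) • w) v.1
    rwa [neg_smul_neg_smul] at this)
  continuous_toFun := ((continuous_signedShift ε w).comp continuous_subtype_val).subtype_mk _
  continuous_invFun := ((continuous_signedShift ε _).comp continuous_subtype_val).subtype_mk _

theorem isOpen_not_isLattice : IsOpen {v : Plane | ¬ IsLattice v} := by
  have hr := Int.isClosedEmbedding_coe_real.isClosed_range
  have h0 : IsClosed {v : Plane | v 0 ∈ range ((↑) : ℤ → ℝ)} :=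
    hr.preimage (by fun_prop : Continuous fun v : Plane => v 0)
  have h1 : IsClosed {v : Plane | v 1 ∈ range ((↑) : ℤ → ℝ)} :=
    hr.preimage (by fun_prop : Continuous fun v : Plane => v 1)
  have : {v : Plane | IsLattice v} =
      {v : Plane | v 0 ∈ range ((↑) : ℤ → ℝ)} ∩ {v : Plane | v 1 ∈ range ((↑) : ℤ → ℝ)} := by
    ext v
    constructor
    · rintro ⟨a, b, h0, h1⟩
      exact ⟨⟨a, h0.symm⟩, ⟨b, h1.symm⟩⟩
    · rintro ⟨⟨a, h0⟩, ⟨b, h1⟩⟩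
      exact ⟨a, b, h0.symm, h1.symm⟩
  have hcl : IsClosed {v : Plane | IsLattice v} := this ▸ h0.inter h1
  exact hcl.isOpen_compl

/-- The plane as the complex line. -/
noncomputable def planeToComplex : Plane ≃ₜ ℂ :=
  Complex.orthonormalBasisOneI.repr.symm.toHomeomorph

theorem planeToComplex_apply (v : Plane) : planeToComplex v = v 0 + v 1 * Complex.I :=
  Complex.orthonormalBasisOneI_repr_symm_apply v

/-- The coordinates of the middle part in Euclidean space. -/
noncomputable def midCoord (x : MidPiece) : Space := toSpace (planeToComplex x.1, x.2)

theorem isOpenEmbedding_midCoord : IsOpenEmbedding midCoord :=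
  toSpace.isOpenEmbedding.comp
    ((planeToComplex.isOpenEmbedding.comp
      isOpen_not_isLattice.isOpenEmbedding_subtypeVal).prodMap isOpen_Ioo.isOpenEmbedding_subtypeVal)

/-- The element `± 1` of the circle. -/
noncomputable def signCircle (ε : ℤˣ) : Circle := if ε = 1 then 1 else Circle.exp Real.pi

theorem coe_signCircle (ε : ℤˣ) : (signCircle ε : ℂ) = ((ε : ℤ) : ℂ) := by
  rcases Int.units_eq_one_or ε with rfl | rfl
  · simp [signCircle]
  · have : (-1 : ℤˣ) ≠ 1 := by decide
    simp [signCircle, this]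

theorem exists_isolated_real (x : ℝ) : ∃ r > 0, ∀ n : ℤ, |(n : ℝ) - x| < r → (n : ℝ) = x := by
  have hcl : IsClosed (range ((↑) : ℤ → ℝ) \ {x}) := by
    rw [show range ((↑) : ℤ → ℝ) \ {x} = ((↑) : ℤ → ℝ) '' {n : ℤ | (n : ℝ) ≠ x} by
      ext y
      constructor
      · rintro ⟨⟨n, rfl⟩, h⟩
        exact ⟨n, h, rfl⟩
      · rintro ⟨n, h, rfl⟩
        exact ⟨⟨n, rfl⟩, h⟩]
    exact Int.isClosedEmbedding_coe_real.isClosedMap _ (isClosed_discrete _)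
  obtain ⟨r, hr, h⟩ := Metric.isOpen_iff.1 hcl.isOpen_compl x fun h => h.2 rfl
  refine ⟨r, hr, fun n hn => ?_⟩
  by_contra hne
  exact h (show (n : ℝ) ∈ Metric.ball x r by rwa [Metric.mem_ball, Real.dist_eq])
    ⟨⟨n, rfl⟩, hne⟩

theorem exists_isolated_signedShift (v : Plane) :
    ∃ r > 0, ∀ (ε : ℤˣ) (w : ℤ × ℤ), |signedShift ε w v 0 - v 0| < r →
      |signedShift ε w v 1 - v 1| < r → signedShift ε w v = v := by
  obtain ⟨r0, hr0, h0⟩ := exists_isolated_real (2 * v 0)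
  obtain ⟨r1, hr1, h1⟩ := exists_isolated_real (2 * v 1)
  have h2 : ∀ n : ℤ, |(n : ℝ)| < 1 → (n : ℝ) = 0 := fun n hn => by
    have : |n| < 1 := by exact_mod_cast hn
    rw [Int.abs_lt_one_iff.1 this, Int.cast_zero]
  refine ⟨min 1 (min r0 r1), by positivity, fun ε w ha hb => ?_⟩
  rw [lt_min_iff, lt_min_iff] at ha hb
  rcases Int.units_eq_one_or ε with rfl | rfl
  · have e0 := h2 w.1 (by simpa [signedShift, lattice] using ha.1)
    have e1 := h2 w.2 (by simpa [signedShift, lattice] using hb.1)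
    exact plane_ext (by simp [signedShift, lattice, e0]) (by simp [signedShift, lattice, e1])
  · have e0 := h0 w.1 (by
      refine lt_of_eq_of_lt (congrArg abs ?_) ha.2.1
      simp [signedShift, lattice]; ring)
    have e1 := h1 w.2 (by
      refine lt_of_eq_of_lt (congrArg abs ?_) hb.2.2
      simp [signedShift, lattice]; ring)
    refine plane_ext ?_ ?_
    · simp [signedShift, lattice, e0]; ring
    · simp [signedShift, lattice, e1]; ring

namespace TanglePt

theorem midPoint_meets_iff {r : ℚ} {ε : ℤˣ} {w : ℤ × ℤ} {x y : MidPiece} :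
    Meets ε w (midPoint r x) (midPoint r y) ↔ x.2 = y.2 ∧ planeMove ε w x.1 = y.1 := by
  constructor
  · rintro ⟨hs, h | ⟨h, -⟩ | ⟨h, -⟩⟩
    · exact ⟨Subtype.ext hs, Subtype.ext h⟩
    · exact absurd h x.2.2.2.ne
    · exact absurd h x.2.2.1.ne'
  · rintro ⟨h1, h2⟩
    exact ⟨congrArg Subtype.val h1, Or.inl (congrArg Subtype.val h2)⟩

end TanglePt

/-- The identifications in the middle part are realized by the maps `v ↦ ± v + w`. -/
noncomputable def midSymmetry (r : ℚ) (n : ℕ) :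
    (evenHeckoid r n).PieceSymmetry (TanglePt.deckAction r) (O := MidPiece) Sum.inl where
  J := ℤˣ × (ℤ × ℤ)
  φ := midCoord
  act j := (planeMove j.1 j.2).prodCongr (Homeomorph.refl _)
  linear j := rotSpace (signCircle j.1) 1
  shift j := toSpace (planeToComplex (lattice j.2), 0)
  label j := deckClass j.2
  isOpenEmbedding_inclusion := IsOpenEmbedding.inl
  isOpenEmbedding_coord := isOpenEmbedding_midCoord
  coord_act j x := by
    unfold midCoord
    rw [rotSpace_toSpace, ← toSpace_add]
    congr 1
    refine Prod.ext ?_ ?_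
    · change planeToComplex (signedShift j.1 j.2 x.1.1) = (signCircle j.1 : ℂ) *
        conjSign 1 (planeToComplex x.1.1) + planeToComplex (lattice j.2)
      rw [conjSign_one, coe_signCircle, planeToComplex_apply, planeToComplex_apply,
        planeToComplex_apply]
      simp [signedShift]
      ring
    · change (x.2 : ℝ) = ((1 : ℤˣ) : ℤ) * (x.2 : ℝ) + 0
      simp
  proj_act j x := (TanglePt.deckAction_mk j.1 j.2 (midPoint r x)).symm
  exists_act γ x y h := by
    obtain ⟨ε, w, hw, h⟩ := TanglePt.deckAction_mk_eq_iff.1 h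
    obtain ⟨h1, h2⟩ := TanglePt.midPoint_meets_iff.1 h
    exact ⟨(ε, w), hw, Prod.ext h2 h1⟩
  exists_label γ := by
    obtain ⟨w, hw⟩ := deckClass_surjective γ
    exact ⟨(1, w), hw⟩
  finite_linear := (finite_range fun ε : ℤˣ => rotSpace (signCircle ε) 1).subset
    (by rintro _ ⟨j, rfl⟩; exact ⟨j.1, rfl⟩)
  axis j := rotSpace_axis _ _
  isolated x := by
    obtain ⟨r, hr, h⟩ := exists_isolated_signedShift x.1.1
    refine ⟨r, hr, fun j hj => ?_⟩
    have hcoord : ∀ (y y' : Space) (i : Fin 3), |y i - y' i| ≤ dist y y' := fun y y' i => by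
      rw [dist_eq_norm]
      exact PiLp.norm_apply_le (y - y') i
    have hre : ∀ y : MidPiece, midCoord y 0 = y.1.1 0 := fun y => by
      change (planeToComplex y.1.1).re = _
      simp [planeToComplex_apply]
    have him : ∀ y : MidPiece, midCoord y 1 = y.1.1 1 := fun y => by
      change (planeToComplex y.1.1).im = _
      simp [planeToComplex_apply]
    refine Prod.ext (Subtype.ext (h j.1 j.2 ?_ ?_)) rfl
    · have := (hcoord _ _ 0).trans_lt hj
      rwa [hre, hre] at this
    · have := (hcoord _ _ 1).trans_lt hj
      rwa [him, him] at this

/-! ### The handles -/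

/-- The position of a point along the lines of direction `d`. -/
noncomputable def position (d v : Plane) : ℝ := (d 0 * v 0 + d 1 * v 1) / (d 0 ^ 2 + d 1 ^ 2)

theorem continuous_position (d : Plane) : Continuous (position d) := by
  unfold position
  fun_prop

theorem position_linePoint {d : Plane} (hd : d 0 ^ 2 + d 1 ^ 2 ≠ 0) (k l : ℝ) :
    position d (linePoint d k l) = k := by
  simp [position, linePoint]
  field_simp
  ring

theorem linePoint_position {d : Plane} (hd : d 0 ^ 2 + d 1 ^ 2 ≠ 0) (v : Plane) :
    linePoint d (position d v) (height d v) = v := by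
  refine plane_ext ?_ ?_
  · simp [position, linePoint, height]
    field_simp
    ring
  · simp [position, linePoint, height]
    field_simp
    ring

theorem position_signedShift (d : Plane) (ε : ℤˣ) (w : ℤ × ℤ) (v : Plane) :
    position d (signedShift ε w v) = (ε : ℤ) * position d v + position d (lattice w) := by
  simp [position, signedShift]
  ring

theorem position_smul_self {d : Plane} (hd : d 0 ^ 2 + d 1 ^ 2 ≠ 0) (t : ℝ) :
    position d (t • d) = t := by
  simp [position]
  field_simp

theorem continuous_linePoint (d : Plane) : Continuous fun x : ℝ × ℝ => linePoint d x.1 x.2 := by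
  unfold linePoint
  fun_prop

theorem plane_eq_of_position_height {d : Plane} (hd : d 0 ^ 2 + d 1 ^ 2 ≠ 0) {v v' : Plane}
    (hp : position d v = position d v') (hh : height d v = height d v') : v = v' := by
  rw [← linePoint_position hd v, hp, hh, linePoint_position hd]

theorem not_isLattice_of_height {d : Plane} (hd : IsPrimitive d) {v : Plane}
    (h : height d v ∈ Ioo (0 : ℝ) 1) : ¬ IsLattice v := by
  intro h'
  obtain ⟨w, rfl⟩ := isLattice_iff.1 h'
  obtain ⟨k, hk⟩ := hd.exists_height w
  exact not_int_of_mem_Ioo h k hk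

/-- The handle coordinates of a point of the strip `0 < height d v < 1` at level `s`: the inverse of
`topPoint` and `botPoint`, with the level of the collapsed end normalized to `η * s = 1`. -/
noncomputable def handleCoord (d : Plane) (η : ℝ) (b : ℕ) (x : Plane × ℝ) : ℂ × ℝ :=
  (((1 - η * x.2 : ℝ) : ℂ) * Circle.exp (Real.pi * position d x.1 / b), height d x.1)

theorem continuous_handleCoord (d : Plane) (η : ℝ) (b : ℕ) : Continuous (handleCoord d η b) := by
  have h1 := (continuous_position d).comp (continuous_fst (X := Plane) (Y := ℝ))
  have h2 := (continuous_height d).comp (continuous_fst (X := Plane) (Y := ℝ))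
  simp only [Function.comp_def] at h1 h2
  unfold handleCoord
  fun_prop

theorem conjSign_circleExp (ε : ℤˣ) (t : ℝ) :
    conjSign ε (Circle.exp t : ℂ) = Circle.exp ((ε : ℤ) * t) := by
  rcases Int.units_eq_one_or ε with rfl | rfl
  · simp [conjSign_one]
  · rw [conjSign_neg_one, ← Circle.coe_inv_eq_conj, ← Circle.exp_neg]
    simp

theorem conjSign_ofReal_mul (ε : ℤˣ) (t : ℝ) (z : ℂ) : conjSign ε (t * z) = t * conjSign ε z := by
  rw [← Complex.real_smul, map_smul, Complex.real_smul]

/-- The maps `v ↦ ± v + w` act on the handle coordinates by rotations about axes. -/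
theorem handleCoord_signedShift (d : Plane) (η : ℝ) (b : ℕ) (ε : ℤˣ) (w : ℤ × ℤ) (v : Plane) (s : ℝ) :
    handleCoord d η b (signedShift ε w v, s) =
      rotPair (Circle.exp (Real.pi * position d (lattice w) / b)) ε (handleCoord d η b (v, s)) +
        (0, height d (lattice w)) := by
  refine Prod.ext ?_ ?_
  · change _ * (Circle.exp (Real.pi * position d (signedShift ε w v) / b) : ℂ) =
      (Circle.exp _ : ℂ) * conjSign ε (_ * (Circle.exp _ : ℂ)) + 0
    have e : Real.pi * position d (signedShift ε w v) / b =
        Real.pi * position d (lattice w) / b + (ε : ℤ) * (Real.pi * position d v / b) := by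
      rw [position_signedShift]
      ring
    rw [conjSign_ofReal_mul, conjSign_circleExp, e, Circle.exp_add, Circle.coe_mul]
    ring
  · exact height_signedShift d ε w v

open TanglePt

/-- The common properties of the parametrizations `topPoint` and `botPoint` of the two handles of the
orbifold for `ℤ²`: the handle at the end `s = η` is attached along the lines of direction `d`, and its
meridian runs `b` times around the loop. -/
structure IsHandle (r : ℚ) (d : Plane) (η : ℝ) (b : ℕ) (H : OpenHandle → TanglePt r) : Prop where
  pos : 0 < b
  isPrimitive : IsPrimitive d
  sign : η * η = 1
  v_eq : ∀ o, (H o).v = linePoint d (2 * 1 * b * (Complex.arg o.1 / (2 * Real.pi))) o.2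
  s_eq : ∀ o, (H o).s = η * (1 - ‖(o.1 : ℂ)‖)
  exists_pt : ∀ (v : Plane) (s : ℝ), 0 < η * s → η * s ≤ 1 → height d v ∈ Ioo (0 : ℝ) 1 →
    ∃ x : TanglePt r, x.v = v ∧ x.s = s
  off : ∀ x : TanglePt r, x.s = η → ∀ j : ℤ, height d x.v ≠ j
  of_meets : ∀ (ε : ℤˣ) (w : ℤ × ℤ) (x y : TanglePt r), Meets ε w x y → 0 < η * x.s →
    signedShift ε w x.v = y.v ∨ (x.s = η ∧ height d (signedShift ε w x.v) = height d y.v)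
  meets : ∀ (ε : ℤˣ) (w : ℤ × ℤ) (x y : TanglePt r), x.s = η → y.s = η →
    height d (signedShift ε w x.v) = height d y.v → Meets ε w x y

theorem isHandle_topPoint (r : ℚ) {a : ℕ} (ha : 0 < a) :
    IsHandle r dirInfty 1 a (topPoint 1 r a) where
  pos := ha
  isPrimitive := isPrimitive_dirInfty
  sign := one_mul 1
  v_eq _ := rfl
  s_eq _ := (one_mul _).symm
  exists_pt v s h0 h1 hv := by
    rw [one_mul] at h0 h1
    exact ⟨⟨v, s, ⟨by linarith, h1⟩, not_isLattice_of_height isPrimitive_dirInfty hv,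
      fun _ => not_int_of_mem_Ioo hv, fun h => by linarith⟩, rfl, rfl⟩
  off x h := x.off_top h
  of_meets ε w x y h hx := by
    rcases h.2 with h | h | h
    · exact Or.inl h
    · exact Or.inr h
    · rw [h.1] at hx
      norm_num at hx
  meets ε w x y hx hy h := ⟨hx.trans hy.symm, Or.inr (Or.inl ⟨hx, h⟩)⟩

theorem isHandle_botPoint (r : ℚ) {b : ℕ} (hb : 0 < b) :
    IsHandle r (dirSlope r) (-1) b (botPoint 1 r b) where
  pos := hb
  isPrimitive := isPrimitive_dirSlope r
  sign := by norm_num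
  v_eq _ := rfl
  s_eq o := by change ‖(o.1 : ℂ)‖ - 1 = _; ring
  exists_pt v s h0 h1 hv := by
    exact ⟨⟨v, s, ⟨by linarith, by linarith⟩, not_isLattice_of_height (isPrimitive_dirSlope r) hv,
      fun h => by linarith, fun _ => not_int_of_mem_Ioo hv⟩, rfl, rfl⟩
  off x h := x.off_bot h
  of_meets ε w x y h hx := by
    rcases h.2 with h | h | h
    · exact Or.inl h
    · rw [h.1] at hx
      norm_num at hx
    · exact Or.inr h
  meets ε w x y hx hy h := ⟨hx.trans hy.symm, Or.inr (Or.inr ⟨hx, h⟩)⟩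

/-- The inclusion of the handle into `ℂ × ℝ`. -/
def handleVal (o : OpenHandle) : ℂ × ℝ := (o.1, o.2)

theorem isOpenEmbedding_handleVal : IsOpenEmbedding handleVal :=
  Metric.isOpen_ball.isOpenEmbedding_subtypeVal.prodMap isOpen_Ioo.isOpenEmbedding_subtypeVal

theorem norm_lt_one (o : OpenHandle) : ‖(o.1 : ℂ)‖ < 1 := mem_ball_zero_iff.1 o.1.2

namespace IsHandle

variable {r : ℚ} {d : Plane} {η : ℝ} {b : ℕ} {H : OpenHandle → TanglePt r}
  (hH : IsHandle r d η b H)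

include hH

theorem cast_pos : (0 : ℝ) < b := Nat.cast_pos.2 hH.pos

theorem position_eq (o : OpenHandle) : position d (H o).v = b * Complex.arg o.1 / Real.pi := by
  have := Real.pi_pos
  rw [hH.v_eq, position_linePoint hH.isPrimitive.ne_zero]
  field_simp

theorem height_eq (o : OpenHandle) : height d (H o).v = o.2 := by
  rw [hH.v_eq, height_linePoint _ hH.isPrimitive.ne_zero]

theorem one_sub (o : OpenHandle) : 1 - η * (H o).s = ‖(o.1 : ℂ)‖ := by
  rw [hH.s_eq]
  linear_combination (‖(o.1 : ℂ)‖ - 1) * hH.sign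

theorem pos_level (o : OpenHandle) : 0 < η * (H o).s := by
  have h1 := hH.one_sub o
  have h2 := norm_lt_one o
  linarith

theorem handleCoord_apply (o : OpenHandle) :
    handleCoord d η b ((H o).v, (H o).s) = handleVal o := by
  have h0 := hH.cast_pos
  have h1 := Real.pi_pos
  refine Prod.ext ?_ (hH.height_eq o)
  change ((1 - η * (H o).s : ℝ) : ℂ) * (Circle.exp (Real.pi * position d (H o).v / b) : ℂ) = o.1
  rw [hH.one_sub, hH.position_eq]
  have e : Real.pi * (b * Complex.arg o.1 / Real.pi) / b = Complex.arg o.1 := by field_simp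
  rw [e, Circle.coe_exp]
  exact Complex.norm_mul_exp_arg_mul_I _

theorem one_sub_eq_norm {x : TanglePt r} {o : OpenHandle}
    (hE : handleCoord d η b (x.v, x.s) = handleVal o) : 1 - η * x.s = ‖(o.1 : ℂ)‖ := by
  have h1 : ((1 - η * x.s : ℝ) : ℂ) * (Circle.exp (Real.pi * position d x.v / b) : ℂ) = o.1 :=
    congrArg Prod.fst hE
  have h2 : η * x.s ≤ 1 := by
    have := x.mem
    rcases mul_self_eq_one_iff.1 hH.sign with h | h <;> rw [h] <;> linarith [this.1, this.2]
  rw [← h1, norm_mul, Circle.norm_coe, mul_one, Complex.norm_real,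
    Real.norm_of_nonneg (by linarith)]

theorem eq_sign_iff {s : ℝ} : s = η ↔ 1 - η * s = 0 := by
  constructor
  · rintro rfl
    linarith [hH.sign]
  · intro h
    linear_combination (-s) * hH.sign - η * h

/-- The point of the handle with the handle coordinates of `x` represents the same point as `x`:
angles are determined up to multiples of `2 * π`, which correspond to translations in the group. -/
theorem mk_eq {x : TanglePt r} {o : OpenHandle}
    (hE : handleCoord d η b (x.v, x.s) = handleVal o) :
    Quot.mk (Rel 1 r) (H o) = Quot.mk _ x := by
  have h0 := hH.cast_pos
  have h1 := Real.pi_pos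
  have hn := hH.one_sub_eq_norm hE
  have hs : (H o).s = x.s := by
    rw [hH.s_eq, ← hn]
    linear_combination x.s * hH.sign
  have hh : height d x.v = o.2 := congrArg Prod.snd hE
  rw [mk_one_eq_iff]
  by_cases hx : x.s = η
  · refine ⟨1, 0, deckClass_zero, hH.meets _ _ _ _ (hs.trans hx) hx ?_⟩
    rw [signedShift_one_zero, hH.height_eq, hh]
  · have hz : (‖(o.1 : ℂ)‖ : ℂ) ≠ 0 := by
      rw [← hn]
      exact_mod_cast fun h => hx (hH.eq_sign_iff.2 h)
    have hexp : Circle.exp (Real.pi * position d x.v / b) = Circle.exp (Complex.arg o.1) := by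
      refine Circle.ext (mul_left_cancel₀ hz ?_)
      rw [Circle.coe_exp (Complex.arg o.1), Complex.norm_mul_exp_arg_mul_I, ← hn]
      exact congrArg Prod.fst hE
    obtain ⟨m, hm⟩ := Circle.exp_eq_exp.1 hexp
    obtain ⟨i, j, hi, hj, -⟩ := hH.isPrimitive
    refine ⟨1, 2 • ((b * m) • (i, j)), deckClass_two_smul _, hs, Or.inl ?_⟩
    have hl : lattice (2 • ((b * m : ℤ) • (i, j))) = (2 * b * m : ℝ) • d := by
      refine plane_ext ?_ ?_
      · simp [lattice, hi]; ring
      · simp [lattice, hj]; ring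
    refine plane_eq_of_position_height hH.isPrimitive.ne_zero ?_ ?_
    · rw [position_signedShift, hl, position_smul_self hH.isPrimitive.ne_zero, hH.position_eq]
      field_simp at hm ⊢
      simp
      linarith
    · rw [height_signedShift, hl, hH.height_eq, hh]
      simp [height]
      ring

theorem exists_handleVal {x : TanglePt r} (hx : 0 < η * x.s) (hh : height d x.v ∈ Ioo (0 : ℝ) 1) :
    ∃ o, handleCoord d η b (x.v, x.s) = handleVal o := by
  have h2 : η * x.s ≤ 1 := by
    have := x.mem
    rcases mul_self_eq_one_iff.1 hH.sign with h | h <;> rw [h] <;> linarith [this.1, this.2]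
  refine ⟨(⟨(handleCoord d η b (x.v, x.s)).1, ?_⟩, ⟨height d x.v, hh⟩), rfl⟩
  rw [mem_ball_zero_iff]
  change ‖((1 - η * x.s : ℝ) : ℂ) * (Circle.exp (Real.pi * position d x.v / b) : ℂ)‖ < 1
  rw [norm_mul, Circle.norm_coe, mul_one, Complex.norm_real, Real.norm_of_nonneg (by linarith)]
  linarith

/-- The image of an open set of the handle, described by handle coordinates. -/
theorem mk_mem_image_iff {U : Set OpenHandle} {x : TanglePt r} :
    Quot.mk (Rel 1 r) x ∈ (fun o => Quot.mk (Rel 1 r) (H o)) '' U ↔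
      0 < η * x.s ∧ ∃ ε w, deckClass w = 1 ∧
        handleCoord d η b (signedShift ε w x.v, x.s) ∈ handleVal '' U := by
  constructor
  · rintro ⟨o, ho, h⟩
    obtain ⟨ε, w, hw, hm⟩ := mk_one_eq_iff.1 h.symm
    have hs : x.s = (H o).s := hm.1
    have hpos : 0 < η * x.s := hs ▸ hH.pos_level o
    refine ⟨hpos, ε, w, hw, o, ho, ?_⟩
    rw [← hH.handleCoord_apply]
    rcases hH.of_meets _ _ _ _ hm hpos with h1 | ⟨h1, h2⟩
    · rw [h1, hs]
    · refine Prod.ext ?_ h2.symm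
      change ((1 - η * (H o).s : ℝ) : ℂ) * _ = ((1 - η * x.s : ℝ) : ℂ) * _
      rw [← hs, hH.eq_sign_iff.1 h1]
      simp
  · rintro ⟨-, ε, w, hw, o, ho, h⟩
    refine ⟨o, ho, (hH.mk_eq (x := move ε w x) h.symm).trans ?_⟩
    exact (mk_one_eq_iff.2 ⟨ε, w, hw, meets_move ε w x⟩).symm

theorem isOpenMap_mk : IsOpenMap fun o => Quot.mk (Rel 1 r) (H o) := by
  intro U hU
  rw [← isQuotientMap_quot_mk.isOpen_preimage]
  have : Quot.mk (Rel 1 r) ⁻¹' ((fun o => Quot.mk (Rel 1 r) (H o)) '' U) =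
      {x | 0 < η * x.s} ∩ ⋃ ε, ⋃ w ∈ {w | deckClass w = 1},
        (fun x : TanglePt r => handleCoord d η b (signedShift ε w x.v, x.s)) ⁻¹'
          (handleVal '' U) := by
    ext x
    rw [mem_preimage, hH.mk_mem_image_iff]
    simp
  rw [this]
  refine (isOpen_lt continuous_const (continuous_const.mul (continuous_s r))).inter
    (isOpen_iUnion fun ε => isOpen_biUnion fun w _ =>
      (isOpenEmbedding_handleVal.isOpenMap U hU).preimage ?_)
  exact (continuous_handleCoord d η b).comp
    (((continuous_signedShift ε w).comp (continuous_v r)).prodMk (continuous_s r))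

/-- The argument is not continuous, but the handle is the quotient of a closed subset of the product
with the compact interval of angles, by a closed projection. -/
theorem continuous_mk : Continuous fun o => Quot.mk (Rel 1 r) (H o) := by
  have h0 := hH.cast_pos
  have h1 := Real.pi_pos
  let A : Set (Icc (-Real.pi) Real.pi × OpenHandle) :=
    {y | ((‖(y.2.1 : ℂ)‖ : ℝ) : ℂ) * (Circle.exp y.1 : ℂ) = y.2.1}
  have hA : IsClosed A := isClosed_eq (by fun_prop) (by fun_prop)
  let q : A → OpenHandle := fun y => y.1.2
  have hq : IsQuotientMap q := by
    refine IsClosedMap.isQuotientMap ?_ (continuous_snd.comp continuous_subtype_val) ?_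
    · exact (isClosedMap_snd_of_compactSpace).comp hA.isClosedEmbedding_subtypeVal.isClosedMap
    · intro o
      have harg : Complex.arg o.1 ∈ Icc (-Real.pi) Real.pi :=
        ⟨(Complex.neg_pi_lt_arg _).le, Complex.arg_le_pi _⟩
      refine ⟨⟨(⟨_, harg⟩, o), ?_⟩, rfl⟩
      change ((‖(o.1 : ℂ)‖ : ℝ) : ℂ) * (Circle.exp (Complex.arg o.1) : ℂ) = o.1
      rw [Circle.coe_exp]
      exact Complex.norm_mul_exp_arg_mul_I _
  have hpt : ∀ y : A, ∃ x : TanglePt r, x.v = linePoint d (b * y.1.1 / Real.pi) y.1.2.2 ∧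
      x.s = η * (1 - ‖(y.1.2.1 : ℂ)‖) := by
    intro y
    have hn := norm_lt_one y.1.2
    have hη : η * (η * (1 - ‖(y.1.2.1 : ℂ)‖)) = 1 - ‖(y.1.2.1 : ℂ)‖ := by
      rw [← mul_assoc, hH.sign, one_mul]
    refine hH.exists_pt _ _ ?_ ?_ ?_
    · rw [hη]; linarith
    · rw [hη]; linarith [norm_nonneg (y.1.2.1 : ℂ)]
    · rw [height_linePoint _ hH.isPrimitive.ne_zero]
      exact y.1.2.2.2
  choose f hfv hfs using hpt
  have hf : Continuous f := by
    refine continuous_induced_rng.2 (Continuous.prodMk ?_ ?_)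
    · refine Continuous.congr (f := fun y : A => linePoint d (b * y.1.1 / Real.pi) y.1.2.2) ?_
        fun y => (hfv y).symm
      exact (continuous_linePoint d).comp (by fun_prop :
        Continuous fun y : A => ((b * y.1.1 / Real.pi : ℝ), (y.1.2.2 : ℝ)))
    · refine Continuous.congr (f := fun y : A => η * (1 - ‖(y.1.2.1 : ℂ)‖)) (by fun_prop)
        fun y => (hfs y).symm
  rw [hq.continuous_iff]
  refine (continuous_quot_mk.comp hf).congr fun y => ?_
  refine (hH.mk_eq (x := f y) (o := y.1.2) (Prod.ext ?_ ?_)).symm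
  · change ((1 - η * (f y).s : ℝ) : ℂ) * (Circle.exp (Real.pi * position d (f y).v / b) : ℂ) = _
    have e1 : 1 - η * (f y).s = ‖(y.1.2.1 : ℂ)‖ := by
      rw [hfs]
      linear_combination (‖(y.1.2.1 : ℂ)‖ - 1) * hH.sign
    have e2 : Real.pi * position d (f y).v / b = y.1.1 := by
      rw [hfv, position_linePoint hH.isPrimitive.ne_zero]
      field_simp
    rw [e1, e2]
    exact y.2
  · change height d (f y).v = _
    rw [hfv, height_linePoint _ hH.isPrimitive.ne_zero]
    rfl

/-- Every point at the end `s = η` lies in the image of the handle. -/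
theorem exists_mk_eq {x : TanglePt r} (hx : x.s = η) :
    ∃ o, Quot.mk (Rel 1 r) (H o) = Quot.mk _ x := by
  have hoff := hH.off x hx
  set l := height d x.v with hl
  have hlt : (⌊l⌋ : ℝ) < l := lt_of_le_of_ne (Int.floor_le l) (hoff _).symm
  have hlt2 := Int.lt_floor_add_one l
  obtain ⟨ε, k, hk⟩ : ∃ (ε : ℤˣ) (k : ℤ), (ε : ℤ) * l + 2 * k ∈ Ioo (0 : ℝ) 1 := by
    rcases Int.even_or_odd' ⌊l⌋ with ⟨m, hm | hm⟩
    · refine ⟨1, -m, ?_⟩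
      rw [hm] at hlt hlt2
      push_cast at hlt hlt2 ⊢
      constructor <;> linarith
    · refine ⟨-1, m + 1, ?_⟩
      rw [hm] at hlt hlt2
      push_cast at hlt hlt2 ⊢
      constructor <;> linarith
  obtain ⟨u, hu⟩ := hH.isPrimitive.exists_lattice k
  have hmem : height d (move ε (2 • u) x).v ∈ Ioo (0 : ℝ) 1 := by
    change height d (signedShift ε (2 • u) x.v) ∈ _
    have := height_add_smul d (lattice u) 0 2 0
    rw [height_signedShift, lattice_two_smul]
    rw [zero_smul, add_zero, zero_mul, add_zero] at this
    rw [this, hu]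
    exact hk
  obtain ⟨o, ho⟩ := hH.exists_handleVal (x := move ε (2 • u) x) (by
    change 0 < η * x.s
    rw [hx, hH.sign]; exact one_pos) hmem
  exact ⟨o, (hH.mk_eq ho).trans
    (mk_one_eq_iff.2 ⟨ε, 2 • u, deckClass_two_smul u, meets_move _ _ x⟩).symm⟩

end IsHandle

/-- The pairs `(ε, w)` for which `v ↦ ε * v + w` preserves the strip `0 < height d v < 1`. -/
def StripIndex (d : Plane) : Type :=
  {j : ℤˣ × (ℤ × ℤ) // (j.1 = 1 ∧ height d (lattice j.2) = 0) ∨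
    (j.1 = -1 ∧ height d (lattice j.2) = 1)}

/-- The rotation `z ↦ ζ z` or `z ↦ ζ * conj z` of the unit disk. -/
noncomputable def diskMove (ζ : Circle) (ε : ℤˣ) :
    Metric.ball (0 : ℂ) 1 ≃ₜ Metric.ball (0 : ℂ) 1 :=
  ((conjSign ε).trans (rotation ζ)).toHomeomorph.subtype fun z => by simp [Circle.norm_coe]

theorem signed_ne_zero (ε : ℤˣ) : ((ε : ℤ) : ℝ) ≠ 0 := fun h => by
  have := units_sq ε
  rw [h, zero_mul] at this
  exact zero_ne_one this

/-- The map `l ↦ ± l + k` of the unit interval, for suitable `k`. -/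
noncomputable def intervalMove (ε : ℤˣ) (k : ℝ) (h : (ε = 1 ∧ k = 0) ∨ (ε = -1 ∧ k = 1)) :
    Ioo (0 : ℝ) 1 ≃ₜ Ioo (0 : ℝ) 1 :=
  ((Homeomorph.mulLeft₀ ((ε : ℤ) : ℝ) (signed_ne_zero ε)).trans (Homeomorph.addRight k)).subtype
    fun l => by
      rcases h with ⟨rfl, rfl⟩ | ⟨rfl, rfl⟩
      · simp
      · simp only [mem_Ioo, Homeomorph.trans_apply, Homeomorph.coe_mulLeft₀,
          Homeomorph.coe_addRight, Units.val_neg, Units.val_one, Int.cast_neg, Int.cast_one]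
        constructor <;> rintro ⟨h1, h2⟩ <;> constructor <;> linarith

/-- The angle by which `v ↦ ± v + w` turns the handle. -/
noncomputable def handleTurn (d : Plane) (b : ℕ) (w : ℤ × ℤ) : Circle :=
  Circle.exp (Real.pi * position d (lattice w) / b)

/-- The action of `v ↦ ± v + w` on the handle. -/
noncomputable def handleMove (d : Plane) (b : ℕ) (j : StripIndex d) : OpenHandle ≃ₜ OpenHandle :=
  (diskMove (handleTurn d b j.1.2) j.1.1).prodCongr
    (intervalMove j.1.1 (height d (lattice j.1.2)) j.2)

theorem handleVal_handleMove (d : Plane) (b : ℕ) (j : StripIndex d) (o : OpenHandle) :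
    handleVal (handleMove d b j o) = rotPair (handleTurn d b j.1.2) j.1.1 (handleVal o) +
      (0, height d (lattice j.1.2)) := by
  refine Prod.ext ?_ rfl
  change (handleTurn d b j.1.2 : ℂ) * conjSign j.1.1 o.1 = _ + 0
  rw [add_zero]
  rfl

theorem finite_range_circleExp {b : ℕ} (hb : 0 < b) :
    (range fun i : ℤ => Circle.exp (Real.pi * i / b)).Finite := by
  have hb' : (0 : ℝ) < b := Nat.cast_pos.2 hb
  refine ((finite_Ico (0 : ℤ) (2 * b)).image fun i : ℤ => Circle.exp (Real.pi * i / b)).subset ?_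
  rintro _ ⟨i, rfl⟩
  have h2 : (0 : ℤ) < 2 * b := by positivity
  refine ⟨i % (2 * b), ⟨Int.emod_nonneg _ h2.ne', Int.emod_lt_of_pos _ h2⟩, ?_⟩
  refine Circle.exp_eq_exp.2 ⟨-(i / (2 * b)), ?_⟩
  have := Int.emod_add_mul_ediv i (2 * b)
  have h3 : (i : ℝ) = ((i % (2 * b) : ℤ) : ℝ) + 2 * b * ((i / (2 * b) : ℤ) : ℝ) := by
    exact_mod_cast this.symm
  rw [h3]
  field_simp
  push_cast
  ring

theorem finite_range_rotSpace {d : Plane} (hd : IsPrimitive d) {b : ℕ} (hb : 0 < b) :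
    (range fun j : StripIndex d => rotSpace (handleTurn d b j.1.2) j.1.1).Finite := by
  obtain ⟨w1, hw1⟩ := hd.exists_lattice 1
  have hF := finite_range_circleExp hb
  refine ((hF.image fun ζ => rotSpace ζ 1).union
    (hF.image fun ζ => rotSpace (handleTurn d b w1 * ζ) (-1))).subset ?_
  rintro _ ⟨⟨⟨ε, w⟩, ⟨hε, h⟩ | ⟨hε, h⟩⟩, rfl⟩
  · obtain rfl : ε = 1 := hε
    obtain ⟨i, hi⟩ := hd.eq_smul h
    refine Or.inl ⟨_, ⟨i, rfl⟩, ?_⟩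
    dsimp only [handleTurn]
    rw [hi, position_smul_self hd.ne_zero]
  · obtain rfl : ε = -1 := hε
    have h0 : height d (lattice (w - w1)) = 0 := by
      have := height_add_smul d (lattice w) (lattice w1) 1 (-1)
      rw [one_smul, neg_one_smul, ← lattice_neg, ← lattice_add, ← sub_eq_add_neg] at this
      rw [this, h, hw1]
      norm_num
    obtain ⟨i, hi⟩ := hd.eq_smul h0
    refine Or.inr ⟨_, ⟨i, rfl⟩, ?_⟩
    dsimp only [handleTurn]
    rw [← Circle.exp_add]
    congr 2
    have hw : lattice w = signedShift 1 w1 ((i : ℝ) • d) := by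
      rw [← hi, signedShift]
      simp [← lattice_add]
    rw [hw, position_signedShift, position_smul_self hd.ne_zero]
    push_cast
    ring

theorem exists_isolated_of_finite {S : Type*} [MetricSpace S] {F : Set S} (hF : F.Finite) (x : S) :
    ∃ r > 0, ∀ y ∈ F, dist y x < r → y = x := by
  obtain ⟨r, hr, h⟩ := Metric.isOpen_iff.1 (hF.subset (sdiff_subset (t := {x}))).isClosed.isOpen_compl
    x fun h => h.2 rfl
  refine ⟨r, hr, fun y hy hd => ?_⟩
  by_contra hne
  exact h (Metric.mem_ball.2 hd) ⟨hy, hne⟩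

theorem stripIndex_of_mem {d : Plane} (hd : IsPrimitive d) {ε : ℤˣ} {w : ℤ × ℤ} {l l' : ℝ}
    (hl : l ∈ Ioo (0 : ℝ) 1) (hl' : l' ∈ Ioo (0 : ℝ) 1)
    (h : l' = (ε : ℤ) * l + height d (lattice w)) :
    (ε = 1 ∧ height d (lattice w) = 0) ∨ (ε = -1 ∧ height d (lattice w) = 1) := by
  obtain ⟨k, hk⟩ := hd.exists_height w
  rw [hk] at h ⊢
  obtain ⟨h1, h2⟩ := hl
  obtain ⟨h3, h4⟩ := hl'
  rcases Int.units_eq_one_or ε with rfl | rfl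
  · refine Or.inl ⟨rfl, ?_⟩
    push_cast at h
    have a1 : ((-1 : ℤ) : ℝ) < k := by push_cast; linarith
    have a2 : (k : ℝ) < (1 : ℤ) := by push_cast; linarith
    have : k = 0 := by
      have := Int.cast_lt.1 a1
      have := Int.cast_lt.1 a2
      omega
    rw [this, Int.cast_zero]
  · refine Or.inr ⟨rfl, ?_⟩
    push_cast at h
    have a1 : ((0 : ℤ) : ℝ) < k := by push_cast; linarith
    have a2 : (k : ℝ) < (2 : ℤ) := by push_cast; linarith
    have : k = 1 := by
      have := Int.cast_lt.1 a1
      have := Int.cast_lt.1 a2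
      omega
    rw [this, Int.cast_one]

namespace IsHandle

variable {r : ℚ} {d : Plane} {η : ℝ} {b : ℕ} {H : OpenHandle → TanglePt r}
  (hH : IsHandle r d η b H)

include hH in
theorem handleCoord_move (j : StripIndex d) (o : OpenHandle) :
    handleCoord d η b ((move j.1.1 j.1.2 (H o)).v, (move j.1.1 j.1.2 (H o)).s) =
      handleVal (handleMove d b j o) := by
  rw [handleVal_handleMove, ← hH.handleCoord_apply]
  exact handleCoord_signedShift _ _ _ _ _ _ _

include hH in
theorem mk_handleMove (j : StripIndex d) (o : OpenHandle) :
    Quot.mk (Rel 1 r) (H (handleMove d b j o)) =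
      deckAction r (deckClass j.1.2) (Quot.mk _ (H o)) := by
  rw [deckAction_mk j.1.1]
  exact hH.mk_eq (hH.handleCoord_move j o)

include hH in
theorem exists_handleMove {γ : DeckGroup} {o o' : OpenHandle}
    (h : deckAction r γ (Quot.mk _ (H o)) = Quot.mk _ (H o')) :
    ∃ j : StripIndex d, deckClass j.1.2 = γ ∧ handleMove d b j o = o' := by
  obtain ⟨ε, w, hw, hm⟩ := deckAction_mk_eq_iff.1 h
  have hc := hH.of_meets _ _ _ _ hm (hH.pos_level o)
  have hh : height d (signedShift ε w (H o).v) = height d (H o').v :=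
    hc.elim (fun h => by rw [h]) fun h => h.2
  have hidx := stripIndex_of_mem hH.isPrimitive (ε := ε) (w := w) o.2.2 o'.2.2 (by
    rw [height_signedShift, hH.height_eq, hH.height_eq] at hh
    exact hh.symm)
  let j : StripIndex d := ⟨(ε, w), hidx⟩
  refine ⟨j, hw, isOpenEmbedding_handleVal.injective ?_⟩
  refine (hH.handleCoord_move j o).symm.trans (Eq.trans ?_ (hH.handleCoord_apply o'))
  change handleCoord d η b (signedShift ε w (H o).v, (H o).s) = _
  have hs : (H o).s = (H o').s := hm.1
  rcases hc with h1 | ⟨h1, -⟩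
  · rw [h1, hs]
  · refine Prod.ext ?_ hh
    change ((1 - η * (H o).s : ℝ) : ℂ) * _ = ((1 - η * (H o').s : ℝ) : ℂ) * _
    rw [← hs, hH.eq_sign_iff.1 h1]
    simp

/-- The identifications in a handle are realized by rotations. -/
noncomputable def symmetry (n : ℕ) {ι : OpenHandle → (evenHeckoid r n).dom} (hι : IsOpenEmbedding ι)
    (hproj : ∀ o, (evenHeckoid r n).proj (ι o) = Quot.mk _ (H o)) :
    (evenHeckoid r n).PieceSymmetry (deckAction r) ι where
  J := StripIndex d
  φ o := toSpace (handleVal o)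
  act j := handleMove d b j
  linear j := rotSpace (handleTurn d b j.1.2) j.1.1
  shift j := toSpace (0, height d (lattice j.1.2))
  label j := deckClass j.1.2
  isOpenEmbedding_inclusion := hι
  isOpenEmbedding_coord := toSpace.isOpenEmbedding.comp isOpenEmbedding_handleVal
  coord_act j o := by rw [handleVal_handleMove, toSpace_add, rotSpace_toSpace]
  proj_act j o := by rw [hproj, hproj]; exact hH.mk_handleMove j o
  exists_act γ o o' h := by
    rw [hproj, hproj] at h
    exact hH.exists_handleMove h
  exists_label γ := by
    obtain ⟨w, rfl⟩ := deckClass_surjective γ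
    obtain ⟨k, hk⟩ := hH.isPrimitive.exists_height w
    obtain ⟨u, hu⟩ := hH.isPrimitive.exists_lattice (k / 2)
    have hcl : deckClass (w + 2 • -u) = deckClass w := (deckClass_eq_iff.2 ⟨-u, rfl⟩).symm
    have hh : height d (lattice (w + 2 • -u)) = (k % 2 : ℤ) := by
      have e := height_add_smul d (lattice w) (lattice u) 1 (-2)
      have e1 : lattice (w + 2 • -u) = (1 : ℝ) • lattice w + (-2 : ℝ) • lattice u := by
        rw [lattice_add, lattice_two_smul, lattice_neg]
        module
      rw [e1, e, hk, hu]
      have := Int.emod_add_mul_ediv k 2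
      have h3 : (k : ℝ) = ((k % 2 : ℤ) : ℝ) + 2 * ((k / 2 : ℤ) : ℝ) := by exact_mod_cast this.symm
      rw [h3]
      ring
    rcases Int.emod_two_eq_zero_or_one k with h | h
    · exact ⟨⟨(1, w + 2 • -u), Or.inl ⟨rfl, by rw [hh, h, Int.cast_zero]⟩⟩, hcl⟩
    · exact ⟨⟨(-1, w + 2 • -u), Or.inr ⟨rfl, by rw [hh, h, Int.cast_one]⟩⟩, hcl⟩
  finite_linear := finite_range_rotSpace hH.isPrimitive hH.pos
  axis j := rotSpace_axis _ _
  isolated o := by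
    have hF := finite_range_rotSpace hH.isPrimitive hH.pos
    have hfin : (range fun j : StripIndex d => toSpace (handleVal (handleMove d b j o))).Finite := by
      refine ((hF.image fun R => R (toSpace (handleVal o)) + toSpace (0, 0)).union
        (hF.image fun R => R (toSpace (handleVal o)) + toSpace (0, 1))).subset ?_
      rintro _ ⟨j, rfl⟩
      dsimp only
      rw [handleVal_handleMove, toSpace_add, ← rotSpace_toSpace]
      rcases j.2 with ⟨-, h⟩ | ⟨-, h⟩
      · exact Or.inl ⟨_, ⟨j, rfl⟩, by rw [h]⟩
      · exact Or.inr ⟨_, ⟨j, rfl⟩, by rw [h]⟩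
    obtain ⟨r, hr, h⟩ := exists_isolated_of_finite hfin (toSpace (handleVal o))
    refine ⟨r, hr, fun j hj => isOpenEmbedding_handleVal.injective (toSpace.injective ?_)⟩
    exact h _ ⟨j, rfl⟩ hj

end IsHandle

/-! ### Changes of charts between the handles and the middle part -/

/-- A branch of the inverse of the handle coordinates, on a half-plane of values of `z`. -/
noncomputable def handleBranch {d : Plane} (hd : d 0 ^ 2 + d 1 ^ 2 ≠ 0) {η : ℝ} (hη : η * η = 1) {b : ℕ}
    (hb : 0 < b) (α : ℝ) : OpenPartialHomeomorph (ℂ × ℝ) (Plane × ℝ) where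
  toFun x := (linePoint d (b / Real.pi * (α + Complex.arg (x.1 * Circle.exp (-α)))) x.2,
    η * (1 - ‖x.1‖))
  invFun := handleCoord d η b
  source := {x | 0 < (x.1 * Circle.exp (-α)).re}
  target := {y | 0 < 1 - η * y.2 ∧ |Real.pi * position d y.1 / b - α| < Real.pi / 2}
  map_source' x hx := by
    have hb' : (0 : ℝ) < b := Nat.cast_pos.2 hb
    have hpi := Real.pi_pos
    have hx0 : 0 < ‖x.1‖ := by
      rw [norm_pos_iff]
      intro h
      simp [h] at hx
    refine ⟨?_, ?_⟩
    · change 0 < 1 - η * (η * (1 - ‖x.1‖))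
      rw [← mul_assoc, hη]
      linarith
    · change |Real.pi * position d (linePoint d _ _) / b - α| < _
      rw [position_linePoint hd]
      have e : Real.pi * (b / Real.pi * (α + Complex.arg (x.1 * Circle.exp (-α)))) / b - α =
          Complex.arg (x.1 * Circle.exp (-α)) := by
        field_simp
        ring
      rw [e]
      exact Complex.abs_arg_lt_pi_div_two_iff.2 (Or.inl hx)
  map_target' y hy := by
    change 0 < (((1 - η * y.2 : ℝ) : ℂ) * (Circle.exp (Real.pi * position d y.1 / b) : ℂ) *
      (Circle.exp (-α) : ℂ)).re
    rw [mul_assoc, ← Circle.coe_mul, ← Circle.exp_add, ← sub_eq_add_neg, Circle.coe_exp,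
      Complex.re_ofReal_mul, Complex.exp_ofReal_mul_I_re]
    exact mul_pos hy.1 (Real.cos_pos_of_mem_Ioo (abs_lt.1 hy.2))
  left_inv' x hx := by
    have hb' : (0 : ℝ) < b := Nat.cast_pos.2 hb
    have hpi := Real.pi_pos
    refine Prod.ext ?_ (height_linePoint d hd _ _)
    change ((1 - η * (η * (1 - ‖x.1‖)) : ℝ) : ℂ) *
      (Circle.exp (Real.pi * position d (linePoint d _ _) / b) : ℂ) = x.1
    rw [position_linePoint hd, ← mul_assoc, hη]
    have e : Real.pi * (b / Real.pi * (α + Complex.arg (x.1 * Circle.exp (-α)))) / b =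
        α + Complex.arg (x.1 * Circle.exp (-α)) := by
      field_simp
    rw [e, Circle.exp_add, Circle.coe_mul, Circle.coe_exp (Complex.arg _)]
    have h1 := Complex.norm_mul_exp_arg_mul_I (x.1 * Circle.exp (-α))
    rw [norm_mul, Circle.norm_coe, mul_one] at h1
    have h2 : (Circle.exp α : ℂ) * Circle.exp (-α) = 1 := by
      rw [← Circle.coe_mul, ← Circle.exp_add, add_neg_cancel, Circle.exp_zero, Circle.coe_one]
    rw [one_mul, sub_sub_cancel]
    linear_combination (Circle.exp α : ℂ) * h1 + x.1 * h2
  right_inv' y hy := by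
    have hb' : (0 : ℝ) < b := Nat.cast_pos.2 hb
    have hpi := Real.pi_pos
    refine Prod.ext ?_ ?_
    · refine plane_eq_of_position_height hd ?_ ?_
      · change position d (linePoint d _ _) = _
        rw [position_linePoint hd]
        change (b / Real.pi * (α + Complex.arg (((1 - η * y.2 : ℝ) : ℂ) *
          (Circle.exp (Real.pi * position d y.1 / b) : ℂ) * (Circle.exp (-α) : ℂ)))) = _
        have h3 := abs_lt.1 hy.2
        rw [mul_assoc, ← Circle.coe_mul, ← Circle.exp_add, ← sub_eq_add_neg, Circle.coe_exp,
          Complex.exp_mul_I, ← Complex.ofReal_cos, ← Complex.ofReal_sin,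
          Complex.ofReal_cos, Complex.ofReal_sin,
          Complex.arg_mul_cos_add_sin_mul_I hy.1 ⟨by linarith, by linarith⟩]
        field_simp
        ring
      · exact height_linePoint d hd _ _
    · change η * (1 - ‖((1 - η * y.2 : ℝ) : ℂ) *
        (Circle.exp (Real.pi * position d y.1 / b) : ℂ)‖) = y.2
      rw [norm_mul, Circle.norm_coe, mul_one, Complex.norm_real, Real.norm_of_nonneg hy.1.le]
      linear_combination y.2 * hη
  open_source := isOpen_lt continuous_const
    (show Continuous fun x : ℂ × ℝ => (x.1 * (Circle.exp (-α) : ℂ)).re by fun_prop)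
  open_target := by
    have h1 := (continuous_position d).comp (continuous_fst (X := Plane) (Y := ℝ))
    simp only [Function.comp_def] at h1
    have h2 : Continuous fun y : Plane × ℝ => 1 - η * y.2 := by fun_prop
    have h3 : Continuous fun y : Plane × ℝ => |Real.pi * position d y.1 / b - α| :=
      (((h1.const_mul Real.pi).div_const _).sub continuous_const).abs
    exact (isOpen_lt continuous_const h2).inter (isOpen_lt h3 continuous_const)
  continuousOn_toFun := by
    refine ContinuousOn.prodMk ?_ (by fun_prop)
    refine (continuous_linePoint d).comp_continuousOn (f := fun x : ℂ × ℝ =>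
      ((b / Real.pi * (α + Complex.arg (x.1 * Circle.exp (-α))) : ℝ), x.2))
      (ContinuousOn.prodMk ?_ (by fun_prop))
    refine continuousOn_const.mul (continuousOn_const.add ?_)
    intro x hx
    refine ContinuousAt.continuousWithinAt ?_
    exact (Complex.continuousAt_arg (Or.inl hx)).comp (f := fun x : ℂ × ℝ =>
      x.1 * (Circle.exp (-α) : ℂ)) (by fun_prop)
  continuousOn_invFun := (continuous_handleCoord d η b).continuousOn

/-! ### Branches of the handle coordinates -/

/-- The inclusion of the middle part into `ℝ² × ℝ`. -/
def midVal (x : MidPiece) : Plane × ℝ := (x.1, x.2)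

theorem isOpenEmbedding_midVal : IsOpenEmbedding midVal :=
  isOpen_not_isLattice.isOpenEmbedding_subtypeVal.prodMap isOpen_Ioo.isOpenEmbedding_subtypeVal

/-- The inclusion of the middle part into the chart domains. -/
def midIncl (r : ℚ) (n : ℕ) (x : MidPiece) : (evenHeckoid r n).dom := Sum.inl x

theorem continuous_midIncl (r : ℚ) (n : ℕ) : Continuous (midIncl r n) := continuous_inl

theorem continuous_midPoint (r : ℚ) : Continuous (midPoint r) :=
  continuous_induced_rng.2 isOpenEmbedding_midVal.continuous

theorem exists_midPoint_eq {r : ℚ} {x : TanglePt r} (h1 : x.s ≠ 1) (h2 : x.s ≠ -1) :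
    ∃ y, midPoint r y = x :=
  ⟨(⟨x.v, x.off_lattice⟩, ⟨x.s, lt_of_le_of_ne x.mem.1 h2.symm, lt_of_le_of_ne x.mem.2 h1⟩), rfl⟩

theorem isOpenMap_mk_midPoint (r : ℚ) : IsOpenMap fun x => Quot.mk (Rel 1 r) (midPoint r x) := by
  intro U hU
  rw [← isQuotientMap_quot_mk.isOpen_preimage]
  have : Quot.mk (Rel 1 r) ⁻¹' ((fun x => Quot.mk (Rel 1 r) (midPoint r x)) '' U) =
      ⋃ ε, ⋃ w ∈ {w | deckClass w = 1},
        (fun x : TanglePt r => (signedShift ε w x.v, x.s)) ⁻¹' (midVal '' U) := by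
    ext x
    simp only [mem_preimage, mem_image, mem_iUnion, mem_ofPred_eq, exists_prop]
    constructor
    · rintro ⟨y, hy, h⟩
      obtain ⟨ε, w, hw, hs, h⟩ := mk_one_eq_iff.1 h.symm
      refine ⟨ε, w, hw, y, hy, ?_⟩
      have h' : signedShift ε w x.v = (midPoint r y).v := by
        rcases h with h | ⟨h, -⟩ | ⟨h, -⟩
        · exact h
        · exact absurd (hs.symm.trans h) y.2.2.2.ne
        · exact absurd (hs.symm.trans h) y.2.2.1.ne'
      rw [h', hs]
      rfl
    · rintro ⟨ε, w, hw, y, hy, h⟩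
      refine ⟨y, hy, (mk_one_eq_iff.2 ⟨ε, w, hw, ?_⟩).symm⟩
      exact ⟨(congrArg Prod.snd h).symm, Or.inl (congrArg Prod.fst h).symm⟩
  rw [this]
  exact isOpen_iUnion fun ε => isOpen_biUnion fun w _ =>
    (isOpenEmbedding_midVal.isOpenMap U hU).preimage
      (((continuous_signedShift ε w).comp (continuous_v r)).prodMk (continuous_s r))

theorem re_pos_of_ne_zero {z : ℂ} (hz : z ≠ 0) : 0 < (z * Circle.exp (-Complex.arg z)).re := by
  have h := Complex.norm_mul_exp_arg_mul_I z
  rw [← Circle.coe_exp] at h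
  nth_rewrite 1 [← h]
  rw [mul_assoc, ← Circle.coe_mul, ← Circle.exp_add, add_neg_cancel, Circle.exp_zero,
    Circle.coe_one, mul_one, Complex.ofReal_re]
  exact norm_pos_iff.2 hz

namespace IsHandle

variable {r : ℚ} {d : Plane} {η : ℝ} {b : ℕ} {H : OpenHandle → TanglePt r}
  (hH : IsHandle r d η b H)

/-- A branch of the inverse of the handle coordinates, from a half of the handle to the middle part. -/
noncomputable def branch (α : ℝ) : OpenPartialHomeomorph OpenHandle MidPiece :=
  have : Nonempty OpenHandle := ⟨(⟨0, by simp⟩, ⟨1 / 2, by norm_num, by norm_num⟩)⟩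
  have : Nonempty MidPiece := ⟨midChart.symm (Sum.inr (Sum.inl this.some))⟩
  (isOpenEmbedding_handleVal.toOpenPartialHomeomorph handleVal).trans
    ((handleBranch hH.isPrimitive.ne_zero hH.sign hH.pos α).trans
      (isOpenEmbedding_midVal.toOpenPartialHomeomorph midVal).symm)

theorem branch_spec {α : ℝ} {o : OpenHandle} (ho : 0 < ((o.1 : ℂ) * Circle.exp (-α)).re) :
    o ∈ (hH.branch α).source ∧
      handleCoord d η b (((hH.branch α) o).1, ((hH.branch α) o).2) = handleVal o := by
  have : Nonempty OpenHandle := ⟨o⟩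
  have hn := norm_lt_one o
  have hz : 0 < ‖(o.1 : ℂ)‖ := by
    rw [norm_pos_iff]
    intro h
    simp [h] at ho
  let β := handleBranch hH.isPrimitive.ne_zero hH.sign hH.pos α
  have hsrc : handleVal o ∈ β.source := ho
  have hh : height d (β (handleVal o)).1 ∈ Ioo (0 : ℝ) 1 := by
    have : height d (β (handleVal o)).1 = o.2 := height_linePoint d hH.isPrimitive.ne_zero _ _
    rw [this]
    exact o.2.2
  have hs : (β (handleVal o)).2 ∈ Ioo (-1 : ℝ) 1 := by
    change η * (1 - ‖(o.1 : ℂ)‖) ∈ _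
    rcases mul_self_eq_one_iff.1 hH.sign with h | h <;> rw [h] <;> constructor <;> linarith
  let y : MidPiece := (⟨_, not_isLattice_of_height hH.isPrimitive hh⟩, ⟨_, hs⟩)
  have hy : midVal y = β (handleVal o) := rfl
  have : Nonempty MidPiece := ⟨y⟩
  have hval : (isOpenEmbedding_midVal.toOpenPartialHomeomorph midVal).symm (β (handleVal o)) = y := by
    rw [← hy]
    exact (isOpenEmbedding_midVal.toOpenPartialHomeomorph midVal).left_inv trivial
  have hmem : β (handleVal o) ∈ (isOpenEmbedding_midVal.toOpenPartialHomeomorph midVal).target := by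
    rw [← hy]
    exact (isOpenEmbedding_midVal.toOpenPartialHomeomorph midVal).map_source trivial
  have hb : hH.branch α o = y := hval
  refine ⟨⟨trivial, hsrc, hmem⟩, ?_⟩
  rw [hb]
  exact β.left_inv hsrc

theorem branch_source (α : ℝ) :
    (hH.branch α).source = {o | 0 < ((o.1 : ℂ) * Circle.exp (-α)).re} := by
  ext o
  exact ⟨fun h => h.2.1, fun h => (hH.branch_spec h).1⟩

theorem mk_branch {α : ℝ} {o : OpenHandle} (ho : 0 < ((o.1 : ℂ) * Circle.exp (-α)).re) :
    Quot.mk (Rel 1 r) (midPoint r (hH.branch α o)) = Quot.mk _ (H o) :=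
  (hH.mk_eq (x := midPoint r (hH.branch α o)) (hH.branch_spec ho).2).symm

/-- The change of charts from a half of the handle to the middle part. -/
noncomputable def branchTransition (n : ℕ) {ι : OpenHandle → (evenHeckoid r n).dom}
    (hι : IsOpenEmbedding ι) (hproj : ∀ o, (evenHeckoid r n).proj (ι o) = Quot.mk _ (H o)) (α : ℝ) :
    (evenHeckoid r n).Transition :=
  have : Nonempty OpenHandle := ⟨(⟨0, by simp⟩, ⟨1 / 2, by norm_num, by norm_num⟩)⟩
  ⟨(hι.toOpenPartialHomeomorph ι).symm.trans ((hH.branch α).trans midChart), by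
    have hinv : ∀ o, (hι.toOpenPartialHomeomorph ι).symm (ι o) = o := fun o =>
      (hι.toOpenPartialHomeomorph ι).left_inv trivial
    rintro w ⟨hw, hw2, -⟩
    obtain ⟨o, rfl⟩ : ∃ o, ι o = w := ⟨_, (hι.toOpenPartialHomeomorph ι).right_inv hw⟩
    have hw3 : o ∈ (hH.branch α).source := by
      have : (hι.toOpenPartialHomeomorph ι).symm (ι o) ∈ (hH.branch α).source := hw2
      rwa [hinv] at this
    rw [branch_source] at hw3
    change (evenHeckoid r n).proj (Sum.inl (hH.branch α
      ((hι.toOpenPartialHomeomorph ι).symm (ι o)))) = _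
    rw [hinv, hproj]
    exact hH.mk_branch hw3⟩

section Transition

variable (n : ℕ) {ι : OpenHandle → (evenHeckoid r n).dom} (hι : IsOpenEmbedding ι)
  (hproj : ∀ o, (evenHeckoid r n).proj (ι o) = Quot.mk _ (H o))

theorem branchTransition_apply (α : ℝ) (o : OpenHandle) :
    (hH.branchTransition n hι hproj α).1 (ι o) = midIncl r n (hH.branch α o) := by
  have : Nonempty OpenHandle := ⟨o⟩
  change midIncl r n (hH.branch α ((hι.toOpenPartialHomeomorph ι).symm (ι o))) = _
  rw [show (hι.toOpenPartialHomeomorph ι).symm (ι o) = o from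
    (hι.toOpenPartialHomeomorph ι).left_inv trivial]

theorem mem_branchTransition_source {α : ℝ} {o : OpenHandle}
    (ho : 0 < ((o.1 : ℂ) * Circle.exp (-α)).re) :
    ι o ∈ (hH.branchTransition n hι hproj α).1.source := by
  have : Nonempty OpenHandle := ⟨o⟩
  refine ⟨(hι.toOpenPartialHomeomorph ι).map_source trivial, ?_, trivial⟩
  change (hι.toOpenPartialHomeomorph ι).symm (ι o) ∈ (hH.branch α).source
  rw [show (hι.toOpenPartialHomeomorph ι).symm (ι o) = o from
    (hι.toOpenPartialHomeomorph ι).left_inv trivial]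
  exact (hH.branch_spec ho).1

include hH hproj in
theorem ne_zero_of_eq {γ : DeckGroup} {o : OpenHandle} {x : MidPiece}
    (h : deckAction r γ ((evenHeckoid r n).proj (ι o)) = (evenHeckoid r n).proj (Sum.inl x)) :
    (o.1 : ℂ) ≠ 0 := by
  intro hz
  rw [hproj] at h
  obtain ⟨ε, w, -, hs, -⟩ := (deckAction_mk_eq_iff (y := midPoint r x)).1 h
  have h1 := hH.one_sub o
  rw [hz, norm_zero] at h1
  have h2 := hs.symm.trans (hH.eq_sign_iff.2 h1)
  have h3 := x.2.2
  change (x.2 : ℝ) = η at h2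
  rw [h2] at h3
  rcases mul_self_eq_one_iff.1 hH.sign with h | h <;> rw [h] at h3
  · exact lt_irrefl _ h3.2
  · exact lt_irrefl _ h3.1

include hH hι hproj in
theorem exists_lift_mid {γ : DeckGroup} {o : OpenHandle} {x : MidPiece}
    (h : deckAction r γ ((evenHeckoid r n).proj (ι o)) = (evenHeckoid r n).proj (Sum.inl x)) :
    ∃ k : OpenPartialHomeomorph (evenHeckoid r n).dom (evenHeckoid r n).dom,
      ι o ∈ k.source ∧ k (ι o) = Sum.inl x ∧
      ∀ w ∈ k.source, (evenHeckoid r n).proj (k w) = deckAction r γ ((evenHeckoid r n).proj w) := by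
  have ho := re_pos_of_ne_zero (hH.ne_zero_of_eq n hproj h)
  set α := Complex.arg o.1
  obtain ⟨k, h1, h2, h3⟩ := (midSymmetry r n).exists_lift (γ := γ) (o := hH.branch α o) (o' := x) (by
    refine Eq.trans ?_ h
    rw [hproj]
    exact congrArg _ (hH.mk_branch ho))
  have hm := hH.mem_branchTransition_source n hι hproj ho
  have ha := hH.branchTransition_apply n hι hproj α o
  refine ⟨(hH.branchTransition n hι hproj α).1.trans k, ⟨hm, ?_⟩, ?_, fun w hw => ?_⟩
  · change (hH.branchTransition n hι hproj α).1 (ι o) ∈ k.source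
    rw [ha]
    exact h1
  · change k ((hH.branchTransition n hι hproj α).1 (ι o)) = _
    rw [ha]
    exact h2
  · exact (h3 _ hw.2).trans (congrArg _ ((hH.branchTransition n hι hproj α).2 w hw.1))

end Transition

end IsHandle

/-! ### The deck action is good -/

theorem isOpenEmbedding_top (r : ℚ) (n : ℕ) : IsOpenEmbedding
    (fun o => Sum.inr (Sum.inl o) : OpenHandle → (evenHeckoid r n).dom) :=
  IsOpenEmbedding.inr.comp IsOpenEmbedding.inl

theorem isOpenEmbedding_bot (r : ℚ) (n : ℕ) : IsOpenEmbedding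
    (fun o => Sum.inr (Sum.inr o) : OpenHandle → (evenHeckoid r n).dom) :=
  IsOpenEmbedding.inr.comp IsOpenEmbedding.inr

theorem OrbAtlas.exists_lift_symm {X : OrbAtlas} {Γ : Type} [Group Γ]
    {ρ : Γ →* (X.carrier ≃ₜ X.carrier)} {γ : Γ} {u v : X.dom}
    (h : ∃ k : OpenPartialHomeomorph X.dom X.dom, v ∈ k.source ∧ k v = u ∧
      ∀ w ∈ k.source, X.proj (k w) = ρ γ⁻¹ (X.proj w)) :
    ∃ k : OpenPartialHomeomorph X.dom X.dom, u ∈ k.source ∧ k u = v ∧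
      ∀ w ∈ k.source, X.proj (k w) = ρ γ (X.proj w) := by
  obtain ⟨k, h1, rfl, h3⟩ := h
  refine ⟨k.symm, k.map_source h1, k.left_inv h1, fun w hw => ?_⟩
  have := h3 _ (k.map_target hw)
  rw [k.right_inv hw] at this
  rw [this, ← Homeomorph.mul_apply, ← map_mul]
  simp

theorem apply_inv_eq {C : Type} [TopologicalSpace C] {Γ : Type} [Group Γ]
    {ρ : Γ →* (C ≃ₜ C)} {γ : Γ} {x y : C} (h : ρ γ x = y) :
    ρ γ⁻¹ y = x := by
  rw [← h, ← Homeomorph.mul_apply, ← map_mul]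
  simp

/-- The points of the plane which are not in `(½ ℤ)²`. -/
abbrev HalfPunctured : Type := {v : Plane // ¬ IsLattice ((2 : ℝ) • v)}

theorem countable_half_lattice : {v : Plane | IsLattice ((2 : ℝ) • v)}.Countable := by
  refine (countable_range fun w : ℤ × ℤ => (1 / 2 : ℝ) • lattice w).mono ?_
  intro v hv
  obtain ⟨w, hw⟩ := isLattice_iff.1 hv
  exact ⟨w, by dsimp only; rw [← hw, smul_smul]; norm_num⟩

theorem one_lt_rank_plane : 1 < Module.rank ℝ Plane := by
  rw [← Module.finrank_eq_rank, finrank_euclideanSpace_fin]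
  norm_num

theorem isLattice_two_smul {v : Plane} (h : IsLattice v) : IsLattice ((2 : ℝ) • v) := by
  obtain ⟨w, rfl⟩ := isLattice_iff.1 h
  exact isLattice_iff.2 ⟨2 • w, (lattice_two_smul w).symm⟩

/-- The part of the middle piece on which the group acts freely. -/
def freeIncl (x : HalfPunctured × Ioo (-1 : ℝ) 1) : MidPiece :=
  (⟨x.1.1, fun h => x.1.2 (isLattice_two_smul h)⟩, x.2)

theorem continuous_freeIncl : Continuous freeIncl := by
  unfold freeIncl
  fun_prop

theorem denseRange_freeIncl : DenseRange freeIncl := by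
  have h1 : Dense {v : Plane | ¬ IsLattice ((2 : ℝ) • v)} :=
    countable_half_lattice.dense_compl ℝ
  have h2 : IsOpenMap fun x : MidPiece => x.1.1 :=
    isOpen_not_isLattice.isOpenEmbedding_subtypeVal.isOpenMap.comp isOpenMap_fst
  refine (h1.preimage h2).mono ?_
  intro x hx
  exact ⟨(⟨x.1.1, hx⟩, x.2), rfl⟩

theorem preconnectedSpace_halfPunctured : PreconnectedSpace (HalfPunctured × Ioo (-1 : ℝ) 1) := by
  have h1 : PreconnectedSpace HalfPunctured := isPreconnected_iff_preconnectedSpace.1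
    (countable_half_lattice.isPathConnected_compl_of_one_lt_rank
      one_lt_rank_plane).isConnected.isPreconnected
  have h2 : PreconnectedSpace (Ioo (-1 : ℝ) 1) :=
    isPreconnected_iff_preconnectedSpace.1 isPreconnected_Ioo
  infer_instance

theorem denseRange_mk_midPoint (r : ℚ) {n : ℕ} (hn : 0 < n) :
    DenseRange fun x => Quot.mk (Rel 1 r) (midPoint r x) := by
  have hdense : Dense {o : OpenHandle | (o.1 : ℂ) ≠ 0} :=
    (dense_compl_singleton (0 : ℂ)).preimage
      (Metric.isOpen_ball.isOpenEmbedding_subtypeVal.isOpenMap.comp isOpenMap_fst)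
  have key : ∀ {d : Plane} {η : ℝ} {b : ℕ} {H : OpenHandle → TanglePt r}, IsHandle r d η b H →
      ∀ o, Quot.mk (Rel 1 r) (H o) ∈ closure (range fun x => Quot.mk (Rel 1 r) (midPoint r x)) := by
    intro d η b H hH o
    have := mem_closure_image (hH.continuous_mk.continuousAt) (hdense o)
    refine closure_mono ?_ this
    rintro _ ⟨o', ho', rfl⟩
    exact ⟨_, hH.mk_branch (re_pos_of_ne_zero ho')⟩
  rintro ⟨x⟩
  by_cases h1 : x.s = 1
  · have hH := isHandle_topPoint r one_pos
    obtain ⟨o, ho⟩ := hH.exists_mk_eq h1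
    exact ho ▸ key hH o
  by_cases h2 : x.s = -1
  · have hH := isHandle_botPoint r hn
    obtain ⟨o, ho⟩ := hH.exists_mk_eq h2
    exact ho ▸ key hH o
  obtain ⟨y, rfl⟩ := exists_midPoint_eq h1 h2
  exact subset_closure ⟨y, rfl⟩

theorem proj_top_ne_bot (r : ℚ) {n : ℕ} (hn : 0 < n) (γ : DeckGroup) (o o' : OpenHandle) :
    deckAction r γ (Quot.mk _ (topPoint 1 r 1 o)) ≠ Quot.mk _ (botPoint 1 r n o') := fun h => by
  obtain ⟨ε, w, -, hs, -⟩ := deckAction_mk_eq_iff.1 h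
  have h1 := (isHandle_topPoint r one_pos).pos_level o
  have h2 := (isHandle_botPoint r hn).pos_level o'
  rw [← hs] at h2
  linarith

/-- The action of `(ℤ/2)²` on the even Heckoid orbifold. -/
theorem isGoodAction_deckAction (r : ℚ) {n : ℕ} (hn : 0 < n) :
    (evenHeckoid r n).IsGoodAction (deckAction r) where
  t2 := t2Space one_pos r
  secondCountable_dom := inferInstanceAs (SecondCountableTopology
    (MidPiece ⊕ (OpenHandle ⊕ OpenHandle)))
  continuous_proj := (continuous_quot_mk.comp (continuous_midPoint r)).sumElim
    ((isHandle_topPoint r one_pos).continuous_mk.sumElim (isHandle_botPoint r hn).continuous_mk)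
  isOpenMap_proj := (isOpenMap_mk_midPoint r).sumElim
    ((isHandle_topPoint r one_pos).isOpenMap_mk.sumElim (isHandle_botPoint r hn).isOpenMap_mk)
  surjective_proj := by
    rintro ⟨x⟩
    by_cases h1 : x.s = 1
    · obtain ⟨o, ho⟩ := (isHandle_topPoint r one_pos).exists_mk_eq h1
      exact ⟨Sum.inr (Sum.inl o), ho⟩
    by_cases h2 : x.s = -1
    · obtain ⟨o, ho⟩ := (isHandle_botPoint r hn).exists_mk_eq h2
      exact ⟨Sum.inr (Sum.inr o), ho⟩
    obtain ⟨y, rfl⟩ := exists_midPoint_eq h1 h2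
    exact ⟨Sum.inl y, rfl⟩
  exists_lift γ u v h := by
    have hT := isHandle_topPoint r one_pos
    have hB := isHandle_botPoint r hn
    rcases u with u | u | u <;> rcases v with v | v | v
    · exact (midSymmetry r n).exists_lift h
    · exact OrbAtlas.exists_lift_symm (hT.exists_lift_mid n (isOpenEmbedding_top r n)
        (fun _ => rfl) (apply_inv_eq h))
    · exact OrbAtlas.exists_lift_symm (hB.exists_lift_mid n (isOpenEmbedding_bot r n)
        (fun _ => rfl) (apply_inv_eq h))
    · exact hT.exists_lift_mid n (isOpenEmbedding_top r n) (fun _ => rfl) h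
    · exact (hT.symmetry n (isOpenEmbedding_top r n) fun _ => rfl).exists_lift h
    · exact absurd h (proj_top_ne_bot r hn _ _ _)
    · exact hB.exists_lift_mid n (isOpenEmbedding_bot r n) (fun _ => rfl) h
    · exact absurd (apply_inv_eq h) (proj_top_ne_bot r hn _ _ _)
    · exact (hB.symmetry n (isOpenEmbedding_bot r n) fun _ => rfl).exists_lift h
  localModel := by
    rintro (u | u | u)
    · exact (midSymmetry r n).nonempty_localModel u
    · exact ((isHandle_topPoint r one_pos).symmetry n (isOpenEmbedding_top r n)
        fun _ => rfl).nonempty_localModel u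
    · exact ((isHandle_botPoint r hn).symmetry n (isOpenEmbedding_bot r n)
        fun _ => rfl).nonempty_localModel u
  exists_free := by
    have := preconnectedSpace_halfPunctured
    have hc : Continuous fun x => Quot.mk (Rel 1 r) (midPoint r x) :=
      continuous_quot_mk.comp (continuous_midPoint r)
    refine ⟨range fun x => Quot.mk (Rel 1 r) (midPoint r (freeIncl x)),
      isPreconnected_range (hc.comp continuous_freeIncl),
      (denseRange_mk_midPoint r hn).comp denseRange_freeIncl hc, ?_⟩
    rintro _ ⟨x, rfl⟩ γ h
    obtain ⟨ε, w, rfl, hm⟩ := (deckAction_mk_eq_iff (x := midPoint r (freeIncl x))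
      (y := midPoint r (freeIncl x))).1 h
    have h1 : signedShift ε w x.1.1 = x.1.1 := congrArg Subtype.val (midPoint_meets_iff.1 hm).2
    rcases Int.units_eq_one_or ε with rfl | rfl
    · have h2 : lattice w = 0 := by simpa [signedShift] using h1
      have h3 : w = 0 := by
        have e0 := congrArg (fun v : Plane => v 0) h2
        have e1 := congrArg (fun v : Plane => v 1) h2
        simp [lattice] at e0 e1
        exact Prod.ext e0 e1
      rw [h3, deckClass_zero]
    · refine absurd (isLattice_iff.2 ⟨w, ?_⟩) x.1.2
      have : lattice w = x.1.1 + x.1.1 := by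
        nth_rewrite 1 [← h1]
        simp [signedShift]
      rw [this, two_smul]

/-- The covering transformations act on the chart domains. -/
theorem exists_chart_action (r : ℚ) {n : ℕ} (hn : 0 < n) :
    ∃ t : DeckGroup → (evenHeckoid r n).dom ≃ₜ (evenHeckoid r n).dom,
      t 1 = Homeomorph.refl _ ∧
      ∀ γ u, (evenHeckoid r n).proj (t γ u) = deckAction r γ ((evenHeckoid r n).proj u) := by
  have key : ∀ γ, ∃ t : (evenHeckoid r n).dom ≃ₜ (evenHeckoid r n).dom,
      ∀ u, (evenHeckoid r n).proj (t u) = deckAction r γ ((evenHeckoid r n).proj u) := by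
    intro γ
    obtain ⟨f, hf⟩ := (midSymmetry r n).exists_homeomorph γ
    obtain ⟨g, hg⟩ := ((isHandle_topPoint r one_pos).symmetry n (isOpenEmbedding_top r n)
        fun _ => rfl).exists_homeomorph γ
    obtain ⟨h, hh⟩ := ((isHandle_botPoint r hn).symmetry n (isOpenEmbedding_bot r n)
        fun _ => rfl).exists_homeomorph γ
    refine ⟨Homeomorph.sumCongr f (Homeomorph.sumCongr g h), ?_⟩
    rintro (u | u | u)
    · exact hf u
    · exact hg u
    · exact hh u
  choose t ht using key
  classical
  refine ⟨fun γ => if γ = 1 then Homeomorph.refl _ else t γ, if_pos rfl, fun γ u => ?_⟩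
  dsimp only
  split_ifs with h
  · subst h
    rw [map_one]
    rfl
  · exact ht γ u

/-! ### Arrows of the middle part -/

namespace OrbAtlas

variable {X : OrbAtlas} {Γ : Type} [Group Γ] {ρ : Γ →* (X.carrier ≃ₜ X.carrier)}
  {O : Type} [TopologicalSpace O] {ι : O → X.dom}

/-- Near every point, a lift of `γ` which stays in the piece is given by members of the family of
homeomorphisms which agree at this point. -/
theorem PieceSymmetry.eventually_eq_act (F : X.PieceSymmetry ρ ι) {γ : Γ}
    (k : OpenPartialHomeomorph X.dom X.dom) {o o' : O} (ho : ι o ∈ k.source) (ho' : k (ι o) = ι o')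
    (hk : ∀ w ∈ k.source, X.proj (k w) = ρ γ (X.proj w)) :
    ∀ᶠ w in 𝓝 o, ∃ j, F.label j = γ ∧ F.act j o = o' ∧ k (ι w) = ι (F.act j w) := by
  have hι := F.isOpenEmbedding_inclusion
  have hφ := F.isOpenEmbedding_coord.continuous
  obtain ⟨δ, hδ, hiso⟩ := F.isolated o'
  have h1 : ∀ᶠ w in 𝓝 o, ι w ∈ k.source :=
    hι.continuous.continuousAt.eventually (k.open_source.mem_nhds ho)
  have hcont : ContinuousAt (fun w => k (ι w)) o :=
    (k.continuousAt ho).comp hι.continuous.continuousAt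
  have h2 : ∀ᶠ w in 𝓝 o, dist (F.φ w) (F.φ o) < δ / 2 :=
    hφ.continuousAt.eventually (Metric.ball_mem_nhds _ (half_pos hδ))
  have h3 : ∀ᶠ w in 𝓝 o, k (ι w) ∈ ι '' {y | dist (F.φ y) (F.φ o') < δ / 2} := by
    refine hcont.eventually ?_
    change ∀ᶠ y in 𝓝 (k (ι o)), _
    rw [ho']
    exact (hι.isOpenMap _ (Metric.isOpen_ball.preimage hφ)).mem_nhds
      ⟨o', Metric.mem_ball_self (half_pos hδ), rfl⟩
  filter_upwards [h1, h2, h3] with w hw1 hw2 ⟨y, hy, hyw⟩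
  have hw3 := hk _ hw1
  rw [← hyw] at hw3
  obtain ⟨j, hj, rfl⟩ := F.exists_act γ w y hw3.symm
  refine ⟨j, hj, ?_, hyw.symm⟩
  have h4 := hk _ ho
  rw [ho', ← hj, ← F.proj_act] at h4
  obtain ⟨j', -, hj'⟩ := F.exists_act 1 o' (F.act j o) (by rw [map_one]; exact h4)
  refine hj'.symm.trans (hiso j' ?_)
  rw [hj']
  refine (dist_triangle _ (F.φ (F.act j w)) _).trans_lt ?_
  have h5 : dist (F.φ (F.act j o)) (F.φ (F.act j w)) = dist (F.φ w) (F.φ o) := by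
    rw [F.coord_act, F.coord_act, dist_add_right, LinearIsometryEquiv.dist_map, dist_comm]
  have h6 : dist (F.φ (F.act j w)) (F.φ o') < δ / 2 := hy
  rw [h5]
  linarith

/-- A path in the chart domains which starts in an open and closed piece stays in it. -/
theorem exists_path_lift {D : Type} [TopologicalSpace D] {ι : O → D} (hι : IsOpenEmbedding ι)
    (hcl : IsClosed (range ι)) {o : O} {w : D} (γ : Path (ι o) w) :
    ∃ (o' : O) (δ : Path o o'), ι o' = w ∧ ∀ s, γ s = ι (δ s) := by
  have hmem : ∀ s, γ s ∈ range ι := by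
    have hclopen : IsClopen (γ ⁻¹' range ι) :=
      ⟨hcl.preimage γ.continuous, hι.isOpen_range.preimage γ.continuous⟩
    exact fun s => eq_univ_iff_forall.1
      (hclopen.eq_univ ⟨0, by rw [mem_preimage, γ.source]; exact ⟨o, rfl⟩⟩) s
  choose f hf using hmem
  have hc : Continuous f := by
    rw [hι.isInducing.continuous_iff]
    exact γ.continuous.congr fun s => (hf s).symm
  refine ⟨f 1, ⟨⟨f, hc⟩, hι.injective ((hf 0).trans γ.source), rfl⟩, (hf 1).trans γ.target,
    fun s => (hf s).symm⟩

end OrbAtlas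

instance : SimplyConnectedSpace (Ioo (-1 : ℝ) 1) :=
  have := (convex_Ioo (-1 : ℝ) 1).contractibleSpace ⟨0, by norm_num⟩
  inferInstance

instance : SimplyConnectedSpace OpenHandle :=
  have := (convex_Ioo (0 : ℝ) 1).contractibleSpace ⟨1 / 2, by norm_num⟩
  have := (convex_ball (0 : ℂ) 1).contractibleSpace ⟨0, by simp⟩
  inferInstance

section Level

variable (r : ℚ) (n : ℕ)

/-- The functor induced by the inclusion of the punctured Conway sphere at the level `0`. -/
noncomputable def levelHom {v v' : PuncturedPlane} (g : puncturedConway.obj v ⟶ puncturedConway.obj v') :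
    (evenHeckoid r n).obj (midIncl r n (v, levelZero)) ⟶
      (evenHeckoid r n).obj (midIncl r n (v', levelZero)) :=
  (levelInclusion 1 r 1 n).functor.map g

theorem levelHom_id (v : PuncturedPlane) : levelHom r n (𝟙 (puncturedConway.obj v)) = 𝟙 _ :=
  (levelInclusion 1 r 1 n).functor.map_id _

theorem levelHom_comp {v v' v'' : PuncturedPlane}
    (g : puncturedConway.obj v ⟶ puncturedConway.obj v')
    (g' : puncturedConway.obj v' ⟶ puncturedConway.obj v'') :
    levelHom r n (g ≫ g') = levelHom r n g ≫ levelHom r n g' :=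
  (levelInclusion 1 r 1 n).functor.map_comp _ _

/-- The vertical path from the level `0`. -/
noncomputable def verticalPath (x : MidPiece) : Path ((x.1, levelZero) : MidPiece) x :=
  (Path.refl x.1).prod (PathConnectedSpace.somePath levelZero x.2)

/-- The class of the vertical path from the level `0`. -/
noncomputable def vertical (x : MidPiece) : (evenHeckoid r n).obj (midIncl r n (x.1, levelZero)) ⟶
    (evenHeckoid r n).obj (midIncl r n x) :=
  (evenHeckoid r n).pathHom ((verticalPath x).map (continuous_midIncl r n))

theorem vertical_levelZero (v : PuncturedPlane) : vertical r n (v, levelZero) = 𝟙 _ := by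
  rw [← OrbAtlas.pathHom_refl]
  refine OrbAtlas.pathHom_homotopic
    (Path.Homotopic.map (q := Path.refl (v, levelZero)) ?_ ⟨_, continuous_midIncl r n⟩)
  obtain ⟨h⟩ := SimplyConnectedSpace.paths_homotopic
    (PathConnectedSpace.somePath levelZero levelZero) (Path.refl levelZero)
  exact ⟨Path.Homotopic.prodHomotopy (Path.Homotopy.refl _) h⟩

/-- The arrow `f` between points of the middle part is, up to vertical paths, the image of an arrow
of the punctured Conway sphere. -/
def IsLevel {x y : MidPiece} (f : (evenHeckoid r n).obj (midIncl r n x) ⟶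
    (evenHeckoid r n).obj (midIncl r n y)) : Prop :=
  ∃ g : puncturedConway.obj x.1 ⟶ puncturedConway.obj y.1,
    vertical r n x ≫ f = levelHom r n g ≫ vertical r n y

variable {r n}

theorem isLevel_id (x : MidPiece) : IsLevel r n (𝟙 ((evenHeckoid r n).obj (midIncl r n x))) :=
  ⟨𝟙 _, by rw [levelHom_id, Category.comp_id, Category.id_comp]⟩

theorem IsLevel.comp {x y z : MidPiece} {f : (evenHeckoid r n).obj (midIncl r n x) ⟶
    (evenHeckoid r n).obj (midIncl r n y)} {f' : (evenHeckoid r n).obj (midIncl r n y) ⟶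
    (evenHeckoid r n).obj (midIncl r n z)} (h : IsLevel r n f) (h' : IsLevel r n f') :
    IsLevel r n (f ≫ f') := by
  obtain ⟨g, hg⟩ := h
  obtain ⟨g', hg'⟩ := h'
  exact ⟨g ≫ g', by rw [levelHom_comp, Category.assoc, ← hg', ← Category.assoc, hg, Category.assoc]⟩

theorem IsLevel.inv {x y : MidPiece} {f : (evenHeckoid r n).obj (midIncl r n x) ⟶
    (evenHeckoid r n).obj (midIncl r n y)} (h : IsLevel r n f) : IsLevel r n (Groupoid.inv f) := by
  obtain ⟨g, hg⟩ := h
  refine ⟨Groupoid.inv g, ?_⟩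
  have h1 : levelHom r n (Groupoid.inv g) ≫ levelHom r n g = 𝟙 _ := by
    rw [← levelHom_comp, Groupoid.inv_comp, levelHom_id]
  rw [← cancel_mono f, Category.assoc, Category.assoc, Groupoid.inv_comp, hg, ← Category.assoc, h1,
    Category.comp_id, Category.id_comp]

theorem isLevel_pathHom {x y : MidPiece} (γ : Path x y) :
    IsLevel r n ((evenHeckoid r n).pathHom (γ.map (continuous_midIncl r n))) := by
  obtain ⟨v, t⟩ := x
  obtain ⟨v', t'⟩ := y
  refine ⟨puncturedConway.pathHom (γ.map continuous_fst), ?_⟩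
  have h1 : levelHom r n (puncturedConway.pathHom (γ.map continuous_fst)) =
      (evenHeckoid r n).pathHom (((γ.map continuous_fst).prod (Path.refl levelZero)).map
        (continuous_midIncl r n)) :=
    OrbAtlas.Hom.functor_map_pathHom _ _
  refine Eq.trans ?_ (congrArg (· ≫ vertical r n (v', t')) h1.symm)
  refine (OrbAtlas.pathHom_trans _ _).trans (Eq.trans ?_ (OrbAtlas.pathHom_trans _ _).symm)
  rw [← Path.map_trans, ← Path.map_trans]
  refine OrbAtlas.pathHom_homotopic (Path.Homotopic.map ?_ ⟨_, continuous_midIncl r n⟩)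
  have h2 : γ = (γ.map continuous_fst).prod (γ.map continuous_snd) := by ext s <;> rfl
  have h3 : (verticalPath (v, t)).trans γ = ((Path.refl v).trans (γ.map continuous_fst)).prod
      ((PathConnectedSpace.somePath levelZero t).trans (γ.map continuous_snd)) := by
    nth_rewrite 1 [h2]
    exact Path.trans_prod_eq_prod_trans _ _ _ _
  have h4 : ((γ.map continuous_fst).prod (Path.refl levelZero)).trans (verticalPath (v', t')) =
      ((γ.map continuous_fst).trans (Path.refl v')).prod
        ((Path.refl levelZero).trans (PathConnectedSpace.somePath levelZero t')) :=
    Path.trans_prod_eq_prod_trans _ _ _ _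
  rw [h3, h4]
  obtain ⟨h⟩ := SimplyConnectedSpace.paths_homotopic
    ((PathConnectedSpace.somePath levelZero t).trans (γ.map continuous_snd))
    ((Path.refl levelZero).trans (PathConnectedSpace.somePath levelZero t'))
  exact ⟨Path.Homotopic.prodHomotopy
    ((Path.Homotopy.reflTrans _).trans (Path.Homotopy.transRefl _).symm) h⟩

/-- The maps `v ↦ ± v + w`, with `w` in `2 ℤ²`, act freely. -/
theorem eq_of_planeMove_eq {ε ε' : ℤˣ} {w w' : ℤ × ℤ} (hw : deckClass w = 1)
    (hw' : deckClass w' = 1) {v : PuncturedPlane} (h : planeMove ε w v = planeMove ε' w' v) :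
    ε = ε' ∧ w = w' := by
  obtain ⟨u, rfl⟩ := deckClass_eq_iff.1 (deckClass_zero.trans hw.symm)
  obtain ⟨u', rfl⟩ := deckClass_eq_iff.1 (deckClass_zero.trans hw'.symm)
  have h0 : signedShift ε (0 + 2 • u) v.1 = signedShift ε' (0 + 2 • u') v.1 := congrArg Subtype.val h
  have e0 := congrArg (fun v : Plane => v 0) h0
  have e1 := congrArg (fun v : Plane => v 1) h0
  simp [signedShift, lattice] at e0 e1
  have hcast : ∀ a b : ℤ, (2 * a : ℝ) = 2 * b → a = b := fun a b h => by
    have : (a : ℝ) = b := by linarith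
    exact_mod_cast this
  have hoff : ∀ a b : ℤ, v.1 0 = a → v.1 1 = b → False := fun a b h h' => v.2 ⟨a, b, h, h'⟩
  rcases Int.units_eq_one_or ε with rfl | rfl <;> rcases Int.units_eq_one_or ε' with rfl | rfl
  · simp at e0 e1
    exact ⟨rfl, by rw [Prod.ext e0 e1]⟩
  · refine (hoff (u'.1 - u.1) (u'.2 - u.2) ?_ ?_).elim
    · push_cast at e0 ⊢; linarith
    · push_cast at e1 ⊢; linarith
  · refine (hoff (u.1 - u'.1) (u.2 - u'.2) ?_ ?_).elim
    · push_cast at e0 ⊢; linarith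
    · push_cast at e1 ⊢; linarith
  · simp at e0 e1
    exact ⟨rfl, by rw [Prod.ext e0 e1]⟩

/-- The change of charts `v ↦ ± v + w`, with `w` in `2 ℤ²`, of the punctured Conway sphere. -/
noncomputable def moveTransition (ε : ℤˣ) (w : ℤ × ℤ) (hw : deckClass w = 1) :
    puncturedConway.Transition :=
  ⟨(planeMove ε w).toOpenPartialHomeomorph, fun v _ => by
    obtain ⟨u, rfl⟩ := deckClass_eq_iff.1 (deckClass_zero.trans hw.symm)
    obtain ⟨g, hg, h⟩ := exists_mem_halfTurnGroup 1 ε u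
    refine (Quot.sound ⟨g, hg, ?_⟩).symm
    rw [h, mul_one, ← lattice_two_smul]
    change _ = signedShift ε (0 + 2 • u) v.1
    rw [zero_add]
    rfl⟩

theorem isLevel_jumpHom {x y : MidPiece} (h : (evenHeckoid r n).Transition)
    (hx : midIncl r n x ∈ h.1.source) (hy : h.1 (midIncl r n x) = midIncl r n y) :
    IsLevel r n ((evenHeckoid r n).jumpHom h hx hy) := by
  have hev := (midSymmetry r n).eventually_eq_act (γ := 1) h.1 (o := x) (o' := y) hx hy
    (fun w hw => (h.2 w hw).trans
      (congrArg (fun f : (evenHeckoid r n).carrier ≃ₜ (evenHeckoid r n).carrier =>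
        f ((evenHeckoid r n).proj w)) (map_one (deckAction r)).symm))
  obtain ⟨⟨ε, w⟩, hw, rfl, -⟩ := hev.self_of_nhds
  have hw' : deckClass w = 1 := hw
  let K := (levelInclusion 1 r 1 n).onJump (moveTransition ε w hw')
  have hK : ∀ z, midIncl r n z ∈ K.1.source := fun z =>
    (mem_thicken_source _ _).2 ⟨z, rfl, trivial⟩
  have hKz : ∀ z, K.1 (midIncl r n z) = midIncl r n (planeMove ε w z.1, z.2) := fun z => rfl
  have hgerm : h.1 =ᶠ[𝓝 (midIncl r n x)] K.1 := by
    have hemb : IsOpenEmbedding (midIncl r n) := IsOpenEmbedding.inl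
    rw [← hemb.map_nhds_eq x]
    refine Filter.eventually_map.2 ?_
    filter_upwards [hev] with z ⟨j, hj, hjx, hz⟩
    have hj' : deckClass j.2 = 1 := hj
    obtain ⟨h1, h2⟩ := eq_of_planeMove_eq hj' hw' (congrArg Prod.fst hjx)
    refine hz.trans ?_
    change midIncl r n (planeMove j.1 j.2 z.1, z.2) = midIncl r n (planeMove ε w z.1, z.2)
    rw [h1, h2]
  refine ⟨puncturedConway.jumpHom (moveTransition ε w hw') trivial rfl, ?_⟩
  rw [OrbAtlas.jumpHom_germ h K hx hy (hK x) rfl hgerm]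
  exact OrbAtlas.jumpHom_slide K (hK _) (hK _) rfl rfl _ _ (fun s => hK _) fun s => rfl

end Level

/-! ### Arrows of the handles -/

/-- A base point of the handle, away from its core. -/
noncomputable def handleBase : OpenHandle :=
  (⟨1 / 2, by rw [mem_ball_zero_iff]; norm_num⟩, ⟨1 / 2, by norm_num, by norm_num⟩)

theorem handleBase_re : 0 < ((handleBase.1 : ℂ) * Circle.exp (-0)).re := by
  simp [handleBase]

theorem isPathConnected_half (α : ℝ) (h : {o : OpenHandle | 0 < ((o.1 : ℂ) *
    Circle.exp (-α)).re}.Nonempty) :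
    IsPathConnected {o : OpenHandle | 0 < ((o.1 : ℂ) * Circle.exp (-α)).re} := by
  rw [isOpenEmbedding_handleVal.isInducing.isPathConnected_iff]
  refine Convex.isPathConnected ?_ (h.image _)
  have : handleVal '' {o : OpenHandle | 0 < ((o.1 : ℂ) * Circle.exp (-α)).re} =
      (Metric.ball (0 : ℂ) 1 ∩ {z | 0 < (z * Circle.exp (-α)).re}) ×ˢ Ioo (0 : ℝ) 1 := by
    ext x
    constructor
    · rintro ⟨o, ho, rfl⟩
      exact ⟨⟨o.1.2, ho⟩, o.2.2⟩
    · rintro ⟨⟨h1, h2⟩, h3⟩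
      exact ⟨(⟨x.1, h1⟩, ⟨x.2, h3⟩), h2, rfl⟩
  rw [this]
  refine ((convex_ball _ _).inter ?_).prod (convex_Ioo _ _)
  exact convex_halfSpace_gt (f := fun z : ℂ => (z * Circle.exp (-α)).re)
    ⟨fun a b => by simp [add_mul], fun c a => by simp [mul_assoc]⟩ 0

namespace IsHandle

variable {r : ℚ} {d : Plane} {η : ℝ} {b : ℕ} {H : OpenHandle → TanglePt r}
  (hH : IsHandle r d η b H) (n : ℕ) {ι : OpenHandle → (evenHeckoid r n).dom}
  (hι : IsOpenEmbedding ι) (hproj : ∀ o, (evenHeckoid r n).proj (ι o) = Quot.mk _ (H o))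

/-- The jump from the handle to the middle part along a branch. -/
noncomputable def branchHom (α : ℝ) (o : OpenHandle) (ho : 0 < ((o.1 : ℂ) * Circle.exp (-α)).re) :
    (evenHeckoid r n).obj (ι o) ⟶ (evenHeckoid r n).obj (midIncl r n (hH.branch α o)) :=
  (evenHeckoid r n).jumpHom (hH.branchTransition n hι hproj α)
    (hH.mem_branchTransition_source n hι hproj ho) (hH.branchTransition_apply n hι hproj α o)

/-- The class of an arrow from a fixed point of the middle part to a point of the handle. -/
noncomputable def anchorHom (o : OpenHandle) :
    (evenHeckoid r n).obj (midIncl r n (hH.branch 0 handleBase)) ⟶ (evenHeckoid r n).obj (ι o) :=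
  Groupoid.inv (hH.branchHom n hι hproj 0 handleBase handleBase_re) ≫
    (evenHeckoid r n).pathHom ((PathConnectedSpace.somePath handleBase o).map hι.continuous)

theorem anchorHom_comp_pathHom {o o' : OpenHandle} (γ : Path o o') :
    hH.anchorHom n hι hproj o ≫ (evenHeckoid r n).pathHom (γ.map hι.continuous) =
      hH.anchorHom n hι hproj o' := by
  unfold anchorHom
  rw [Category.assoc, OrbAtlas.pathHom_trans, ← Path.map_trans]
  congr 1
  exact OrbAtlas.pathHom_homotopic
    (Path.Homotopic.map (SimplyConnectedSpace.paths_homotopic _ _) ⟨_, hι.continuous⟩)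

theorem anchorHom_comp_branchHom :
    hH.anchorHom n hι hproj handleBase ≫
      hH.branchHom n hι hproj 0 handleBase handleBase_re = 𝟙 _ := by
  have h1 : (evenHeckoid r n).pathHom
      ((PathConnectedSpace.somePath handleBase handleBase).map hι.continuous) = 𝟙 _ := by
    rw [← OrbAtlas.pathHom_refl]
    exact OrbAtlas.pathHom_homotopic (Path.Homotopic.map (q := Path.refl handleBase)
      (SimplyConnectedSpace.paths_homotopic _ _) ⟨_, hι.continuous⟩)
  unfold anchorHom
  rw [h1, Category.comp_id, Groupoid.inv_comp]

/-- Two jumps from a point of the handle to the middle part differ by a jump in the middle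
part. -/
theorem isLevel_jumpHom_of_branchHom {α : ℝ} {o : OpenHandle}
    (ho : 0 < ((o.1 : ℂ) * Circle.exp (-α)).re)
    (hα : IsLevel r n (hH.anchorHom n hι hproj o ≫ hH.branchHom n hι hproj α o ho))
    (h : (evenHeckoid r n).Transition) {x : MidPiece} (hu : ι o ∈ h.1.source)
    (hx : h.1 (ι o) = midIncl r n x) :
    IsLevel r n (hH.anchorHom n hι hproj o ≫ (evenHeckoid r n).jumpHom h hu hx) := by
  set k := hH.branchTransition n hι hproj α with hk
  have hm := hH.mem_branchTransition_source n hι hproj ho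
  have ha := hH.branchTransition_apply n hι hproj α o
  have e1 : midIncl r n (hH.branch α o) ∈ k.symm.1.source := ha ▸ k.1.map_source hm
  have e2 : k.symm.1 (midIncl r n (hH.branch α o)) = ι o := ha ▸ k.1.left_inv hm
  have e3 : midIncl r n (hH.branch α o) ∈ (k.symm.comp h).1.source :=
    ⟨e1, by change k.symm.1 _ ∈ h.1.source; rw [e2]; exact hu⟩
  have e4 : (k.symm.comp h).1 (midIncl r n (hH.branch α o)) = midIncl r n x := by
    change h.1 (k.symm.1 _) = _
    rw [e2, hx]
  have key : (evenHeckoid r n).jumpHom h hu hx = hH.branchHom n hι hproj α o ho ≫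
      (evenHeckoid r n).jumpHom (k.symm.comp h) e3 e4 := by
    rw [← OrbAtlas.jumpHom_comp k.symm h e1 e2 hu hx e3 e4, ← Category.assoc]
    have : hH.branchHom n hι hproj α o ho ≫ (evenHeckoid r n).jumpHom k.symm e1 e2 = 𝟙 _ :=
      OrbAtlas.jumpHom_comp_symm k hm ha e1 e2
    rw [this, Category.id_comp]
  rw [key, ← Category.assoc]
  exact hα.comp (isLevel_jumpHom _ _ _)

/-- A branch jump may be moved inside the half of the handle on which the branch is defined. -/
theorem isLevel_branchHom_of_exists {α : ℝ} {o o' : OpenHandle}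
    (ho : 0 < ((o.1 : ℂ) * Circle.exp (-α)).re) (ho' : 0 < ((o'.1 : ℂ) * Circle.exp (-α)).re)
    (hα : IsLevel r n (hH.anchorHom n hι hproj o ≫ hH.branchHom n hι hproj α o ho)) :
    IsLevel r n (hH.anchorHom n hι hproj o' ≫ hH.branchHom n hι hproj α o' ho') := by
  have hj := (isPathConnected_half α ⟨o, ho⟩).joinedIn o ho o' ho'
  let γ := hj.somePath
  have hγ : ∀ s, γ s ∈ (hH.branch α).source := fun s => by
    rw [branch_source]
    exact hj.somePath_mem s
  let δ : Path (hH.branch α o) (hH.branch α o') :=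
    ⟨⟨fun s => hH.branch α (γ s), (hH.branch α).continuousOn.comp_continuous γ.continuous hγ⟩,
      by simp, by simp⟩
  have hs := OrbAtlas.jumpHom_slide (hH.branchTransition n hι hproj α)
    (hH.mem_branchTransition_source n hι hproj ho) (hH.mem_branchTransition_source n hι hproj ho')
    (hH.branchTransition_apply n hι hproj α o) (hH.branchTransition_apply n hι hproj α o')
    (γ.map hι.continuous) (δ.map (continuous_midIncl r n))
    (fun s => hH.mem_branchTransition_source n hι hproj (hj.somePath_mem s))
    (fun s => (hH.branchTransition_apply n hι hproj α (γ s)).symm)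
  rw [← hH.anchorHom_comp_pathHom n hι hproj γ, Category.assoc]
  refine Eq.subst (motive := fun f => IsLevel r n (hH.anchorHom n hι hproj o ≫ f)) hs.symm ?_
  change IsLevel r n (_ ≫ hH.branchHom n hι hproj α o ho ≫ _)
  rw [← Category.assoc]
  exact hα.comp (isLevel_pathHom δ)

theorem isLevel_branchHom_step {α α' : ℝ} (hd : |α - α'| < Real.pi)
    (hα : ∀ o ho, IsLevel r n (hH.anchorHom n hι hproj o ≫ hH.branchHom n hι hproj α o ho))
    (o : OpenHandle) (ho : 0 < ((o.1 : ℂ) * Circle.exp (-α')).re) :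
    IsLevel r n (hH.anchorHom n hι hproj o ≫ hH.branchHom n hι hproj α' o ho) := by
  obtain ⟨h1, h2⟩ := abs_lt.1 hd
  -- The point at the angle halfway between `α` and `α'` belongs to both half-planes.
  let o0 : OpenHandle := (⟨((1 / 2 : ℝ) : ℂ) * Circle.exp ((α + α') / 2), by
    rw [mem_ball_zero_iff, norm_mul, Circle.norm_coe, Complex.norm_real]
    norm_num⟩, ⟨1 / 2, by norm_num, by norm_num⟩)
  have hre : ∀ β : ℝ, |(α + α') / 2 - β| < Real.pi / 2 →
      0 < ((o0.1 : ℂ) * Circle.exp (-β)).re := by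
    intro β hβ
    change 0 < (((1 / 2 : ℝ) : ℂ) * (Circle.exp ((α + α') / 2) : ℂ) * (Circle.exp (-β) : ℂ)).re
    rw [mul_assoc, ← Circle.coe_mul, ← Circle.exp_add, ← sub_eq_add_neg, Circle.coe_exp,
      Complex.re_ofReal_mul, Complex.exp_ofReal_mul_I_re]
    exact mul_pos (by norm_num) (Real.cos_pos_of_mem_Ioo (abs_lt.1 hβ))
  have r1 := hre α (abs_lt.2 ⟨by linarith, by linarith⟩)
  have r2 := hre α' (abs_lt.2 ⟨by linarith, by linarith⟩)
  exact hH.isLevel_branchHom_of_exists n hι hproj r2 ho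
    (hH.isLevel_jumpHom_of_branchHom n hι hproj r1 (hα o0 r1) _ _ _)

theorem isLevel_branchHom {α : ℝ} (hα : α ∈ Ioc (-Real.pi) Real.pi) (o : OpenHandle)
    (ho : 0 < ((o.1 : ℂ) * Circle.exp (-α)).re) :
    IsLevel r n (hH.anchorHom n hι hproj o ≫ hH.branchHom n hι hproj α o ho) := by
  have hpi := Real.pi_pos
  have h0 : ∀ o ho, IsLevel r n (hH.anchorHom n hι hproj o ≫ hH.branchHom n hι hproj 0 o ho) :=
    fun o ho => hH.isLevel_branchHom_of_exists n hι hproj handleBase_re ho (by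
      rw [anchorHom_comp_branchHom]
      exact isLevel_id _)
  have h1 := hH.isLevel_branchHom_step n hι hproj (α := 0) (α' := α / 2)
    (abs_lt.2 ⟨by linarith [hα.2], by linarith [hα.1]⟩) h0
  exact hH.isLevel_branchHom_step n hι hproj
    (abs_lt.2 ⟨by linarith [hα.2], by linarith [hα.1]⟩) h1 o ho

/-- Jumps from the handle to the middle part come from the punctured Conway sphere. -/
theorem isLevel_anchorHom_comp_jumpHom (h : (evenHeckoid r n).Transition) {o : OpenHandle}
    {x : MidPiece} (hu : ι o ∈ h.1.source) (hx : h.1 (ι o) = midIncl r n x) :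
    IsLevel r n (hH.anchorHom n hι hproj o ≫ (evenHeckoid r n).jumpHom h hu hx) := by
  have hne : (o.1 : ℂ) ≠ 0 := by
    refine hH.ne_zero_of_eq n hproj (γ := 1) (x := x) ?_
    refine (congrArg (fun f : (evenHeckoid r n).carrier ≃ₜ (evenHeckoid r n).carrier =>
      f ((evenHeckoid r n).proj (ι o))) (map_one (deckAction r))).trans ?_
    change (evenHeckoid r n).proj (ι o) = (evenHeckoid r n).proj (midIncl r n x)
    rw [← hx]
    exact (h.2 _ hu).symm
  exact hH.isLevel_jumpHom_of_branchHom n hι hproj (re_pos_of_ne_zero hne)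
    (hH.isLevel_branchHom n hι hproj (Complex.arg_mem_Ioc _) o _) h hu hx

/-- Every point of an open subset of the handle can be joined in this set to a point off the
core. -/
theorem exists_joinedIn_ne_zero {U : Set OpenHandle} (hU : IsOpen U) {o : OpenHandle} (ho : o ∈ U) :
    ∃ o', (o'.1 : ℂ) ≠ 0 ∧ JoinedIn U o o' := by
  have : LocallyPathConnectedSpace OpenHandle :=
    isOpenEmbedding_handleVal.locallyPathConnectedSpace
  have hdense : Dense {o : OpenHandle | (o.1 : ℂ) ≠ 0} :=
    (dense_compl_singleton (0 : ℂ)).preimage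
      (Metric.isOpen_ball.isOpenEmbedding_subtypeVal.isOpenMap.comp isOpenMap_fst)
  obtain ⟨V, ⟨hV, hpc⟩, hVU⟩ :=
    (LocallyPathConnectedSpace.path_connected_basis o).mem_iff.1 (hU.mem_nhds ho)
  obtain ⟨o', ho', hne⟩ := hdense.inter_open_nonempty _ isOpen_interior
    ⟨o, mem_interior_iff_mem_nhds.2 hV⟩
  exact ⟨o', hne, (hpc.joinedIn o (mem_of_mem_nhds hV) o' (interior_subset ho')).mono hVU⟩

/-- Jumps inside the handle come from the punctured Conway sphere. -/
theorem isLevel_anchorHom_comp_jumpHom_inv (hcl : IsClosed (range ι))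
    (h : (evenHeckoid r n).Transition) {o o' : OpenHandle} (hu : ι o ∈ h.1.source)
    (hx : h.1 (ι o) = ι o') :
    IsLevel r n (hH.anchorHom n hι hproj o ≫ (evenHeckoid r n).jumpHom h hu hx ≫
      Groupoid.inv (hH.anchorHom n hι hproj o')) := by
  -- The jump is moved to a point off the core, where it can be compared with branch jumps.
  obtain ⟨p, hp, hj⟩ := exists_joinedIn_ne_zero (h.1.open_source.preimage hι.continuous) hu
  let γ := hj.somePath
  have hγ : ∀ s, ι (γ s) ∈ h.1.source := hj.somePath_mem
  have hps : ι p ∈ h.1.source := by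
    have := hγ 1
    rwa [γ.target] at this
  let δ0 : Path (ι o') (h.1 (ι p)) :=
    ⟨⟨fun s => h.1 (ι (γ s)), h.1.continuousOn.comp_continuous
      (hι.continuous.comp γ.continuous) hγ⟩, by simp [hx], by simp⟩
  obtain ⟨p', δ, hp', hδ⟩ := OrbAtlas.exists_path_lift hι hcl δ0
  have hs := OrbAtlas.jumpHom_slide h hu hps hx hp'.symm (γ.map hι.continuous)
    (δ.map hι.continuous) hγ (fun s => (hδ s).symm)
  have hre := re_pos_of_ne_zero hp
  have hb := hH.mk_branch hre
  have hpp : deckAction r 1 ((evenHeckoid r n).proj (ι p')) =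
      (evenHeckoid r n).proj (Sum.inl (hH.branch (Complex.arg p.1) p)) := by
    refine (congrArg (fun f : (evenHeckoid r n).carrier ≃ₜ (evenHeckoid r n).carrier =>
      f ((evenHeckoid r n).proj (ι p'))) (map_one (deckAction r))).trans ?_
    refine Eq.trans ?_ hb.symm
    rw [← hproj, hp']
    exact h.2 _ hps
  have hre' := re_pos_of_ne_zero (hH.ne_zero_of_eq n hproj hpp)
  set α' := Complex.arg p'.1
  have hm := hH.mem_branchTransition_source n hι hproj hre'
  have ha := hH.branchTransition_apply n hι hproj α' p'
  set k := hH.branchTransition n hι hproj α' with hk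
  have e1 : ι p ∈ (h.comp k).1.source := ⟨hps, by change h.1 (ι p) ∈ k.1.source; rwa [← hp']⟩
  have e2 : (h.comp k).1 (ι p) = midIncl r n (hH.branch α' p') := by
    change k.1 (h.1 (ι p)) = _
    rw [← hp']
    exact ha
  have hcomp : (evenHeckoid r n).jumpHom h hps hp'.symm ≫ hH.branchHom n hι hproj α' p' hre' =
      (evenHeckoid r n).jumpHom (h.comp k) e1 e2 :=
    OrbAtlas.jumpHom_comp h k hps hp'.symm hm ha e1 e2
  have h1 := hH.isLevel_anchorHom_comp_jumpHom n hι hproj (h.comp k) e1 e2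
  have h2 := hH.isLevel_branchHom n hι hproj (Complex.arg_mem_Ioc _) p' hre'
  have h3 := h1.comp h2.inv
  have h4 : hH.anchorHom n hι hproj o ≫ (evenHeckoid r n).jumpHom h hu hx ≫
      Groupoid.inv (hH.anchorHom n hι hproj o') =
      (hH.anchorHom n hι hproj p ≫ (evenHeckoid r n).jumpHom (h.comp k) e1 e2) ≫
        Groupoid.inv (hH.anchorHom n hι hproj p' ≫ hH.branchHom n hι hproj α' p' hre') := by
    rw [← hcomp, ← hH.anchorHom_comp_pathHom n hι hproj γ,
      ← hH.anchorHom_comp_pathHom n hι hproj δ]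
    simp only [Groupoid.inv_eq_inv, IsIso.inv_comp, Category.assoc, IsIso.hom_inv_id_assoc]
    have h5 : (evenHeckoid r n).jumpHom h hps hp'.symm = Groupoid.inv
        ((evenHeckoid r n).pathHom (γ.map hι.continuous)) ≫
        (evenHeckoid r n).jumpHom h hu hx ≫ (evenHeckoid r n).pathHom (δ.map hι.continuous) := by
      rw [← hs, ← Category.assoc, Groupoid.inv_comp, Category.id_comp]
    rw [h5]
    simp [Groupoid.inv_eq_inv]
  rw [h4]
  exact h3

end IsHandle

/-! ### Surjectivity from the punctured Conway sphere -/

theorem isClosed_range_top (r : ℚ) (n : ℕ) : IsClosed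
    (range (fun o => Sum.inr (Sum.inl o) : OpenHandle → (evenHeckoid r n).dom)) :=
  (IsClosedEmbedding.inr.comp IsClosedEmbedding.inl).isClosed_range

theorem isClosed_range_bot (r : ℚ) (n : ℕ) : IsClosed
    (range (fun o => Sum.inr (Sum.inr o) : OpenHandle → (evenHeckoid r n).dom)) :=
  (IsClosedEmbedding.inr.comp IsClosedEmbedding.inr).isClosed_range

theorem isClosed_range_mid (r : ℚ) (n : ℕ) : IsClosed (range (midIncl r n)) :=
  IsClosedEmbedding.inl.isClosed_range

theorem proj_top_ne_proj_bot (r : ℚ) {n : ℕ} (hn : 0 < n) (o o' : OpenHandle) :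
    (evenHeckoid r n).proj (Sum.inr (Sum.inl o)) ≠ (evenHeckoid r n).proj (Sum.inr (Sum.inr o')) :=
  fun h => proj_top_ne_bot r hn 1 o o' ((congrArg
    (fun f : Quot (Rel 1 r) ≃ₜ Quot (Rel 1 r) => f (Quot.mk _ (topPoint 1 r 1 o)))
    (map_one (deckAction r))).trans h)

section Anchor

variable (r : ℚ) {n : ℕ} (hn : 0 < n)

/-- The point of the middle part from which a chart point is reached. -/
noncomputable def anchor : (evenHeckoid r n).dom → MidPiece :=
  Sum.elim id (Sum.elim (fun _ => (isHandle_topPoint r one_pos).branch 0 handleBase)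
    fun _ => (isHandle_botPoint r hn).branch 0 handleBase)

/-- An arrow from a point of the middle part to a chart point. -/
noncomputable def toAnchor : ∀ u : (evenHeckoid r n).dom,
    (evenHeckoid r n).obj (midIncl r n (anchor r hn u)) ⟶ (evenHeckoid r n).obj u
  | Sum.inl x => 𝟙 ((evenHeckoid r n).obj (midIncl r n x))
  | Sum.inr (Sum.inl o) => (isHandle_topPoint r one_pos).anchorHom n (isOpenEmbedding_top r n)
      (fun _ => rfl) o
  | Sum.inr (Sum.inr o) => (isHandle_botPoint r hn).anchorHom n (isOpenEmbedding_bot r n)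
      (fun _ => rfl) o

/-- An arrow, extended to an arrow between points of the middle part. -/
noncomputable def toMid {u v : (evenHeckoid r n).dom}
    (f : (evenHeckoid r n).obj u ⟶ (evenHeckoid r n).obj v) :
    (evenHeckoid r n).obj (midIncl r n (anchor r hn u)) ⟶
      (evenHeckoid r n).obj (midIncl r n (anchor r hn v)) :=
  toAnchor r hn u ≫ f ≫ Groupoid.inv (toAnchor r hn v)

theorem toMid_comp {u v w : (evenHeckoid r n).dom}
    (f : (evenHeckoid r n).obj u ⟶ (evenHeckoid r n).obj v)
    (g : (evenHeckoid r n).obj v ⟶ (evenHeckoid r n).obj w) :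
    toMid r hn (f ≫ g) = toMid r hn f ≫ toMid r hn g := by
  simp [toMid]

theorem toMid_id (u : (evenHeckoid r n).dom) :
    toMid r hn (𝟙 ((evenHeckoid r n).obj u)) = 𝟙 _ := by
  simp [toMid]

theorem toMid_inv {u v : (evenHeckoid r n).dom}
    (f : (evenHeckoid r n).obj u ⟶ (evenHeckoid r n).obj v) :
    toMid r hn (Groupoid.inv f) = Groupoid.inv (toMid r hn f) := by
  simp [toMid, Groupoid.inv_eq_inv]

theorem toMid_midIncl {x y : MidPiece}
    (f : (evenHeckoid r n).obj (midIncl r n x) ⟶ (evenHeckoid r n).obj (midIncl r n y)) :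
    toMid r hn f = f := by
  change 𝟙 _ ≫ f ≫ Groupoid.inv (𝟙 _) = f
  simp [Groupoid.inv_eq_inv]

theorem isLevel_toMid_midIncl {x y : MidPiece}
    {f : (evenHeckoid r n).obj (midIncl r n x) ⟶ (evenHeckoid r n).obj (midIncl r n y)}
    (h : IsLevel r n f) : IsLevel r n (toMid r hn f) := by
  rw [toMid_midIncl]
  exact h

theorem isLevel_toMid_pathHom {u v : (evenHeckoid r n).dom} (γ : Path u v) :
    IsLevel r n (toMid r hn ((evenHeckoid r n).pathHom γ)) := by
  have key : ∀ {d : Plane} {η : ℝ} {b : ℕ} {H : OpenHandle → TanglePt r} (hH : IsHandle r d η b H)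
      {ι : OpenHandle → (evenHeckoid r n).dom} (hι : IsOpenEmbedding ι)
      (hproj : ∀ o, (evenHeckoid r n).proj (ι o) = Quot.mk _ (H o)) (o o' : OpenHandle)
      (δ : Path o o'), IsLevel r n (hH.anchorHom n hι hproj o ≫
        (evenHeckoid r n).pathHom (δ.map hι.continuous) ≫
        Groupoid.inv (hH.anchorHom n hι hproj o')) := by
    intro d η b H hH ι hι hproj o o' δ
    rw [← Category.assoc, hH.anchorHom_comp_pathHom, Groupoid.comp_inv]
    exact isLevel_id _
  rcases u with x | o | o
  · obtain ⟨y, δ, rfl, hδ⟩ := OrbAtlas.exists_path_lift (ι := midIncl r n) IsOpenEmbedding.inl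
      (isClosed_range_mid r n) γ
    obtain rfl : γ = δ.map (continuous_midIncl r n) := Path.ext (funext hδ)
    exact isLevel_toMid_midIncl r hn (isLevel_pathHom δ)
  · obtain ⟨y, δ, rfl, hδ⟩ := OrbAtlas.exists_path_lift (isOpenEmbedding_top r n)
      (isClosed_range_top r n) (o := o) γ
    obtain rfl : γ = δ.map (isOpenEmbedding_top r n).continuous := Path.ext (funext hδ)
    exact key _ _ _ _ _ _
  · obtain ⟨y, δ, rfl, hδ⟩ := OrbAtlas.exists_path_lift (isOpenEmbedding_bot r n)
      (isClosed_range_bot r n) (o := o) γ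
    obtain rfl : γ = δ.map (isOpenEmbedding_bot r n).continuous := Path.ext (funext hδ)
    exact key _ _ _ _ _ _

theorem isLevel_toMid_jumpHom {u v : (evenHeckoid r n).dom} (h : (evenHeckoid r n).Transition)
    (hu : u ∈ h.1.source) (hv : h.1 u = v) :
    IsLevel r n (toMid r hn ((evenHeckoid r n).jumpHom h hu hv)) := by
  -- A jump from the middle part to a handle is the inverse of a jump from the handle.
  have hinv : ∀ {u v : (evenHeckoid r n).dom} (h : (evenHeckoid r n).Transition)
      (hu : u ∈ h.1.source) (hv : h.1 u = v),
      (∀ hu' hv', IsLevel r n (toMid r hn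
        ((evenHeckoid r n).jumpHom h.symm (u := v) (v := u) hu' hv'))) →
      IsLevel r n (toMid r hn ((evenHeckoid r n).jumpHom h hu hv)) := by
    intro u v h hu hv H
    have hu' : v ∈ h.symm.1.source := hv ▸ h.1.map_source hu
    have hv' : h.symm.1 v = u := hv ▸ h.1.left_inv hu
    have e : (evenHeckoid r n).jumpHom h hu hv =
        Groupoid.inv ((evenHeckoid r n).jumpHom h.symm hu' hv') := by
      rw [← cancel_mono ((evenHeckoid r n).jumpHom h.symm hu' hv'), Groupoid.inv_comp,
        OrbAtlas.jumpHom_comp_symm]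
    rw [e, toMid_inv]
    exact (H hu' hv').inv
  have hT := isHandle_topPoint r one_pos
  have hB := isHandle_botPoint r hn
  have hmid : ∀ {u : (evenHeckoid r n).dom} {x : MidPiece} (h : (evenHeckoid r n).Transition)
      (hu : u ∈ h.1.source) (hv : h.1 u = midIncl r n x),
      IsLevel r n (toMid r hn ((evenHeckoid r n).jumpHom h hu hv)) := by
    intro u x h hu hv
    have e : toMid r hn ((evenHeckoid r n).jumpHom h hu hv) =
        toAnchor r hn u ≫ (evenHeckoid r n).jumpHom h hu hv := by
      change _ ≫ _ ≫ Groupoid.inv (𝟙 ((evenHeckoid r n).obj (midIncl r n x))) = _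
      rw [Groupoid.inv_eq_inv, IsIso.inv_id]
      exact congrArg (toAnchor r hn u ≫ ·) (Category.comp_id _)
    rcases u with y | o | o
    · exact isLevel_toMid_midIncl r hn (isLevel_jumpHom (x := y) h hu hv)
    · rw [e]
      exact hT.isLevel_anchorHom_comp_jumpHom n _ _ h hu hv
    · rw [e]
      exact hB.isLevel_anchorHom_comp_jumpHom n _ _ h hu hv
  rcases v with x | o' | o'
  · exact hmid h hu hv
  · rcases u with y | o | o
    · exact hinv h hu hv fun hu' hv' => hmid h.symm hu' hv'
    · exact hT.isLevel_anchorHom_comp_jumpHom_inv n _ _ (isClosed_range_top r n) h hu hv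
    · exact absurd (hv ▸ h.2 _ hu) (proj_top_ne_proj_bot r hn o' o)
  · rcases u with y | o | o
    · exact hinv h hu hv fun hu' hv' => hmid h.symm hu' hv'
    · exact absurd (hv ▸ h.2 _ hu).symm (proj_top_ne_proj_bot r hn o o')
    · exact hB.isLevel_anchorHom_comp_jumpHom_inv n _ _ (isClosed_range_bot r n) h hu hv

theorem isLevel_toMid {u v : (evenHeckoid r n).dom}
    (f : (evenHeckoid r n).obj u ⟶ (evenHeckoid r n).obj v) : IsLevel r n (toMid r hn f) := by
  refine OrbAtlas.hom_induction (P := fun f => IsLevel r n (toMid r hn f)) (fun u => ?_)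
    (fun f γ ih => ?_) (fun f h hv hw ih => ?_) f
  · rw [toMid_id]
    exact isLevel_id _
  · rw [toMid_comp]
    exact ih.comp (isLevel_toMid_pathHom r hn γ)
  · rw [toMid_comp]
    exact ih.comp (isLevel_toMid_jumpHom r hn h hv hw)

include hn in
/-- The punctured Conway sphere carries the fundamental group of the even Heckoid orbifold. -/
theorem levelHom_surjective {v v' : PuncturedPlane}
    (f : (evenHeckoid r n).obj (midIncl r n (v, levelZero)) ⟶
      (evenHeckoid r n).obj (midIncl r n (v', levelZero))) : ∃ g, levelHom r n g = f := by
  have h : IsLevel r n f := by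
    have := isLevel_toMid r hn f
    rw [toMid_midIncl] at this
    exact this
  obtain ⟨g, hg⟩ := h
  rw [vertical_levelZero, vertical_levelZero, Category.id_comp,
    Category.comp_id] at hg
  exact ⟨g, hg.symm⟩

end Anchor

/-! ### The covering of the quotient orbifold -/

instance : PathConnectedSpace PuncturedPlane :=
  have h : {v : Plane | IsLattice v}.Countable :=
    countable_half_lattice.mono fun _ => isLattice_two_smul
  isPathConnected_iff_pathConnectedSpace.1
    (h.isPathConnected_compl_of_one_lt_rank one_lt_rank_plane)

/-- An arrow from a point of the level `0` to a chart point. -/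
noncomputable def levelTo (r : ℚ) {n : ℕ} (hn : 0 < n) (v : PuncturedPlane)
    (u : (evenHeckoid r n).dom) :
    (evenHeckoid r n).obj (midIncl r n (v, levelZero)) ⟶ (evenHeckoid r n).obj u :=
  levelHom r n (puncturedConway.pathHom (PathConnectedSpace.somePath v (anchor r hn u).1)) ≫
    vertical r n (anchor r hn u) ≫ toAnchor r hn u

theorem map_comp_aux (r : ℚ) (n : ℕ) {u v w : PuncturedPlane}
    (f : puncturedConway.obj u ⟶ puncturedConway.obj v)
    (g : puncturedConway.obj v ⟶ puncturedConway.obj w)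
    (hf : (heckoidCovering r n).functor.map (levelHom r n f) =
      (levelInclusion (1 / 2) r 2 (2 * n)).functor.map (conwayToO.functor.map f))
    (hg : (heckoidCovering r n).functor.map (levelHom r n g) =
      (levelInclusion (1 / 2) r 2 (2 * n)).functor.map (conwayToO.functor.map g)) :
    (heckoidCovering r n).functor.map (levelHom r n (f ≫ g)) =
      (levelInclusion (1 / 2) r 2 (2 * n)).functor.map (conwayToO.functor.map (f ≫ g)) := by
  refine ((congrArg _ (levelHom_comp r n f g)).trans
    ((heckoidCovering r n).functor.map_comp _ _)).trans ?_
  refine Eq.trans ?_ ((congrArg _ (conwayToO.functor.map_comp f g)).trans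
    ((levelInclusion (1 / 2) r 2 (2 * n)).functor.map_comp _ _)).symm
  exact congrArg₂ (· ≫ ·) hf hg

theorem map_levelHom_id (r : ℚ) (n : ℕ) (u : PuncturedPlane) :
    (heckoidCovering r n).functor.map (levelHom r n (𝟙 (puncturedConway.obj u))) =
      (levelInclusion (1 / 2) r 2 (2 * n)).functor.map
        (conwayToO.functor.map (𝟙 (puncturedConway.obj u))) := by
  refine ((congrArg _ (levelHom_id r n u)).trans
      ((heckoidCovering r n).functor.map_id _)).trans ?_
  exact (((congrArg _ (conwayToO.functor.map_id (puncturedConway.obj u))).trans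
      ((levelInclusion (1 / 2) r 2 (2 * n)).functor.map_id _))).symm

theorem map_levelHom_pathHom (r : ℚ) (n : ℕ) {u v : PuncturedPlane} (γ : Path u v) :
    (heckoidCovering r n).functor.map (levelHom r n (puncturedConway.pathHom γ)) =
      (levelInclusion (1 / 2) r 2 (2 * n)).functor.map
        (conwayToO.functor.map (puncturedConway.pathHom γ)) := by
  have h1 : levelHom r n (puncturedConway.pathHom γ) = (evenHeckoid r n).pathHom
      (γ.map (levelInclusion 1 r 1 n).continuous_lift) :=
    OrbAtlas.Hom.functor_map_pathHom _ _
  have h2 := (heckoidCovering r n).functor_map_pathHom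
    (γ.map (levelInclusion 1 r 1 n).continuous_lift)
  have h3 := conwayToO.functor_map_pathHom γ
  have h4 := (levelInclusion (1 / 2) r 2 (2 * n)).functor_map_pathHom
    (γ.map conwayToO.continuous_lift)
  exact ((congrArg _ h1).trans h2).trans ((congrArg _ h3).trans h4).symm

theorem conwayToO_onJump_apply (h : puncturedConway.Transition) {v : PuncturedPlane}
    (hv : v ∈ h.1.source) :
    @Eq PuncturedPlane ((conwayToO.onJump h).1 v) (h.1 v) :=
  conwayToO.onJump_lift h v hv

theorem heckoidCovering_onJump_apply (r : ℚ) (n : ℕ) (h : (evenHeckoid r n).Transition)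
    {w : MidPiece ⊕ (OpenHandle ⊕ OpenHandle)} (hw : w ∈ h.1.source) :
    @Eq (MidPiece ⊕ (OpenHandle ⊕ OpenHandle)) (((heckoidCovering r n).onJump h).1 w) (h.1 w) :=
  (heckoidCovering r n).onJump_lift h w hw

theorem levelInclusion_onJump_apply (c : ℝ) (r : ℚ) (a b : ℕ) (h : (planeQuotient c).Transition)
    (x : MidPiece) :
    @Eq (MidPiece ⊕ (OpenHandle ⊕ OpenHandle)) (((levelInclusion c r a b).onJump h).1 (Sum.inl x))
      (Sum.inl (h.1 x.1, x.2)) := rfl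

/-- Both composites attach to a change of charts of the sphere its product with the interval. -/
theorem onJump_eventuallyEq (r : ℚ) (n : ℕ) {u : PuncturedPlane} (h : puncturedConway.Transition)
    (hu : u ∈ h.1.source) :
    ∀ᶠ w : MidPiece ⊕ (OpenHandle ⊕ OpenHandle) in 𝓝 (Sum.inl (u, levelZero)),
      @Eq (MidPiece ⊕ (OpenHandle ⊕ OpenHandle))
        (((heckoidCovering r n).onJump ((levelInclusion 1 r 1 n).onJump h)).1 w)
        (((levelInclusion (1 / 2) r 2 (2 * n)).onJump (conwayToO.onJump h)).1 w) := by
  have hemb : IsOpenEmbedding (Sum.inl : MidPiece → MidPiece ⊕ (OpenHandle ⊕ OpenHandle)) :=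
    IsOpenEmbedding.inl
  rw [← hemb.map_nhds_eq]
  refine Filter.eventually_map.2 ?_
  have hev : ∀ᶠ x : MidPiece in 𝓝 (u, levelZero), x.1 ∈ h.1.source :=
    continuous_fst.continuousAt.eventually (h.1.open_source.mem_nhds hu)
  filter_upwards [hev] with x hx
  refine (heckoidCovering_onJump_apply r n ((levelInclusion 1 r 1 n).onJump h)
    ((mem_thicken_source h.1 _).2 ⟨x, rfl, hx⟩)).trans ?_
  refine (levelInclusion_onJump_apply 1 r 1 n h x).trans
    (Eq.trans ?_ (levelInclusion_onJump_apply (1 / 2) r 2 (2 * n) (conwayToO.onJump h) x).symm)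
  exact congrArg
    (fun v : PuncturedPlane => (Sum.inl (v, x.2) : MidPiece ⊕ (OpenHandle ⊕ OpenHandle)))
    (conwayToO_onJump_apply h hx).symm

theorem map_levelHom_jumpHom (r : ℚ) (n : ℕ) {u v : PuncturedPlane}
    (h : puncturedConway.Transition) (hu : u ∈ h.1.source) (hv : h.1 u = v) :
    (heckoidCovering r n).functor.map (levelHom r n (puncturedConway.jumpHom h hu hv)) =
      (levelInclusion (1 / 2) r 2 (2 * n)).functor.map
        (conwayToO.functor.map (puncturedConway.jumpHom h hu hv)) := by
  have hu1 := (levelInclusion 1 r 1 n).mem_source h _ hu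
  have hv1 := ((levelInclusion 1 r 1 n).onJump_lift h _ hu).trans
    (congrArg (levelInclusion 1 r 1 n).lift hv)
  have hu3 := conwayToO.mem_source h _ hu
  have hv3 := (conwayToO.onJump_lift h _ hu).trans (congrArg conwayToO.lift hv)
  have h1 : levelHom r n (puncturedConway.jumpHom h hu hv) =
      (evenHeckoid r n).jumpHom ((levelInclusion 1 r 1 n).onJump h) hu1 hv1 :=
    OrbAtlas.Hom.functor_map_jumpHom _ h hu hv
  have h2 := (heckoidCovering r n).functor_map_jumpHom ((levelInclusion 1 r 1 n).onJump h) hu1 hv1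
  have h3 := conwayToO.functor_map_jumpHom h hu hv
  have h4 := (levelInclusion (1 / 2) r 2 (2 * n)).functor_map_jumpHom (conwayToO.onJump h) hu3 hv3
  have key := OrbAtlas.jumpHom_germ (X := quotientHeckoid r (2 * n))
    (u := Sum.inl (u, levelZero)) (v := Sum.inl (v, levelZero))
    ((heckoidCovering r n).onJump ((levelInclusion 1 r 1 n).onJump h))
    ((levelInclusion (1 / 2) r 2 (2 * n)).onJump (conwayToO.onJump h))
    ((heckoidCovering r n).mem_source _ _ hu1)
    (((heckoidCovering r n).onJump_lift _ _ hu1).trans (congrArg (heckoidCovering r n).lift hv1))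
    ((levelInclusion (1 / 2) r 2 (2 * n)).mem_source _ _ hu3)
    (((levelInclusion (1 / 2) r 2 (2 * n)).onJump_lift _ _ hu3).trans
      (congrArg (levelInclusion (1 / 2) r 2 (2 * n)).lift hv3))
    (onJump_eventuallyEq r n h hu)
  exact ((congrArg _ h1).trans h2).trans (key.trans ((congrArg _ h3).trans h4).symm)

/-- The natural maps from the punctured Conway sphere to the quotient orbifold, through the even
Heckoid orbifold and through the `(2,2,2,∞)`-orbifold, agree on the fundamental groupoids. -/
theorem map_levelHom (r : ℚ) (n : ℕ) {u v : PuncturedPlane}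
    (g : puncturedConway.obj u ⟶ puncturedConway.obj v) :
    (heckoidCovering r n).functor.map (levelHom r n g) =
      (levelInclusion (1 / 2) r 2 (2 * n)).functor.map (conwayToO.functor.map g) := by
  refine OrbAtlas.hom_induction (X := puncturedConway) (P := fun g =>
    (heckoidCovering r n).functor.map (levelHom r n g) =
      (levelInclusion (1 / 2) r 2 (2 * n)).functor.map (conwayToO.functor.map g))
    (fun u => ?_) (fun {u v w} f γ ih => ?_) (fun {u v w} f h hv hw ih => ?_) g
  · exact map_levelHom_id r n u
  · exact map_comp_aux r n f _ ih (map_levelHom_pathHom r n γ)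
  · exact map_comp_aux r n f _ ih (map_levelHom_jumpHom r n h hv hw)

/-- The quotient orbifold has the chart domains of the even Heckoid orbifold, and its chart maps are
the quotients of those of the latter by the whole group `(ℤ/2)²`. -/
theorem isOrbifold_quotientHeckoid (r : ℚ) {n : ℕ} (hn : 0 < n) :
    (quotientHeckoid r (2 * n)).IsOrbifold 3 := by
  have hX := isGoodAction_deckAction r hn
  have : T2Space (quotientHeckoid r (2 * n)).carrier := t2Space (c := 1 / 2) (by norm_num) r
  have hq : (quotientHeckoid r (2 * n)).proj = fun u : (evenHeckoid r n).dom =>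
      halfQuot r ((evenHeckoid r n).proj u) := funext fun u => proj_quotientHeckoid r n u
  have hp := halfQuot_eq_iff (r := r)
  refine hX.isOrbifold_withProj (q := (quotientHeckoid r (2 * n)).proj) ⊤ ?_ ?_ ?_ ?_
  · intro u v
    rw [hq]
    refine (hp _ _).trans ⟨fun ⟨γ, h⟩ => ⟨γ, trivial, h⟩, fun ⟨γ, _, h⟩ => ⟨γ, h⟩⟩
  · rw [hq]
    exact (continuous_halfQuot r).comp hX.continuous_proj
  · rw [hq]
    exact (OrbAtlas.isOpenMap_of_fibres hp (isQuotientMap_halfQuot r)).comp hX.isOpenMap_proj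
  · rw [hq]
    exact (surjective_halfQuot r).comp hX.surjective_proj

theorem proposition3p1 (r : ℚ) (n : ℕ) (hn : 1 < n) :
    (evenHeckoid r n).IsOrbifold 3 ∧ (quotientHeckoid r (2 * n)).IsOrbifold 3 ∧
    OrbAtlas.IsRegularCovering 3 (Multiplicative (ZMod 2 × ZMod 2)) (heckoidCovering r n).base ∧
    ∀ u : PuncturedPlane,
      Function.Injective ((heckoidCovering r n).pi1Map (Sum.inl (u, levelZero))) ∧
      ((heckoidCovering r n).pi1Map (Sum.inl (u, levelZero))).range = (psi r (2 * n) u).range := by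
  have hn0 : 0 < n := by omega
  have hX := isGoodAction_deckAction r hn0
  have hp := halfQuot_eq_iff (r := r)
  have hpq : ∀ u : (evenHeckoid r n).dom, (quotientHeckoid r (2 * n)).proj u =
      halfQuot r ((evenHeckoid r n).proj u) := proj_quotientHeckoid r n
  refine ⟨hX.isOrbifold, isOrbifold_quotientHeckoid r hn0, ?_, fun u => ⟨?_, ?_⟩⟩
  · have : Nonempty (evenHeckoid r n).carrier :=
      ⟨(evenHeckoid r n).proj (Sum.inr (Sum.inl handleBase))⟩
    exact hX.isRegularCovering (q := (quotientHeckoid r (2 * n)).proj) hp hpq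
      (continuous_halfQuot r) (surjective_halfQuot r)
  · obtain ⟨t, h1, ht⟩ := exists_chart_action r hn0
    exact OrbAtlas.pi1Map_toWithProj_injective (X := evenHeckoid r n)
      (ρ := deckAction r) t ht (levelTo r hn0 u) hX
      (q := (quotientHeckoid r (2 * n)).proj)
      (fun v w h => (hp _ _).1 ((hpq v).symm.trans (h.trans (hpq w)))) h1 (halfQuot r) hpq _
  · refine le_antisymm ?_ ?_
    · rintro _ ⟨f, rfl⟩
      obtain ⟨g, rfl⟩ := levelHom_surjective r hn0 f
      exact ⟨g, (map_levelHom r n g).symm⟩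
    · rintro _ ⟨g, rfl⟩
      exact ⟨levelHom r n g, map_levelHom r n g⟩
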